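/- \textbf{Setting.} Let $D, K, M \ge 1$ be integers and let $(X,Y)$ be a random pair with values in $\mathbb{R}^D\times\{1,\dots,K\}$. Let $T$ be any real function of a vector of class proportions (the impurity criterion, e.g. Shannon entropy or Gini index), let $B_1,B_2\ge 0$ be fixed, let $k=k_n$ be integers (minimum leaf size), and let $s_n\le n$ be integers with $s_n/(n-s_n)\to\rho$ for some $\rho\in(0,\infty)$ (partition rate). \textbf{The multinomial random forest.} It is trained on $n$ independent copies of $(X,Y)$. For each of its $M$ trees, independently given the training set, the training set is divided uniformly at random into $s_n$ structure points and $n-s_n$ estimation points, and nodes are split recursively, starting from the root, as follows. At a node, the possible split values of feature $j$ are the values of feature $j$ observed among the structure points of the node, except the largest one; a split at $v$ sends the points with $x_j\le v$ to the left and the others to the right. The impurity decrease of a split is the impurity $T$ of the class proportions of the structure points of the node, minus the average of the impurities of the structure points of the two children, weighted by their proportions. Let $I_{v,j}$ be the impurity decrease of the split $(j,v)$ and $I_j=\max_v I_{v,j}$. Among the features that have a possible split value, a feature $j$ is drawn with probability proportional to $\exp(\tfrac{B_1}{2}\hat I_j)$; then one of its possible split values $v$ is drawn with probability proportional to $\exp(\tfrac{B_2}{2}\hat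 I_{v,j})$, where hats denote min-max normalization to $[0,1]$ (over the features, respectively over the split values of feature $j$; all normalized values are $0$ if the values are all equal). The node is split by $(j,v)$ if both children contain at least $k$ estimation points; otherwise, or if there is no possible split, it becomes a leaf. At a point $x$, let $\eta^{(c)}(x)$ be the proportion of label $c$ among the estimation points in the leaf containing $x$ ($0$ if there are none); the tree predicts a random label, equal to $c$ with probability proportional to $\exp(\tfrac{B_3}{2}\eta^{(c)}(x))$. For $B_3=\infty$ it predicts a label that maximizes $\eta^{(c)}(x)$, with uniform tie-breaking. The forest predicts a label that receives the largest number of votes among the $M$ trees, with any tie-breaking rule. \textbf{Theorem.} Assume that $X$ is supported on $[0,1]^D$ and has a density which is nonzero almost everywhere on $[0,1]^D$. Suppose that $k_n\to\infty$ and $k_n/n\to 0$ as $n\to\infty$. Then the multinomial random forest is consistent as $B_3\to\infty$: for every sequence $B_3=B_{3,n}\to\infty$, and also for $B_3=\infty$, its expected error probability on an independent copy of $(X,Y)$ converges, as $n\to\infty$, to the Bayes risk $\inf_g \Pr(g(X)\ne Y)$, the infimum being over measurable classifiers $g$. (For a non-root node the split values lie strictly inside the range of the split feature in the node, and at the root they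 do so almost surely. Hence the distribution function of the split point, normalized to the range of the node, has no jump at $0$ or at $1$, and no separate assumption of right-continuity at $0$ and left-continuity at $1$ is needed.) -/

import Mathlib

open Filter Topology MeasureTheory
open scoped ENNReal

namespace MRF

/-- A labelled sample of size `n`: the `i`-th point has feature vector `(d i).1 ∈ ℝ^D`
and label `(d i).2 ∈ {0, …, K-1}`. -/
abbrev Sample (D K n : ℕ) : Type := Fin n → (Fin D → ℝ) × Fin K

/-! ### The randomized selections -/

open Classical in
/-- The probability law on the finite set `s` that selects `a ∈ s` with probability
proportional to `exp (B * u a / 2)`, i.e. the law `softmax (B / 2 * u)` on `s`. -/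
noncomputable def expMech {α : Type} (s : Finset α) (hs : s.Nonempty) (B : ℝ) (u : α → ℝ) :
    PMF α :=
  PMF.ofFinset
    (fun a => if a ∈ s then
      ENNReal.ofReal (Real.exp (B / 2 * u a) / ∑ b ∈ s, Real.exp (B / 2 * u b)) else 0) s
    (by
      have hpos : 0 < ∑ b ∈ s, Real.exp (B / 2 * u b) :=
        Finset.sum_pos (fun b _ => Real.exp_pos _) hs
      rw [Finset.sum_congr rfl (fun a ha => if_pos ha),
        ← ENNReal.ofReal_sum_of_nonneg (fun a _ => by positivity), ← Finset.sum_div,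
        div_self hpos.ne', ENNReal.ofReal_one])
    (fun a ha => if_neg ha)

/-- Min-max normalization of the scores `u` over the finite set `s`. If all the scores are equal,
the normalized scores are all `0` (and then `expMech` is uniform on `s`). -/
noncomputable def minMax {α : Type} (s : Finset α) (hs : s.Nonempty) (u : α → ℝ) (a : α) : ℝ :=
  (u a - s.inf' hs u) / (s.sup' hs u - s.inf' hs u)

/-- The labels that maximize `η`. -/
noncomputable def argmaxLabels {K : ℕ} (η : Fin K → ℝ) : Finset (Fin K) := by
  classical exact Finset.univ.filter (fun c => ∀ c', η c' ≤ η c)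

theorem argmaxLabels_nonempty {K : ℕ} [NeZero K] (η : Fin K → ℝ) :
    (argmaxLabels η).Nonempty := by
  obtain ⟨c, -, hc⟩ := Finset.exists_max_image Finset.univ η Finset.univ_nonempty
  exact ⟨c, by simpa [argmaxLabels] using hc⟩

/-- Randomized label of a leaf whose empirical class probabilities are `η`: label `c` is drawn
with probability proportional to `exp (B₃ * η c / 2)`. -/
noncomputable def randomLabel {K : ℕ} [NeZero K] (B₃ : ℝ) (η : Fin K → ℝ) : PMF (Fin K) :=
  expMech Finset.univ Finset.univ_nonempty B₃ η

/-- Majority label of a leaf whose empirical class probabilities are `η`, with uniform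
tie-breaking. This is the limit of `randomLabel B₃ η` as `B₃ → ∞`. -/
noncomputable def majorityLabel {K : ℕ} [NeZero K] (η : Fin K → ℝ) : PMF (Fin K) :=
  PMF.uniformOfFinset (argmaxLabels η) (argmaxLabels_nonempty η)

/-! ### Splitting a node

A node is represented by the set of indices of the points of the sample that fall in it. -/

variable {D K n : ℕ}

/-- The points of `A` sent to the left child by the split of feature `j` at value `v`. -/
noncomputable def left (d : Sample D K n) (A : Finset (Fin n)) (j : Fin D) (v : ℝ) :
    Finset (Fin n) := A.filter (fun i => (d i).1 j ≤ v)

/-- The points of `A` sent to the right child by the split of feature `j` at value `v`. -/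
noncomputable def right (d : Sample D K n) (A : Finset (Fin n)) (j : Fin D) (v : ℝ) :
    Finset (Fin n) := A.filter (fun i => v < (d i).1 j)

/-- The empirical class probabilities in the set `A` of points (`0` if `A` is empty). -/
noncomputable def classFreq (d : Sample D K n) (A : Finset (Fin n)) (c : Fin K) : ℝ :=
  ((A.filter (fun i => (d i).2 = c)).card : ℝ) / (A.card : ℝ)

/-- The impurity decrease at a node with structure points `S` caused by the split of feature `j`
at `v`. The impurity of a set of points is `T` applied to its empirical class probabilities. -/
noncomputable def impurityDecrease (T : (Fin K → ℝ) → ℝ) (d : Sample D K n)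
    (S : Finset (Fin n)) (j : Fin D) (v : ℝ) : ℝ :=
  T (classFreq d S)
    - ((left d S j v).card : ℝ) / (S.card : ℝ) * T (classFreq d (left d S j v))
    - ((right d S j v).card : ℝ) / (S.card : ℝ) * T (classFreq d (right d S j v))

/-- The possible split values of feature `j` at a node with structure points `S`: the values of
the feature that are observed in `S` and for which both children contain points of `S`
(that is, all the observed values except the largest). -/
noncomputable def splitValues (d : Sample D K n) (S : Finset (Fin n)) (j : Fin D) : Finset ℝ := by
  classical exact (S.image (fun i => (d i).1 j)).filter (fun v => (right d S j v).Nonempty)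

/-- The features that have at least one possible split value at the node. -/
noncomputable def splitFeatures (d : Sample D K n) (S : Finset (Fin n)) : Finset (Fin D) := by
  classical exact Finset.univ.filter (fun j => (splitValues d S j).Nonempty)

/-- The largest possible impurity decrease of feature `j` (used only for `j ∈ splitFeatures`). -/
noncomputable def bestDecrease (T : (Fin K → ℝ) → ℝ) (d : Sample D K n)
    (S : Finset (Fin n)) (j : Fin D) : ℝ := by
  classical exact
    if h : (splitValues d S j).Nonempty then
      (splitValues d S j).sup' h (impurityDecrease T d S j)
    else 0

/-! ### Trees -/

/-- Binary trees with axis-parallel splits: `node j v l r` sends `x` to `l` if `x j ≤ v` and to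
`r` otherwise. -/
inductive Tree (D : ℕ) : Type
  | leaf : Tree D
  | node (j : Fin D) (v : ℝ) (l r : Tree D) : Tree D

/-- The points of `A` that lie in the same leaf of the tree as `x`. -/
noncomputable def Tree.leafPoints (d : Sample D K n) (x : Fin D → ℝ) :
    Tree D → Finset (Fin n) → Finset (Fin n)
  | .leaf, A => A
  | .node j v l r, A =>
      if x j ≤ v then l.leafPoints d x (left d A j v) else r.leafPoints d x (right d A j v)

open Classical in
/-- The law of the tree grown from structure points `S` and estimation points `E`.
A split feature, then a split value are drawn by the two impurity-based multinomial laws, computed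
from `S` only. The node is split if both children then contain at least `k` estimation points;
otherwise, or if there is no possible split point, it becomes a leaf. The first numerical argument
is a bound on the depth: every split separates points of `S`, so that the bound never acts if it is
at least the cardinality of `S`. -/
noncomputable def grow (T : (Fin K → ℝ) → ℝ) (B₁ B₂ : ℝ) (k : ℕ) (d : Sample D K n) :
    ℕ → Finset (Fin n) → Finset (Fin n) → PMF (Tree D)
  | 0, _, _ => PMF.pure Tree.leaf
  | m + 1, S, E =>
      if hF : (splitFeatures d S).Nonempty then
        (expMech (splitFeatures d S) hF B₁
            (minMax (splitFeatures d S) hF (bestDecrease T d S))).bind fun j =>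
          if hV : (splitValues d S j).Nonempty then
            (expMech (splitValues d S j) hV B₂
                (minMax (splitValues d S j) hV (impurityDecrease T d S j))).bind fun v =>
              if k ≤ (left d E j v).card ∧ k ≤ (right d E j v).card then
                (grow T B₁ B₂ k d m (left d S j v) (left d E j v)).bind fun l =>
                  (grow T B₁ B₂ k d m (right d S j v) (right d E j v)).map fun r =>
                    Tree.node j v l r
              else PMF.pure Tree.leaf
          else PMF.pure Tree.leaf
      else PMF.pure Tree.leaf

/-- The law of the random choice of `s` structure points among `n` points (the other points are the
estimation points): uniform on the subsets of cardinality `s`. -/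
noncomputable def structureSet (n s : ℕ) (hs : s ≤ n) : PMF (Finset (Fin n)) :=
  PMF.uniformOfFinset (Finset.powersetCard s Finset.univ)
    (Finset.powersetCard_nonempty.2 (by simpa using hs))

/-- The law, given the training set `d`, of the label that one random tree predicts at `x`: draw
the partition of the training set, grow the tree, and label the leaf of `x` by `rule` applied to
the empirical class probabilities of the estimation points of that leaf. -/
noncomputable def treePrediction (T : (Fin K → ℝ) → ℝ) (B₁ B₂ : ℝ) (k s : ℕ) (hs : s ≤ n)
    (rule : (Fin K → ℝ) → PMF (Fin K)) (d : Sample D K n) (x : Fin D → ℝ) : PMF (Fin K) :=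
  (structureSet n s hs).bind fun S =>
    (grow T B₁ B₂ k d n S Sᶜ).bind fun t =>
      rule (classFreq d (t.leafPoints d x Sᶜ))

/-! ### The forest and its error -/

/-- `vote` is a majority vote over `M` predicted labels: it returns a label of maximal
multiplicity (ties being broken in any way). -/
def IsMajorityVote {M : ℕ} (vote : (Fin M → Fin K) → Fin K) : Prop :=
  ∀ (h : Fin M → Fin K) (c : Fin K),
    (Finset.univ.filter (fun i => h i = c)).card ≤
      (Finset.univ.filter (fun i => h i = vote h)).card

/-- The probability that the vote over `M` independent predictions of law `q` differs
from `y`. -/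
noncomputable def voteError {M : ℕ} (vote : (Fin M → Fin K) → Fin K) (q : PMF (Fin K))
    (y : Fin K) : ℝ≥0∞ :=
  ∑ h : Fin M → Fin K, if vote h = y then 0 else ∏ i, q (h i)

/-- The expected error probability of the forest of `M` trees trained on `n` independent points of
law `P`, of which `s` are structure points for each tree. Given the training set, the trees (with
their partitions of the training set and their label draws) are independent. -/
noncomputable def expectedError {M : ℕ} (P : Measure ((Fin D → ℝ) × Fin K))
    (T : (Fin K → ℝ) → ℝ) (B₁ B₂ : ℝ) (vote : (Fin M → Fin K) → Fin K)
    (rule : (Fin K → ℝ) → PMF (Fin K)) (n k s : ℕ) (hs : s ≤ n) : ℝ≥0∞ :=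
  ∫⁻ d : Sample D K n,
    ∫⁻ z, voteError vote (treePrediction T B₁ B₂ k s hs rule d z.1) z.2 ∂P
      ∂(Measure.pi fun _ : Fin n => P)

/-- The Bayes risk of `P`: the smallest error probability of a classifier. -/
noncomputable def bayesRisk (P : Measure ((Fin D → ℝ) × Fin K)) : ℝ≥0∞ :=
  ⨅ (g : (Fin D → ℝ) → Fin K) (_ : Measurable g), P {z | g z.1 ≠ z.2}

end MRF

namespace MRF

/-! ### Expectations under discrete laws -/

/-! Let `eta` be the regression function. The label returned by a majority vote is the label of at
least one tree, so the excess risk of the forest at `x` is at most the sum of the excess risks of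
its `M` trees (`lintegral_voteError_le`). The excess of one tree is at most the slack of the
labelling rule plus twice the sum over labels of |leaf frequency - `eta`| (`expect_gap_le`); the
slack is 0 for the majority label and at most `2K / B₃` for the exponential rule. The Bayes risk
being a lower bound for every forest, it remains to show that the `L¹` error `labelError` is small.
Inserting the conditional label probability `cellProb` of the leaf splits it into a deviation and a
bias (`labelError_le`).

Splits are drawn from the structure points alone, so the tree is obtained from `fullTree`, which
does not see the estimation points, by pruning (`expect_grow`). Given the structure points, the
estimation points are therefore a fresh sample for a fixed unpruned tree.

Deviation. Given the number of estimation points in a cell, the class frequency concentrates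
exponentially. Whether a node is a leaf depends on the positions of these points, so the bound
cannot be applied on the event that a node is a leaf. Instead the deviation probabilities of all the
nodes along a root-to-leaf path are added. Every split that is kept removes at least `k` points from
the node, so the sum is dominated by a geometric series with first term of order `exp(-ε²k/4)`,
whatever the depth of the tree and the number of its leaves (`lintegral_mul_leafSum_devCost_le`).
This is why `k → ∞` suffices.

Bias. Up to an `L¹` error, `eta` is uniformly continuous, hence nearly constant on narrow leaves. A
leaf that is not narrow contains, in some coordinate, one interval of a fixed finite grid. So it
suffices that for a fixed coordinate `j` and interval `[q, q + w]` the leaves spanning the interval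
have small expected total volume (`leafSum_biasCost_le`). Min-max normalized scores lie in `[0, 1]`,
so every candidate is drawn with a probability within constant factors of the uniform one, whatever
the impurity and the labels. Hence an unbalanced split, one child of which has a share below `κ`,
has probability `O(κ)`, and a node with a positive share of its points in the slab is cut there with
probability at least some `p > 0`. After `H` levels the spanning volume is at most `(1 - p)^H +
O(Hκ)`, up to boxes on which the density is badly behaved, and these are dominated by an additive
weight (`expect_leafSum_spanCost_le`). The positive share comes from a uniform law of large numbers
on boxes (`exists_measure_not_isUniform_le`). During these `H` balanced levels the minimum leaf size
never acts, because the nodes keep a fixed fraction of the estimation points and `k / n → 0`. -/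

/-- The expectation of `F` under the discrete law `p`. -/
noncomputable def expect {α : Type*} (p : PMF α) (F : α → ℝ≥0∞) : ℝ≥0∞ := ∑' a, p a * F a

section expect

variable {α β : Type*}

theorem expect_pure (a : α) (F : α → ℝ≥0∞) : expect (PMF.pure a) F = F a := by
  unfold expect
  rw [tsum_eq_single a]
  · simp
  · intro b hb
    simp [PMF.pure_apply, hb]

theorem expect_bind (p : PMF α) (q : α → PMF β) (F : β → ℝ≥0∞) :
    expect (p.bind q) F = expect p fun a => expect (q a) F := by
  unfold expect
  simp_rw [PMF.bind_apply, ← ENNReal.tsum_mul_right, ← ENNReal.tsum_mul_left]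
  rw [ENNReal.tsum_comm]
  simp_rw [mul_assoc]

theorem expect_map (p : PMF α) (g : α → β) (F : β → ℝ≥0∞) :
    expect (p.map g) F = expect p (F ∘ g) := by
  rw [PMF.map, expect_bind]
  simp [Function.comp_def, expect_pure]

theorem expect_mono_support {p : PMF α} {F G : α → ℝ≥0∞} (h : ∀ a ∈ p.support, F a ≤ G a) :
    expect p F ≤ expect p G := by
  refine ENNReal.tsum_le_tsum fun a => ?_
  by_cases ha : p a = 0
  · simp [ha]
  · exact mul_le_mul_right (h a ha) _

theorem expect_mono {p : PMF α} {F G : α → ℝ≥0∞} (h : ∀ a, F a ≤ G a) :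
    expect p F ≤ expect p G := expect_mono_support fun a _ => h a

theorem expect_congr {p : PMF α} {F G : α → ℝ≥0∞} (h : ∀ a, F a = G a) :
    expect p F = expect p G := by
  rw [funext h]

theorem expect_const (p : PMF α) (c : ℝ≥0∞) : expect p (fun _ => c) = c := by
  unfold expect
  rw [ENNReal.tsum_mul_right, p.tsum_coe, one_mul]

theorem expect_add (p : PMF α) (F G : α → ℝ≥0∞) :
    expect p (fun a => F a + G a) = expect p F + expect p G := by
  unfold expect
  simp_rw [mul_add]
  exact ENNReal.tsum_add

theorem expect_const_mul (p : PMF α) (c : ℝ≥0∞) (F : α → ℝ≥0∞) :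
    expect p (fun a => c * F a) = c * expect p F := by
  unfold expect
  rw [← ENNReal.tsum_mul_left]
  exact tsum_congr fun a => by ring

theorem expect_mul_const (p : PMF α) (c : ℝ≥0∞) (F : α → ℝ≥0∞) :
    expect p (fun a => F a * c) = expect p F * c := by
  simp_rw [mul_comm _ c, expect_const_mul]

theorem expect_finset_sum {ι : Type*} (s : Finset ι) (p : PMF α) (F : ι → α → ℝ≥0∞) :
    expect p (fun a => ∑ i ∈ s, F i a) = ∑ i ∈ s, expect p (F i) := by
  classical
  induction s using Finset.induction_on with
  | empty => simp [expect]
  | insert i s hi ih => simp_rw [Finset.sum_insert hi, expect_add, ih]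

theorem expect_le_const {p : PMF α} {F : α → ℝ≥0∞} {c : ℝ≥0∞} (h : ∀ a ∈ p.support, F a ≤ c) :
    expect p F ≤ c :=
  (expect_mono_support h).trans_eq (expect_const p c)

/-- Trees carry real split values and form an uncountable type. The support of a discrete law is
countable, and this reduction is what allows expectations to be exchanged with integrals and to be
shown measurable. -/
theorem expect_eq_tsum_support (p : PMF α) (F : α → ℝ≥0∞) :
    expect p F = ∑' a : p.support, p a * F a := by
  unfold expect
  rw [tsum_subtype p.support fun a => p a * F a]
  refine tsum_congr fun a => ?_
  by_cases ha : a ∈ p.support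
  · simp [ha]
  · rw [Set.indicator_of_notMem ha, (PMF.apply_eq_zero_iff p a).2 ha, zero_mul]

theorem lintegral_expect {Ω : Type*} [MeasurableSpace Ω] (μ : Measure Ω) (p : PMF α)
    {F : Ω → α → ℝ≥0∞} (hF : ∀ a, Measurable fun ω => F ω a) :
    ∫⁻ ω, expect p (F ω) ∂μ = expect p fun a => ∫⁻ ω, F ω a ∂μ := by
  simp_rw [expect_eq_tsum_support]
  have : Countable p.support := p.support_countable.to_subtype
  rw [lintegral_tsum fun a : p.support => ((hF a).const_mul _).aemeasurable]
  exact tsum_congr fun a => lintegral_const_mul _ (hF a)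

theorem measurable_expect {Ω : Type*} [MeasurableSpace Ω] (p : PMF α)
    {F : Ω → α → ℝ≥0∞} (hF : ∀ a, Measurable fun ω => F ω a) :
    Measurable fun ω => expect p (F ω) := by
  simp_rw [expect_eq_tsum_support]
  have : Countable p.support := p.support_countable.to_subtype
  exact Measurable.tsum fun a : p.support => (hF a).const_mul _

theorem expect_fintype [Fintype α] (p : PMF α) (F : α → ℝ≥0∞) :
    expect p F = ∑ a, p a * F a := tsum_fintype _

end expect

/-! ### Boxes -/

variable {D K n : ℕ}

/-- The half-open box `∏ (a j, b j]`. -/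
def box (a b : Fin D → ℝ) : Set (Fin D → ℝ) := {x | ∀ j, a j < x j ∧ x j ≤ b j}

/-- The lower corner of the right child of a box split in coordinate `j` at `v`. -/
noncomputable def lower (a : Fin D → ℝ) (j : Fin D) (v : ℝ) : Fin D → ℝ :=
  Function.update a j (max (a j) v)

/-- The upper corner of the left child of a box split in coordinate `j` at `v`. -/
noncomputable def upper (b : Fin D → ℝ) (j : Fin D) (v : ℝ) : Fin D → ℝ :=
  Function.update b j (min (b j) v)

theorem box_eq_pi (a b : Fin D → ℝ) :
    box a b = Set.pi Set.univ fun j => Set.Ioc (a j) (b j) := by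
  ext x; simp [box, Set.mem_pi]

theorem measurableSet_box (a b : Fin D → ℝ) : MeasurableSet (box a b) := by
  rw [box_eq_pi]
  exact MeasurableSet.univ_pi fun j => measurableSet_Ioc

theorem mem_box_upper {a b : Fin D → ℝ} {j : Fin D} {v : ℝ} {x : Fin D → ℝ} :
    x ∈ box a (upper b j v) ↔ x ∈ box a b ∧ x j ≤ v := by
  simp only [box, upper, Set.mem_ofPred_eq]
  constructor
  · intro h
    refine ⟨fun i => ?_, ?_⟩
    · have := h i
      by_cases hi : i = j
      · subst hi; simp at this; exact ⟨this.1, this.2.1⟩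
      · simpa [hi] using this
    · have := h j
      simp at this; exact this.2.2
  · rintro ⟨h, hv⟩ i
    by_cases hi : i = j
    · subst hi; simp [h i, hv]
    · simpa [hi] using h i

theorem mem_box_lower {a b : Fin D → ℝ} {j : Fin D} {v : ℝ} {x : Fin D → ℝ} :
    x ∈ box (lower a j v) b ↔ x ∈ box a b ∧ v < x j := by
  simp only [box, lower, Set.mem_ofPred_eq]
  constructor
  · intro h
    refine ⟨fun i => ?_, ?_⟩
    · have := h i
      by_cases hi : i = j
      · subst hi; simp at this; exact ⟨this.1.1, this.2⟩
      · simpa [hi] using this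
    · have := h j
      simp at this; exact this.1.2
  · rintro ⟨h, hv⟩ i
    by_cases hi : i = j
    · subst hi; simp [h i, hv]
    · simpa [hi] using h i

theorem box_upper_union_lower (a b : Fin D → ℝ) (j : Fin D) (v : ℝ) :
    box a (upper b j v) ∪ box (lower a j v) b = box a b := by
  ext x
  simp only [Set.mem_union, mem_box_upper, mem_box_lower, ← and_or_left]
  simp [le_or_gt]

theorem disjoint_box_upper_lower (a b : Fin D → ℝ) (j : Fin D) (v : ℝ) :
    Disjoint (box a (upper b j v)) (box (lower a j v) b) := by
  rw [Set.disjoint_left]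
  intro x hx hx'
  exact absurd (mem_box_upper.1 hx).2 (not_le.2 (mem_box_lower.1 hx').2)

theorem box_upper_subset (a b : Fin D → ℝ) (j : Fin D) (v : ℝ) :
    box a (upper b j v) ⊆ box a b := fun _ hx => (mem_box_upper.1 hx).1

theorem box_lower_subset (a b : Fin D → ℝ) (j : Fin D) (v : ℝ) :
    box (lower a j v) b ⊆ box a b := fun _ hx => (mem_box_lower.1 hx).1

theorem setLIntegral_box_split (μ : Measure (Fin D → ℝ)) (g : (Fin D → ℝ) → ℝ≥0∞)
    (a b : Fin D → ℝ) (j : Fin D) (v : ℝ) :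
    ∫⁻ x in box a (upper b j v), g x ∂μ + ∫⁻ x in box (lower a j v) b, g x ∂μ =
      ∫⁻ x in box a b, g x ∂μ := by
  rw [← lintegral_union (measurableSet_box _ _) (disjoint_box_upper_lower a b j v),
    box_upper_union_lower]

theorem measure_box_split (μ : Measure (Fin D → ℝ)) (a b : Fin D → ℝ) (j : Fin D) (v : ℝ) :
    μ (box a (upper b j v)) + μ (box (lower a j v) b) = μ (box a b) := by
  rw [← measure_union (disjoint_box_upper_lower a b j v) (measurableSet_box _ _),
    box_upper_union_lower]

theorem measure_box_inter_split (μ : Measure (Fin D → ℝ)) (A : Set (Fin D → ℝ))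
    (a b : Fin D → ℝ) (j : Fin D) (v : ℝ) :
    μ (box a (upper b j v) ∩ A) + μ (box (lower a j v) b ∩ A) = μ (box a b ∩ A) := by
  rw [← Measure.restrict_apply (measurableSet_box _ _),
    ← Measure.restrict_apply (measurableSet_box _ _),
    ← Measure.restrict_apply (measurableSet_box _ _), measure_box_split]

open Classical in
/-- The points of `E` whose features lie in the box. -/
noncomputable def pointsIn (d : Sample D K n) (E : Finset (Fin n)) (a b : Fin D → ℝ) :
    Finset (Fin n) := E.filter fun i => (d i).1 ∈ box a b

theorem left_pointsIn (d : Sample D K n) (E : Finset (Fin n)) (a b : Fin D → ℝ) (j : Fin D)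
    (v : ℝ) : left d (pointsIn d E a b) j v = pointsIn d E a (upper b j v) := by
  ext i; simp [left, pointsIn, mem_box_upper, and_assoc]

theorem right_pointsIn (d : Sample D K n) (E : Finset (Fin n)) (a b : Fin D → ℝ) (j : Fin D)
    (v : ℝ) : right d (pointsIn d E a b) j v = pointsIn d E (lower a j v) b := by
  ext i; simp [right, pointsIn, mem_box_lower, and_assoc]

theorem pointsIn_eq_self {d : Sample D K n} {E : Finset (Fin n)} {a b : Fin D → ℝ}
    (h : ∀ i ∈ E, (d i).1 ∈ box a b) : pointsIn d E a b = E := by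
  classical
  refine Finset.Subset.antisymm (Finset.filter_subset _ _) fun i hi => ?_
  simp [pointsIn, hi, h i hi]

theorem card_left_add_card_right (d : Sample D K n) (A : Finset (Fin n)) (j : Fin D) (v : ℝ) :
    (left d A j v).card + (right d A j v).card = A.card := by
  classical
  unfold left right
  rw [← Finset.card_filter_add_card_filter_not (s := A) (fun i => (d i).1 j ≤ v)]
  simp [not_le]

/-! ### The tree as a pruning of a tree grown from the structure points only -/

open Classical in
/-- The law of the tree grown from the structure points `S`, without the minimum leaf size. -/
noncomputable def fullTree (T : (Fin K → ℝ) → ℝ) (B₁ B₂ : ℝ) (d : Sample D K n) :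
    ℕ → Finset (Fin n) → PMF (Tree D)
  | 0, _ => PMF.pure Tree.leaf
  | m + 1, S =>
      if hF : (splitFeatures d S).Nonempty then
        (expMech (splitFeatures d S) hF B₁
            (minMax (splitFeatures d S) hF (bestDecrease T d S))).bind fun j =>
          if hV : (splitValues d S j).Nonempty then
            (expMech (splitValues d S j) hV B₂
                (minMax (splitValues d S j) hV (impurityDecrease T d S j))).bind fun v =>
              (fullTree T B₁ B₂ d m (left d S j v)).bind fun l =>
                (fullTree T B₁ B₂ d m (right d S j v)).map fun r => Tree.node j v l r
          else PMF.pure Tree.leaf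
      else PMF.pure Tree.leaf

open Classical in
/-- Remove the splits one of whose children has fewer than `k` points among the points `E`. -/
noncomputable def prune (k : ℕ) (d : Sample D K n) : Tree D → Finset (Fin n) → Tree D
  | .leaf, _ => .leaf
  | .node j v l r, E =>
      if k ≤ (left d E j v).card ∧ k ≤ (right d E j v).card then
        .node j v (prune k d l (left d E j v)) (prune k d r (right d E j v))
      else .leaf

/-- The draws of feature and split value use the structure points only. The size test merely
discards the subtrees below a failing node, and the law of what is discarded has total mass one. -/
theorem expect_grow (T : (Fin K → ℝ) → ℝ) (B₁ B₂ : ℝ) (k : ℕ) (d : Sample D K n) (m : ℕ)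
    (S E : Finset (Fin n)) (F : Tree D → ℝ≥0∞) :
    expect (grow T B₁ B₂ k d m S E) F =
      expect (fullTree T B₁ B₂ d m S) fun t => F (prune k d t E) := by
  induction m generalizing S E F with
  | zero => simp [grow, fullTree, expect_pure, prune]
  | succ m ih =>
    simp only [grow, fullTree]
    split_ifs with hF
    · rw [expect_bind, expect_bind]
      refine expect_congr fun j => ?_
      split_ifs with hV
      · rw [expect_bind, expect_bind]
        refine expect_congr fun v => ?_
        simp only [expect_bind, expect_map, Function.comp_def]
        split_ifs with hk
        · simp only [expect_bind, expect_map, Function.comp_def, prune, hk, and_self, if_true, ih]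
        · simp [expect_pure, prune, hk, expect_const]
      · simp [expect_pure, prune]
    · simp [expect_pure, prune]

open Classical in
/-- The sum of `Q` over the leaves of the pruned tree, each leaf being given by its box and by the
points of `E` that it contains. -/
noncomputable def leafSum (k : ℕ) (d : Sample D K n)
    (Q : (Fin D → ℝ) → (Fin D → ℝ) → Finset (Fin n) → ℝ≥0∞) :
    Tree D → (Fin D → ℝ) → (Fin D → ℝ) → Finset (Fin n) → ℝ≥0∞
  | .leaf, a, b, E => Q a b E
  | .node j v l r, a, b, E =>
      if k ≤ (left d E j v).card ∧ k ≤ (right d E j v).card then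
        leafSum k d Q l a (upper b j v) (left d E j v) +
          leafSum k d Q r (lower a j v) b (right d E j v)
      else Q a b E

/-! ### Sums over the leaves of the pruned tree. -/

variable {k : ℕ} {d : Sample D K n} {Q Q' : (Fin D → ℝ) → (Fin D → ℝ) → Finset (Fin n) → ℝ≥0∞}

theorem leafSum_mono (h : ∀ a b E, Q a b E ≤ Q' a b E) (t : Tree D) (a b : Fin D → ℝ)
    (E : Finset (Fin n)) : leafSum k d Q t a b E ≤ leafSum k d Q' t a b E := by
  induction t generalizing a b E with
  | leaf => exact h a b E
  | node j v l r ihl ihr =>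
    simp only [leafSum]
    split_ifs
    · exact add_le_add (ihl _ _ _) (ihr _ _ _)
    · exact h a b E

theorem leafSum_add (t : Tree D) (a b : Fin D → ℝ) (E : Finset (Fin n)) :
    leafSum k d (fun a b E => Q a b E + Q' a b E) t a b E =
      leafSum k d Q t a b E + leafSum k d Q' t a b E := by
  induction t generalizing a b E with
  | leaf => rfl
  | node j v l r ihl ihr =>
    simp only [leafSum]
    split_ifs
    · rw [ihl, ihr]; ring
    · rfl

theorem leafSum_const_mul (c : ℝ≥0∞) (t : Tree D) (a b : Fin D → ℝ) (E : Finset (Fin n)) :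
    leafSum k d (fun a b E => c * Q a b E) t a b E = c * leafSum k d Q t a b E := by
  induction t generalizing a b E with
  | leaf => rfl
  | node j v l r ihl ihr =>
    simp only [leafSum]
    split_ifs
    · rw [ihl, ihr]; ring
    · rfl

theorem leafSum_finset_sum {ι : Type*} (s : Finset ι)
    (Q : ι → (Fin D → ℝ) → (Fin D → ℝ) → Finset (Fin n) → ℝ≥0∞) (t : Tree D)
    (a b : Fin D → ℝ) (E : Finset (Fin n)) :
    leafSum k d (fun a b E => ∑ i ∈ s, Q i a b E) t a b E =
      ∑ i ∈ s, leafSum k d (Q i) t a b E := by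
  induction t generalizing a b E with
  | leaf => rfl
  | node j v l r ihl ihr =>
    simp only [leafSum]
    split_ifs
    · rw [ihl, ihr, Finset.sum_add_distrib]
    · rfl

/-- The leaves partition the root box for every outcome of the pruning, so the sum of an additive
cost telescopes. -/
theorem leafSum_additive (q : (Fin D → ℝ) → (Fin D → ℝ) → ℝ≥0∞)
    (hq : ∀ a b j v, q a (upper b j v) + q (lower a j v) b = q a b)
    (t : Tree D) (a b : Fin D → ℝ) (E : Finset (Fin n)) :
    leafSum k d (fun a b _ => q a b) t a b E = q a b := by
  induction t generalizing a b E with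
  | leaf => rfl
  | node j v l r ihl ihr =>
    simp only [leafSum]
    split_ifs
    · rw [ihl, ihr, hq]
    · rfl

theorem leafSum_congr_sample {d d' : Sample D K n} (t : Tree D) (a b : Fin D → ℝ)
    (E : Finset (Fin n)) (hQ : ∀ a b, ∀ A ⊆ E, Q a b A = Q' a b A) (h : ∀ i ∈ E, d i = d' i) :
    leafSum k d Q t a b E = leafSum k d' Q' t a b E := by
  induction t generalizing a b E with
  | leaf => exact hQ _ _ _ subset_rfl
  | node j v l r ihl ihr =>
    have hl : left d E j v = left d' E j v := Finset.filter_congr fun i hi => by rw [h i hi]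
    have hr : right d E j v = right d' E j v := Finset.filter_congr fun i hi => by rw [h i hi]
    have hls : left d' E j v ⊆ E := Finset.filter_subset _ _
    have hrs : right d' E j v ⊆ E := Finset.filter_subset _ _
    simp only [leafSum, hl, hr]
    rw [ihl _ _ _ (fun a b A hA => hQ a b A (hA.trans hls)) (fun i hi => h i (hls hi)),
      ihr _ _ _ (fun a b A hA => hQ a b A (hA.trans hrs)) (fun i hi => h i (hrs hi)),
      hQ _ _ _ subset_rfl]

/-- This turns an average over the query point into a sum over leaves, on which inductions over the
tree can act. -/
theorem setLIntegral_leafPoints (μ : Measure (Fin D → ℝ))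
    (Ψ : (Fin D → ℝ) → Finset (Fin n) → ℝ≥0∞) (t : Tree D) (a b : Fin D → ℝ)
    (E : Finset (Fin n)) :
    ∫⁻ x in box a b, Ψ x ((prune k d t E).leafPoints d x E) ∂μ =
      leafSum k d (fun a b A => ∫⁻ x in box a b, Ψ x A ∂μ) t a b E := by
  induction t generalizing a b E with
  | leaf => rfl
  | node j v l r ihl ihr =>
    simp only [leafSum, prune]
    split_ifs
    · rw [← ihl, ← ihr, ← setLIntegral_box_split μ _ a b j v]
      congr 1
      · refine setLIntegral_congr_fun (measurableSet_box _ _) fun x hx => ?_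
        simp [Tree.leafPoints, (mem_box_upper.1 hx).2]
      · refine setLIntegral_congr_fun (measurableSet_box _ _) fun x hx => ?_
        simp [Tree.leafPoints, not_le.2 (mem_box_lower.1 hx).2]
    · rfl

theorem measurable_leafPoints {β : Type*} [MeasurableSpace β]
    {Ψ : (Fin D → ℝ) → Finset (Fin n) → β} (hΨ : ∀ A, Measurable fun x => Ψ x A) (t : Tree D)
    (E : Finset (Fin n)) : Measurable fun x => Ψ x (t.leafPoints d x E) := by
  induction t generalizing E with
  | leaf => exact hΨ E
  | node j v l r ihl ihr =>
    simp only [Tree.leafPoints]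
    have : ∀ x : Fin D → ℝ, Ψ x (if x j ≤ v then l.leafPoints d x (left d E j v)
        else r.leafPoints d x (right d E j v)) = if x j ≤ v then Ψ x (l.leafPoints d x (left d E j v))
        else Ψ x (r.leafPoints d x (right d E j v)) := fun x => apply_ite _ _ _ _
    simp only [this]
    exact Measurable.ite (measurableSet_le (measurable_pi_apply j) measurable_const) (ihl _) (ihr _)

/-! ### Bayes risk and the excess error of a forest -/

section Bayes

variable [NeZero K] (P : Measure ((Fin D → ℝ) × Fin K)) [IsProbabilityMeasure P]

/-- The regression function: `eta P x c` is the conditional probability of label `c` at `x`. -/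
noncomputable def eta (x : Fin D → ℝ) (c : Fin K) : ℝ := (P.condKernel x).real {c}

theorem measurable_eta (c : Fin K) : Measurable fun x => eta P x c :=
  (Measurable.ennreal_toReal (P.condKernel.measurable_coe (measurableSet_singleton c)))

theorem eta_nonneg (x : Fin D → ℝ) (c : Fin K) : 0 ≤ eta P x c := measureReal_nonneg

theorem eta_le_one (x : Fin D → ℝ) (c : Fin K) : eta P x c ≤ 1 := measureReal_le_one

theorem sum_eta (x : Fin D → ℝ) : ∑ c, eta P x c = 1 := by
  have := sum_measureReal_singleton (μ := P.condKernel x) (Finset.univ : Finset (Fin K))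
  unfold eta
  rw [this]; simp

theorem lintegral_eq_lintegral_eta {F : (Fin D → ℝ) × Fin K → ℝ≥0∞} (hF : Measurable F) :
    ∫⁻ z, F z ∂P = ∫⁻ x, ∑ c, ENNReal.ofReal (eta P x c) * F (x, c) ∂(P.map Prod.fst) := by
  conv_lhs => rw [← P.disintegrate P.condKernel]
  rw [Measure.lintegral_compProd hF]
  refine lintegral_congr fun x => ?_
  rw [lintegral_fintype]
  refine Finset.sum_congr rfl fun c _ => ?_
  rw [eta, ofReal_measureReal, mul_comm]

/-- The conditional error probability of label `c` at `x`. -/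
noncomputable def labelRisk (x : Fin D → ℝ) (c : Fin K) : ℝ≥0∞ := ENNReal.ofReal (1 - eta P x c)

/-- The smallest conditional error probability at `x`. -/
noncomputable def minRisk (x : Fin D → ℝ) : ℝ≥0∞ := ⨅ c, labelRisk P x c

theorem measurable_labelRisk (c : Fin K) : Measurable fun x => labelRisk P x c :=
  (measurable_const.sub (measurable_eta P c)).ennreal_ofReal

theorem measurable_minRisk : Measurable (minRisk P) :=
  Measurable.iInf fun c => measurable_labelRisk P c

theorem sum_eta_ne (x : Fin D → ℝ) (c : Fin K) :
    ∑ y, ENNReal.ofReal (eta P x y) * (if c = y then 0 else 1) = labelRisk P x c := by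
  rw [labelRisk, ← sum_eta P x, ← Finset.sum_erase_eq_sub (Finset.mem_univ c),
    ENNReal.ofReal_sum_of_nonneg fun y _ => eta_nonneg P x y,
    ← Finset.sum_erase_add _ _ (Finset.mem_univ c)]
  simp only [if_true, mul_zero, add_zero]
  refine Finset.sum_congr rfl fun y hy => ?_
  rw [if_neg (Finset.ne_of_mem_erase hy).symm, mul_one]

theorem measure_classifier_ne {g : (Fin D → ℝ) → Fin K} (hg : Measurable g) :
    P {z | g z.1 ≠ z.2} = ∫⁻ x, labelRisk P x (g x) ∂(P.map Prod.fst) := by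
  have hms : MeasurableSet {z : (Fin D → ℝ) × Fin K | g z.1 ≠ z.2} :=
    (measurableSet_eq_fun (hg.comp measurable_fst) measurable_snd).compl
  rw [← lintegral_indicator_one hms, lintegral_eq_lintegral_eta P (measurable_one.indicator hms)]
  refine lintegral_congr fun x => ?_
  rw [← sum_eta_ne]
  refine Finset.sum_congr rfl fun y _ => ?_
  by_cases h : g x = y <;> simp [h]

/-- Taking the least of the minimizing labels makes the selection measurable: each of its fibres is
given by finitely many comparisons of measurable risks. -/
theorem exists_measurable_labelRisk_eq_minRisk :
    ∃ g : (Fin D → ℝ) → Fin K, Measurable g ∧ ∀ x, labelRisk P x (g x) = minRisk P x := by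
  classical
  have hne : ∀ x, (Finset.univ.filter fun c => labelRisk P x c ≤ minRisk P x).Nonempty := by
    intro x
    obtain ⟨c, hc⟩ := exists_eq_ciInf_of_finite (f := fun c => labelRisk P x c)
    exact ⟨c, by simpa [minRisk] using hc.le⟩
  refine ⟨fun x => (Finset.univ.filter fun c => labelRisk P x c ≤ minRisk P x).min' (hne x),
    ?_, fun x => ?_⟩
  · refine measurable_to_countable' fun c => ?_
    have : (fun x => (Finset.univ.filter fun c => labelRisk P x c ≤ minRisk P x).min' (hne x)) ⁻¹'
        {c} = {x | labelRisk P x c ≤ minRisk P x} ∩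
          ⋂ c' : Fin K, {x | c' < c → minRisk P x < labelRisk P x c'} := by
      ext x
      simp only [Set.mem_preimage, Set.mem_singleton_iff, Finset.min'_eq_iff, Finset.mem_filter,
        Finset.mem_univ, true_and, Set.mem_inter_iff, Set.mem_ofPred_eq, Set.mem_iInter]
      refine and_congr_right fun _ => forall_congr' fun c' => ?_
      rw [← not_le, ← not_le, not_imp_not]
    rw [this]
    refine (measurableSet_le (measurable_labelRisk P c) (measurable_minRisk P)).inter
      (MeasurableSet.iInter fun c' => ?_)
    by_cases h : c' < c
    · simpa [h] using measurableSet_lt (measurable_minRisk P) (measurable_labelRisk P c')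
    · simp [h]
  · refine le_antisymm ?_ (iInf_le _ _)
    have := Finset.min'_mem _ (hne x)
    exact (Finset.mem_filter.1 this).2

theorem bayesRisk_eq : bayesRisk P = ∫⁻ x, minRisk P x ∂(P.map Prod.fst) := by
  unfold bayesRisk
  refine le_antisymm ?_ (le_iInf₂ fun g hg => ?_)
  · obtain ⟨g, hg, hgm⟩ := exists_measurable_labelRisk_eq_minRisk P
    refine (iInf₂_le g hg).trans ?_
    rw [measure_classifier_ne P hg]
    exact (lintegral_congr hgm).le
  · rw [measure_classifier_ne P hg]
    exact lintegral_mono fun x => iInf_le _ _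

/-- The excess conditional error probability of label `c` at `x`. -/
noncomputable def gap (x : Fin D → ℝ) (c : Fin K) : ℝ≥0∞ := labelRisk P x c - minRisk P x

theorem measurable_gap (c : Fin K) : Measurable fun x => gap P x c :=
  (measurable_labelRisk P c).sub (measurable_minRisk P)

/-! ### The vote over independent trees. -/

theorem sum_prod_pmf {M : ℕ} (q : PMF (Fin K)) : ∑ h : Fin M → Fin K, ∏ i, q (h i) = 1 := by
  classical
  rw [← Fintype.piFinset_univ, Finset.sum_prod_piFinset]
  have : ∑ c, q c = 1 := (tsum_fintype fun c => q c).symm.trans q.tsum_coe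
  simp [this]

/-- The other coordinates integrate to one, leaving the marginal of the `i₀`-th draw. -/
theorem sum_prod_pmf_mul {M : ℕ} (q : PMF (Fin K)) (i₀ : Fin M) (g : Fin K → ℝ≥0∞) :
    ∑ h : Fin M → Fin K, (∏ i, q (h i)) * g (h i₀) = ∑ c, q c * g c := by
  classical
  have hq : ∑ c, q c = 1 := (tsum_fintype fun c => q c).symm.trans q.tsum_coe
  have h1 : ∀ h : Fin M → Fin K, (∏ i, q (h i)) * g (h i₀) =
      ∏ i, (q (h i) * if i = i₀ then g (h i) else 1) := by
    intro h
    rw [Finset.prod_mul_distrib, Finset.prod_ite_eq' Finset.univ i₀ fun i => g (h i)]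
    simp
  simp_rw [h1]
  rw [← Fintype.piFinset_univ,
    Finset.sum_prod_piFinset Finset.univ fun i c => q c * if i = i₀ then g c else 1,
    ← Finset.mul_prod_erase _ _ (Finset.mem_univ i₀)]
  rw [Finset.prod_eq_one, mul_one]
  · simp
  · intro i hi
    simp [Finset.ne_of_mem_erase hi, hq]

theorem lintegral_voteError {M : ℕ} (vote : (Fin M → Fin K) → Fin K)
    {q : (Fin D → ℝ) → PMF (Fin K)} (hq : ∀ c, Measurable fun x => q x c) :
    ∫⁻ z, voteError vote (q z.1) z.2 ∂P =
      ∫⁻ x, ∑ h : Fin M → Fin K, (∏ i, q x (h i)) * labelRisk P x (vote h) ∂(P.map Prod.fst) := by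
  rw [lintegral_eq_lintegral_eta]
  · refine lintegral_congr fun x => ?_
    simp_rw [voteError, Finset.mul_sum]
    rw [Finset.sum_comm]
    refine Finset.sum_congr rfl fun h _ => ?_
    rw [← sum_eta_ne, Finset.mul_sum]
    refine Finset.sum_congr rfl fun y _ => ?_
    split_ifs <;> simp [mul_comm]
  · unfold voteError
    refine Finset.measurable_sum _ fun h _ => ?_
    refine Measurable.ite ?_ measurable_const (Finset.measurable_prod _ fun i _ =>
      (hq (h i)).comp measurable_fst)
    exact measurable_snd (measurableSet_eq_fun measurable_const measurable_id)

theorem bayesRisk_le_lintegral_voteError {M : ℕ} (vote : (Fin M → Fin K) → Fin K)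
    {q : (Fin D → ℝ) → PMF (Fin K)} (hq : ∀ c, Measurable fun x => q x c) :
    bayesRisk P ≤ ∫⁻ z, voteError vote (q z.1) z.2 ∂P := by
  rw [bayesRisk_eq, lintegral_voteError P vote hq]
  refine lintegral_mono fun x => ?_
  calc minRisk P x = ∑ h : Fin M → Fin K, (∏ i, q x (h i)) * minRisk P x := by
        rw [← Finset.sum_mul, sum_prod_pmf, one_mul]
    _ ≤ _ := Finset.sum_le_sum fun h _ => mul_le_mul_right (iInf_le _ _) _

theorem lintegral_voteError_le {M : ℕ} (hM : 0 < M) {vote : (Fin M → Fin K) → Fin K}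
    (hvote : IsMajorityVote vote)
    {q : (Fin D → ℝ) → PMF (Fin K)} (hq : ∀ c, Measurable fun x => q x c) :
    ∫⁻ z, voteError vote (q z.1) z.2 ∂P ≤
      bayesRisk P + M * ∫⁻ x, expect (q x) (gap P x) ∂(P.map Prod.fst) := by
  rw [bayesRisk_eq, lintegral_voteError P vote hq, ← lintegral_const_mul'' _
    (Measurable.aemeasurable ?_), ← lintegral_add_left (measurable_minRisk P)]
  · refine lintegral_mono fun x => ?_
    -- The winner has at least as many votes as the label of the first tree, which has at least one.
    -- Nothing else about majority is used.
    have hmem : ∀ h : Fin M → Fin K, ∃ i, h i = vote h := by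
      intro h
      have h1 := hvote h (h ⟨0, hM⟩)
      have h2 : 0 < (Finset.univ.filter fun i => h i = h ⟨0, hM⟩).card :=
        Finset.card_pos.2 ⟨⟨0, hM⟩, by simp⟩
      obtain ⟨i, hi⟩ := Finset.card_pos.1 (h2.trans_le h1)
      exact ⟨i, (Finset.mem_filter.1 hi).2⟩
    have hle : ∀ h : Fin M → Fin K,
        labelRisk P x (vote h) ≤ minRisk P x + ∑ i, gap P x (h i) := by
      intro h
      obtain ⟨i, hi⟩ := hmem h
      calc labelRisk P x (vote h) ≤ minRisk P x + gap P x (h i) := by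
            rw [gap, hi]; exact le_add_tsub
        _ ≤ _ := add_le_add_right
            (Finset.single_le_sum (f := fun i => gap P x (h i)) (fun _ _ => zero_le)
              (Finset.mem_univ i)) _
    calc ∑ h : Fin M → Fin K, (∏ i, q x (h i)) * labelRisk P x (vote h)
        ≤ ∑ h : Fin M → Fin K, (∏ i, q x (h i)) * (minRisk P x + ∑ i, gap P x (h i)) :=
          Finset.sum_le_sum fun h _ => mul_le_mul_right (hle h) _
      _ = minRisk P x + M * expect (q x) (gap P x) := by
          simp_rw [mul_add, Finset.sum_add_distrib, ← Finset.sum_mul, sum_prod_pmf, one_mul,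
            Finset.mul_sum]
          rw [Finset.sum_comm]
          simp_rw [sum_prod_pmf_mul, expect_fintype]
          simp
  · simp_rw [expect_fintype]
    exact Finset.measurable_sum _ fun c _ => (hq c).mul (measurable_gap P c)

/-! ### Labelling rules that nearly maximize the leaf frequencies. -/

/-- The labelling rule `rule` selects labels whose score is, on average, within `δ` of the
maximal score. -/
def IsNearMaximal (rule : (Fin K → ℝ) → PMF (Fin K)) (δ : ℝ≥0∞) : Prop :=
  ∀ (u : Fin K → ℝ) (c₀ : Fin K), expect (rule u) (fun c => ENNReal.ofReal (u c₀ - u c)) ≤ δ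

/-- The plug-in inequality: comparing with an optimal label `c₀`, replace `eta` by the score `u` at
`c₀` and at the chosen label. Each replacement costs at most the `ℓ¹` distance of `u` and `eta`,
hence the factor 2. -/
theorem expect_gap_le {rule : (Fin K → ℝ) → PMF (Fin K)} {δ : ℝ≥0∞} (hr : IsNearMaximal rule δ)
    (u : Fin K → ℝ) (x : Fin D → ℝ) :
    expect (rule u) (gap P x) ≤ δ + 2 * ∑ c, ENNReal.ofReal |u c - eta P x c| := by
  obtain ⟨c₀, hc₀⟩ := exists_eq_ciInf_of_finite (f := fun c => labelRisk P x c)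
  have hle : ∀ c, gap P x c ≤
      ENNReal.ofReal (u c₀ - u c) + 2 * ∑ c, ENNReal.ofReal |u c - eta P x c| := by
    intro c
    have hs : ∀ c, ENNReal.ofReal |u c - eta P x c| ≤ ∑ c, ENNReal.ofReal |u c - eta P x c| :=
      fun c => Finset.single_le_sum (f := fun c => ENNReal.ofReal |u c - eta P x c|)
        (fun _ _ => zero_le) (Finset.mem_univ c)
    have h1 : gap P x c = ENNReal.ofReal (eta P x c₀ - eta P x c) := by
      rw [gap, minRisk, ← hc₀, labelRisk, labelRisk,
        ← ENNReal.ofReal_sub _ (sub_nonneg.2 (eta_le_one P x c₀))]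
      congr 1; ring
    rw [h1]
    calc ENNReal.ofReal (eta P x c₀ - eta P x c)
        ≤ ENNReal.ofReal ((u c₀ - u c) + (|u c₀ - eta P x c₀| + |u c - eta P x c|)) := by
          refine ENNReal.ofReal_le_ofReal ?_
          have := neg_abs_le (u c₀ - eta P x c₀)
          have := le_abs_self (u c - eta P x c)
          linarith
      _ ≤ ENNReal.ofReal (u c₀ - u c) +
          (ENNReal.ofReal |u c₀ - eta P x c₀| + ENNReal.ofReal |u c - eta P x c|) :=
          ENNReal.ofReal_add_le.trans (add_le_add_right ENNReal.ofReal_add_le _)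
      _ ≤ _ := by
          rw [two_mul]
          exact add_le_add_right (add_le_add (hs _) (hs _)) _
  refine (expect_mono hle).trans ?_
  rw [expect_add, expect_const]
  exact add_le_add_left (hr u c₀) _

theorem isNearMaximal_majorityLabel :
    IsNearMaximal (majorityLabel : (Fin K → ℝ) → PMF (Fin K)) 0 := by
  intro u c₀
  refine expect_le_const fun c hc => ?_
  rw [majorityLabel, PMF.mem_support_uniformOfFinset_iff, argmaxLabels, Finset.mem_filter] at hc
  simp [hc.2 c₀]

theorem expMech_apply {α : Type} {s : Finset α} (hs : s.Nonempty) (B : ℝ) (u : α → ℝ) {a : α}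
    (ha : a ∈ s) : expMech s hs B u a =
      ENNReal.ofReal (Real.exp (B / 2 * u a) / ∑ b ∈ s, Real.exp (B / 2 * u b)) := by
  simp [expMech, PMF.ofFinset_apply, ha]

theorem expMech_apply_of_notMem {α : Type} {s : Finset α} (hs : s.Nonempty) (B : ℝ) (u : α → ℝ)
    {a : α} (ha : a ∉ s) : expMech s hs B u a = 0 := by
  simp [expMech, PMF.ofFinset_apply, ha]

/-- A label whose score is lower by `t` has probability at most `exp(-Bt/2)`, and `y ≤ exp y` at `y
= Bt/2` bounds its contribution by `2/B`. -/
theorem isNearMaximal_randomLabel {B : ℝ} (hB : 0 < B) :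
    IsNearMaximal (randomLabel B : (Fin K → ℝ) → PMF (Fin K)) (ENNReal.ofReal (K * (2 / B))) := by
  intro u c₀
  rw [expect_fintype]
  have hterm : ∀ c, randomLabel B u c * ENNReal.ofReal (u c₀ - u c) ≤ ENNReal.ofReal (2 / B) := by
    intro c
    rcases le_or_gt (u c₀) (u c) with h | h
    · simp [ENNReal.ofReal_of_nonpos (sub_nonpos.2 h)]
    rw [randomLabel, expMech_apply _ _ _ (Finset.mem_univ c), ← ENNReal.ofReal_mul (by positivity)]
    refine ENNReal.ofReal_le_ofReal ?_
    have hS : Real.exp (B / 2 * u c₀) ≤ ∑ b, Real.exp (B / 2 * u b) :=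
      Finset.single_le_sum (f := fun b => Real.exp (B / 2 * u b)) (fun b _ => (Real.exp_pos _).le)
        (Finset.mem_univ c₀)
    have h0 : 0 < u c₀ - u c := sub_pos.2 h
    calc Real.exp (B / 2 * u c) / (∑ b, Real.exp (B / 2 * u b)) * (u c₀ - u c)
        ≤ Real.exp (B / 2 * u c) / Real.exp (B / 2 * u c₀) * (u c₀ - u c) := by gcongr
      _ = (2 / B) * ((B / 2 * (u c₀ - u c)) / Real.exp (B / 2 * (u c₀ - u c))) := by
          rw [show B / 2 * (u c₀ - u c) = B / 2 * u c₀ - B / 2 * u c by ring, Real.exp_sub]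
          field_simp
      _ ≤ (2 / B) * 1 := by
          gcongr
          rw [div_le_one (Real.exp_pos _)]
          have := Real.add_one_le_exp (B / 2 * (u c₀ - u c))
          linarith
      _ = 2 / B := mul_one _
  calc ∑ c, randomLabel B u c * ENNReal.ofReal (u c₀ - u c)
      ≤ ∑ _c : Fin K, ENNReal.ofReal (2 / B) := Finset.sum_le_sum fun c _ => hterm c
    _ = _ := by
      rw [Finset.sum_const, Finset.card_univ, Fintype.card_fin, nsmul_eq_mul,
        ENNReal.ofReal_mul (by positivity), ENNReal.ofReal_natCast]

end Bayes

/-! ### Deviations of the class frequencies in the leaves of a fixed tree -/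

/-- A function of the sample that does not change when points move inside `C`. -/
def Blind (C : Set (Fin D → ℝ)) (G : Sample D K n → ℝ≥0∞) : Prop :=
  ∀ d d' : Sample D K n, (∀ i, d i = d' i ∨ ((d i).1 ∈ C ∧ (d' i).1 ∈ C)) → G d = G d'

theorem Blind.mono {C C' : Set (Fin D → ℝ)} {G : Sample D K n → ℝ≥0∞} (h : Blind C G)
    (hC : C' ⊆ C) : Blind C' G := fun d d' hd =>
  h d d' fun i => (hd i).imp_right fun hi => ⟨hC hi.1, hC hi.2⟩

theorem pointsIn_congr_of_blind {C : Set (Fin D → ℝ)} {a b : Fin D → ℝ}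
    (hC : C ⊆ box a b ∨ Disjoint C (box a b)) {d d' : Sample D K n}
    (hd : ∀ i, d i = d' i ∨ ((d i).1 ∈ C ∧ (d' i).1 ∈ C)) (E : Finset (Fin n)) :
    pointsIn d E a b = pointsIn d' E a b := by
  ext i
  simp only [pointsIn, Finset.mem_filter]
  refine and_congr_right fun _ => ?_
  rcases hd i with h | ⟨h, h'⟩
  · rw [h]
  · rcases hC with hC | hC
    · exact iff_of_true (hC h) (hC h')
    · exact iff_of_false (Set.disjoint_left.1 hC h) (Set.disjoint_left.1 hC h')

/-- The factors are integrated out one sample point at a time. While the point is in `C`, the value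
of `G` does not depend on where it is, so the tilt may be averaged there, with mean at most one.
Outside `C` the tilt is one. -/
theorem lintegral_tilt_le {P : Measure ((Fin D → ℝ) × Fin K)} [IsProbabilityMeasure P]
    {C : Set (Fin D → ℝ)} (hC : MeasurableSet C) {w : (Fin D → ℝ) × Fin K → ℝ≥0∞}
    (hw : Measurable w) (hw1 : ∀ z, z.1 ∉ C → w z = 1)
    (hwC : ∫⁻ z in Prod.fst ⁻¹' C, w z ∂P ≤ P (Prod.fst ⁻¹' C))
    {G : Sample D K n → ℝ≥0∞} (hG : Measurable G) (hB : Blind C G) (E : Finset (Fin n)) :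
    ∫⁻ d, G d * ∏ i ∈ E, w (d i) ∂(Measure.pi fun _ => P) ≤
      ∫⁻ d, G d ∂(Measure.pi fun _ => P) := by
  classical
  have hms : MeasurableSet (Prod.fst ⁻¹' C : Set ((Fin D → ℝ) × Fin K)) := measurable_fst hC
  have hprod : ∀ E : Finset (Fin n), Measurable fun d : Sample D K n => G d * ∏ i ∈ E, w (d i) :=
    fun E => hG.mul (Finset.measurable_prod _ fun i _ => hw.comp (measurable_pi_apply i))
  induction E using Finset.induction_on with
  | empty => simp
  | insert i E hi ih =>
    refine le_trans ?_ ih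
    refine lintegral_le_of_lmarginal_le {i} (hprod _) (hprod _) fun x => ?_
    rw [lmarginal_singleton, lmarginal_singleton]
    have hE : ∀ z, ∏ i' ∈ E, w (Function.update x i z i') = ∏ i' ∈ E, w (x i') := fun z =>
      Finset.prod_congr rfl fun i' hi' => by
        rw [Function.update_of_ne (ne_of_mem_of_not_mem hi' hi)]
    set φ : (Fin D → ℝ) × Fin K → ℝ≥0∞ := fun z =>
      G (Function.update x i z) * ∏ i' ∈ E, w (x i') with hφ
    have h1 : ∀ z, G (Function.update x i z) * ∏ i' ∈ insert i E, w (Function.update x i z i') =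
        φ z * w z := by
      intro z
      rw [Finset.prod_insert hi, hE, Function.update_self, hφ]
      ring
    have h2 : ∀ z, G (Function.update x i z) * ∏ i' ∈ E, w (Function.update x i z i') =
        φ z := fun z => by rw [hE]
    simp_rw [h1, h2]
    rw [← lintegral_add_compl (fun z => φ z * w z) hms, ← lintegral_add_compl φ hms]
    refine add_le_add ?_ (le_of_eq ?_)
    · rcases Set.eq_empty_or_nonempty (Prod.fst ⁻¹' C : Set ((Fin D → ℝ) × Fin K)) with h | ⟨z₀, h⟩
      · simp [h]
      have hconst : ∀ z ∈ (Prod.fst ⁻¹' C : Set ((Fin D → ℝ) × Fin K)), φ z = φ z₀ := by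
        intro z hz
        simp only [hφ]
        congr 1
        refine hB _ _ fun i' => ?_
        by_cases hi' : i' = i
        · subst hi'
          right
          simpa using ⟨hz, h⟩
        · left
          simp [hi']
      rw [setLIntegral_congr_fun hms hconst,
        setLIntegral_congr_fun hms (g := fun z => φ z₀ * w z)
          (fun z hz => by simp only [hconst z hz]),
        lintegral_const_mul _ hw, setLIntegral_const]
      exact mul_le_mul_right hwC _
    · refine setLIntegral_congr_fun hms.compl fun z hz => ?_
      rw [hw1 z hz, mul_one]

/-! ### Counts and class frequencies in a fixed box. -/

theorem measurable_card_pointsIn (E : Finset (Fin n)) (a b : Fin D → ℝ) :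
    Measurable fun d : Sample D K n => (pointsIn d E a b).card := by
  unfold pointsIn
  simp_rw [Finset.card_filter]
  refine Finset.measurable_sum _ fun i _ => Measurable.ite ?_ measurable_const measurable_const
  exact (measurable_fst.comp (measurable_pi_apply i)) (measurableSet_box a b)

theorem measurable_card_class_pointsIn (E : Finset (Fin n)) (a b : Fin D → ℝ) (c : Fin K) :
    Measurable fun d : Sample D K n =>
      ((pointsIn d E a b).filter fun i => (d i).2 = c).card := by
  unfold pointsIn
  simp_rw [Finset.filter_filter, Finset.card_filter]
  refine Finset.measurable_sum _ fun i _ => Measurable.ite ?_ measurable_const measurable_const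
  exact ((measurable_fst.comp (measurable_pi_apply i)) (measurableSet_box a b)).inter
    ((measurable_snd.comp (measurable_pi_apply i)) (measurableSet_singleton c))

theorem measurable_classFreq_pointsIn (E : Finset (Fin n)) (a b : Fin D → ℝ) (c : Fin K) :
    Measurable fun d : Sample D K n => classFreq d (pointsIn d E a b) c := by
  unfold classFreq
  exact ((measurable_from_top (f := fun m : ℕ => (m : ℝ))).comp
    (measurable_card_class_pointsIn E a b c)).div
    ((measurable_from_top (f := fun m : ℕ => (m : ℝ))).comp (measurable_card_pointsIn E a b))

theorem classFreq_nonneg (d : Sample D K n) (A : Finset (Fin n)) (c : Fin K) :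
    0 ≤ classFreq d A c := by unfold classFreq; positivity

theorem classFreq_le_one (d : Sample D K n) (A : Finset (Fin n)) (c : Fin K) :
    classFreq d A c ≤ 1 := by
  unfold classFreq
  exact div_le_one_of_le₀ (by exact_mod_cast Finset.card_filter_le _ _) (by positivity)

/-- The conditional probability of label `c` given that the features lie in the box. -/
noncomputable def cellProb (P : Measure ((Fin D → ℝ) × Fin K)) (a b : Fin D → ℝ) (c : Fin K) : ℝ :=
  P.real (Prod.fst ⁻¹' box a b ∩ Prod.snd ⁻¹' {c}) / P.real (Prod.fst ⁻¹' box a b)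

section Tail

variable (P : Measure ((Fin D → ℝ) × Fin K)) [IsProbabilityMeasure P]

theorem cellProb_nonneg (a b : Fin D → ℝ) (c : Fin K) : 0 ≤ cellProb P a b c := by
  unfold cellProb; positivity

theorem cellProb_le_one (a b : Fin D → ℝ) (c : Fin K) : cellProb P a b c ≤ 1 :=
  div_le_one_of_le₀ (measureReal_mono Set.inter_subset_left) measureReal_nonneg

/-- By `exp y ≤ 1 + y + y²` for `|y| ≤ 1`: the linear terms cancel because the Bernoulli variable is
centred, the quadratic ones add up to at most `s²`, and `1 + s² ≤ exp(s²)`. -/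
theorem bernoulli_exp_le {p s : ℝ} (hp0 : 0 ≤ p) (hp1 : p ≤ 1) (hs : |s| ≤ 1) :
    p * Real.exp (s * (1 - p) - s ^ 2) + (1 - p) * Real.exp (s * (0 - p) - s ^ 2) ≤ 1 := by
  have hb : ∀ y : ℝ, |y| ≤ 1 → Real.exp (s * y) ≤ 1 + s * y + (s * y) ^ 2 := by
    intro y hy
    have h1 : |s * y| ≤ 1 := by
      rw [abs_mul]; exact mul_le_one₀ hs (abs_nonneg _) hy
    have := (abs_le.1 (Real.abs_exp_sub_one_sub_id_le h1)).2
    linarith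
  have e1 := hb (1 - p) (by rw [abs_of_nonneg] <;> linarith)
  have e2 := hb (0 - p) (by rw [abs_of_nonpos] <;> linarith)
  have h3 : p * Real.exp (s * (1 - p)) + (1 - p) * Real.exp (s * (0 - p)) ≤ 1 + s ^ 2 := by
    have h4 := mul_le_mul_of_nonneg_left e1 hp0
    have h5 := mul_le_mul_of_nonneg_left e2 (sub_nonneg.2 hp1)
    have h6 : p * (1 - p) ≤ 1 := by nlinarith
    nlinarith [mul_le_mul_of_nonneg_left h6 (sq_nonneg s)]
  have h7 := Real.add_one_le_exp (s ^ 2)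
  rw [Real.exp_sub, Real.exp_sub, ← mul_div_assoc, ← mul_div_assoc, ← add_div,
    div_le_one (Real.exp_pos _)]
  linarith

open Classical in
/-- The exponential tilt of the centred label indicator inside a box. -/
noncomputable def tilt (a b : Fin D → ℝ) (c : Fin K) (s : ℝ) (z : (Fin D → ℝ) × Fin K) : ℝ≥0∞ :=
  if z.1 ∈ box a b then
    ENNReal.ofReal (Real.exp (s * ((if z.2 = c then 1 else 0) - cellProb P a b c) - s ^ 2))
  else 1

theorem measurable_tilt (a b : Fin D → ℝ) (c : Fin K) (s : ℝ) : Measurable (tilt P a b c s) := by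
  unfold tilt
  refine Measurable.ite (measurable_fst (measurableSet_box a b)) ?_ measurable_const
  refine (Real.measurable_exp.comp (Measurable.sub_const (Measurable.const_mul
    (Measurable.sub_const (Measurable.ite (measurable_snd (measurableSet_singleton c))
      measurable_const measurable_const) _) _) _)).ennreal_ofReal

theorem setLIntegral_tilt_le (a b : Fin D → ℝ) (c : Fin K) {s : ℝ} (hs : |s| ≤ 1) :
    ∫⁻ z in Prod.fst ⁻¹' box a b, tilt P a b c s z ∂P ≤ P (Prod.fst ⁻¹' box a b) := by
  have hms : MeasurableSet (Prod.fst ⁻¹' box a b : Set ((Fin D → ℝ) × Fin K)) :=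
    measurable_fst (measurableSet_box a b)
  have hmc : MeasurableSet (Prod.snd ⁻¹' {c} : Set ((Fin D → ℝ) × Fin K)) :=
    measurable_snd (measurableSet_singleton c)
  rw [← lintegral_inter_add_sdiff _ _ hmc]
  rw [setLIntegral_congr_fun (hms.inter hmc)
      (g := fun _ => ENNReal.ofReal (Real.exp (s * (1 - cellProb P a b c) - s ^ 2)))
      (fun z hz => by
        have h1 : z.1 ∈ box a b := hz.1
        have h2 : z.2 = c := hz.2
        simp [tilt, h1, h2]),
    setLIntegral_congr_fun (hms.diff hmc)
      (g := fun _ => ENNReal.ofReal (Real.exp (s * (0 - cellProb P a b c) - s ^ 2)))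
      (fun z hz => by
        have h1 : z.1 ∈ box a b := hz.1
        have h2 : ¬ z.2 = c := hz.2
        simp [tilt, h1, h2]), setLIntegral_const, setLIntegral_const]
  rw [← ofReal_measureReal, ← ofReal_measureReal, ← ofReal_measureReal (s := Prod.fst ⁻¹' box a b),
    ← ENNReal.ofReal_mul (by positivity), ← ENNReal.ofReal_mul (by positivity),
    ← ENNReal.ofReal_add (by positivity) (by positivity)]
  refine ENNReal.ofReal_le_ofReal ?_
  have hsum := measureReal_inter_add_sdiff (μ := P) (s := Prod.fst ⁻¹' box a b) hmc
  rcases eq_or_ne (P.real (Prod.fst ⁻¹' box a b)) 0 with h0 | h0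
  · have h1 : P.real (Prod.fst ⁻¹' box a b ∩ Prod.snd ⁻¹' {c}) = 0 := by
      have : 0 ≤ P.real (Prod.fst ⁻¹' box a b ∩ Prod.snd ⁻¹' {c}) := measureReal_nonneg
      have : 0 ≤ P.real (Prod.fst ⁻¹' box a b \ Prod.snd ⁻¹' {c}) := measureReal_nonneg
      linarith
    have h2 : P.real (Prod.fst ⁻¹' box a b \ Prod.snd ⁻¹' {c}) = 0 := by linarith
    simp [h0, h1, h2]
  have hA : P.real (Prod.fst ⁻¹' box a b ∩ Prod.snd ⁻¹' {c}) =
      P.real (Prod.fst ⁻¹' box a b) * cellProb P a b c := by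
    unfold cellProb; field_simp
  have hA' : P.real (Prod.fst ⁻¹' box a b \ Prod.snd ⁻¹' {c}) =
      P.real (Prod.fst ⁻¹' box a b) * (1 - cellProb P a b c) := by
    linarith
  rw [hA, hA']
  have := mul_le_mul_of_nonneg_left
    (bernoulli_exp_le (cellProb_nonneg P a b c) (cellProb_le_one P a b c) hs)
    (measureReal_nonneg (μ := P) (s := Prod.fst ⁻¹' box a b))
  linarith

theorem prod_tilt (a b : Fin D → ℝ) (c : Fin K) (s : ℝ) (E : Finset (Fin n))
    (d : Sample D K n) :
    ∏ i ∈ E, tilt P a b c s (d i) = ENNReal.ofReal (Real.exp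
      (s * ((((pointsIn d E a b).filter fun i => (d i).2 = c).card : ℝ) -
        cellProb P a b c * (pointsIn d E a b).card) - s ^ 2 * (pointsIn d E a b).card)) := by
  classical
  unfold tilt
  rw [← Finset.prod_filter, ← ENNReal.ofReal_prod_of_nonneg fun i _ => (Real.exp_pos _).le,
    ← Real.exp_sum]
  have : pointsIn d E a b = E.filter fun i => (d i).1 ∈ box a b := by
    ext i; simp [pointsIn]
  rw [this]
  congr 2
  rw [Finset.sum_sub_distrib, ← Finset.mul_sum, Finset.sum_sub_distrib, Finset.sum_boole,
    Finset.sum_const, Finset.sum_const, nsmul_eq_mul, nsmul_eq_mul]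
  ring

open Classical in
-- Exponential Markov inequality with both tilts `s = ±ε/2`, conditionally on the number of points
-- in the box. The weight `G` plays the role of the conditioning event and must not look inside the
-- box.
theorem lintegral_mul_deviation_le {ε : ℝ} (hε0 : 0 < ε) (hε1 : ε ≤ 1) (a b : Fin D → ℝ)
    (c : Fin K) (E : Finset (Fin n)) {G : Sample D K n → ℝ≥0∞} (hG : Measurable G)
    (hB : Blind (box a b) G) :
    ∫⁻ d, G d * (if ε < |classFreq d (pointsIn d E a b) c - cellProb P a b c| then 1 else 0)
        ∂(Measure.pi fun _ => P) ≤
      ∫⁻ d, G d * ENNReal.ofReal (2 * Real.exp (-(ε ^ 2 / 4 * (pointsIn d E a b).card)))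
        ∂(Measure.pi fun _ => P) := by
  set N : Sample D K n → ℕ := fun d => (pointsIn d E a b).card with hN
  -- With `s = ε/2` and a deviation of at least `ε`, the exponent of the tilt is at least `(ε²/2 -
  -- ε²/4) N`. The factor `exp(-ε²N/4)` leaves a nonnegative exponent, and it depends on the count
  -- only, so that `H` is still blind to the box.
  set H : Sample D K n → ℝ≥0∞ := fun d =>
    G d * ENNReal.ofReal (Real.exp (-(ε ^ 2 / 4 * N d))) with hH
  have hHm : Measurable H := hG.mul ((measurable_from_top
    (f := fun m : ℕ => ENNReal.ofReal (Real.exp (-(ε ^ 2 / 4 * m))))).comp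
      (measurable_card_pointsIn E a b))
  have hHB : Blind (box a b) H := by
    intro d d' hd
    simp only [hH, hN]
    rw [hB d d' hd, pointsIn_congr_of_blind (Or.inl subset_rfl) hd]
  have htilt : ∀ s : ℝ, |s| ≤ 1 →
      ∫⁻ d, H d * ∏ i ∈ E, tilt P a b c s (d i) ∂(Measure.pi fun _ => P) ≤
        ∫⁻ d, H d ∂(Measure.pi fun _ => P) := fun s hs =>
    lintegral_tilt_le (measurableSet_box a b) (measurable_tilt P a b c s)
      (fun z hz => by simp [tilt, hz]) (setLIntegral_tilt_le P a b c hs) hHm hHB E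
  have hs1 : |ε / 2| ≤ 1 := by rw [abs_of_pos (by positivity)]; linarith
  have hs2 : |-(ε / 2)| ≤ 1 := by rwa [abs_neg]
  calc ∫⁻ d, G d * (if ε < |classFreq d (pointsIn d E a b) c - cellProb P a b c| then 1 else 0)
        ∂(Measure.pi fun _ => P)
      ≤ ∫⁻ d, H d * ∏ i ∈ E, tilt P a b c (ε / 2) (d i) +
          H d * ∏ i ∈ E, tilt P a b c (-(ε / 2)) (d i) ∂(Measure.pi fun _ => P) := by
        refine lintegral_mono fun d => ?_
        rw [← mul_add]
        simp only [hH]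
        rw [mul_assoc]
        refine mul_le_mul_right ?_ _
        split_ifs with hdev
        swap
        · exact zero_le
        rw [prod_tilt, prod_tilt, mul_add, ← ENNReal.ofReal_mul (Real.exp_pos _).le,
          ← ENNReal.ofReal_mul (Real.exp_pos _).le, ← Real.exp_add, ← Real.exp_add]
        simp only [hN]
        set m : ℝ := ((pointsIn d E a b).card : ℝ) with hm
        set mc : ℝ := (((pointsIn d E a b).filter fun i => (d i).2 = c).card : ℝ) with hmc
        set p := cellProb P a b c
        have hm0 : 0 ≤ m := by positivity
        -- An empty cell, whose frequency is 0 by convention, satisfies this trivially.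
        have hkey : ε * m ≤ |mc - p * m| := by
          rcases hm0.eq_or_lt with h | h
          · rw [← h]; simp
          · have h1 : mc - p * m = (classFreq d (pointsIn d E a b) c - p) * m := by
              unfold classFreq
              rw [sub_mul, div_mul_cancel₀ _ h.ne']
            rw [h1, abs_mul, abs_of_pos h]
            exact mul_le_mul_of_nonneg_right hdev.le hm0
        rcases le_abs.1 hkey with h | h
        · refine le_add_right ?_
          rw [← ENNReal.ofReal_one]
          refine ENNReal.ofReal_le_ofReal (Real.one_le_exp ?_)
          nlinarith [mul_le_mul_of_nonneg_left h hε0.le]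
        · refine le_add_left ?_
          rw [← ENNReal.ofReal_one]
          refine ENNReal.ofReal_le_ofReal (Real.one_le_exp ?_)
          nlinarith [mul_le_mul_of_nonneg_left h hε0.le]
    _ ≤ ∫⁻ d, H d ∂(Measure.pi fun _ => P) + ∫⁻ d, H d ∂(Measure.pi fun _ => P) := by
        have hm : Measurable fun d : Sample D K n => H d * ∏ i ∈ E, tilt P a b c (ε / 2) (d i) :=
          hHm.mul (Finset.measurable_prod _ fun i _ =>
            (measurable_tilt P a b c _).comp (measurable_pi_apply i))
        rw [lintegral_add_left hm]
        exact add_le_add (htilt _ hs1) (htilt _ hs2)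
    _ = _ := by
        rw [← two_mul, ← lintegral_const_mul _ hHm]
        refine lintegral_congr fun d => ?_
        simp only [hH]
        rw [ENNReal.ofReal_mul zero_le_two, ENNReal.ofReal_ofNat]
        ring

/-- The contribution of a leaf to the mean deviation of the class frequencies. -/
noncomputable def devCost (c : Fin K) (d : Sample D K n) (a b : Fin D → ℝ) (A : Finset (Fin n)) :
    ℝ≥0∞ :=
  P.map Prod.fst (box a b) * ENNReal.ofReal |classFreq d A c - cellProb P a b c|

theorem measurable_leafSum_devCost (k : ℕ) (c : Fin K) (E : Finset (Fin n)) (t : Tree D)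
    (a b : Fin D → ℝ) :
    Measurable fun d : Sample D K n => leafSum k d (devCost P c d) t a b (pointsIn d E a b) := by
  have hQ : ∀ a b : Fin D → ℝ,
      Measurable fun d : Sample D K n => devCost P c d a b (pointsIn d E a b) := fun a b =>
    (((measurable_classFreq_pointsIn E a b c).sub_const _).abs.ennreal_ofReal).const_mul _
  induction t generalizing a b with
  | leaf => exact hQ a b
  | node j v l r ihl ihr =>
    simp only [leafSum, left_pointsIn, right_pointsIn]
    exact Measurable.ite ((measurableSet_le measurable_const (measurable_card_pointsIn _ _ _)).inter
      (measurableSet_le measurable_const (measurable_card_pointsIn _ _ _)))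
      ((ihl _ _).add (ihr _ _)) (hQ a b)

open Classical in
theorem devCost_le (c : Fin K) (d : Sample D K n) (a b : Fin D → ℝ) (A : Finset (Fin n))
    (ε : ℝ) :
    devCost P c d a b A ≤ P.map Prod.fst (box a b) * (ENNReal.ofReal ε +
      if ε < |classFreq d A c - cellProb P a b c| then 1 else 0) := by
  refine mul_le_mul_right ?_ _
  split_ifs with h
  · refine le_add_left ?_
    rw [← ENNReal.ofReal_one]
    refine ENNReal.ofReal_le_ofReal (abs_le.2 ?_)
    have := classFreq_nonneg d A c
    have := classFreq_le_one d A c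
    have := cellProb_nonneg P a b c
    have := cellProb_le_one P a b c
    constructor <;> linarith
  · rw [add_zero]
    exact ENNReal.ofReal_le_ofReal (not_lt.1 h)

open Classical in
-- Induction over the fixed unpruned tree. The weight `G` records that the node has been reached;
-- this is decided by counts outside the box and by the total count in it, so `G` is blind to the
-- box. The potential `φ` pays for all the deviations on a path: by `hφ2`, passing to a child with
-- at least `k` fewer points releases enough to pay for the current node.
theorem lintegral_mul_leafSum_devCost_le {ε : ℝ} (hε0 : 0 < ε) (hε1 : ε ≤ 1) {k : ℕ}
    {φ : ℕ → ℝ≥0∞}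
    (hφ1 : ∀ N : ℕ, k ≤ N → ENNReal.ofReal (2 * Real.exp (-(ε ^ 2 / 4 * N))) ≤ φ N)
    (hφ2 : ∀ N N' : ℕ, N' + k ≤ N →
      ENNReal.ofReal (2 * Real.exp (-(ε ^ 2 / 4 * N))) + φ N' ≤ φ N)
    (c : Fin K) (E : Finset (Fin n)) (t : Tree D) (a b : Fin D → ℝ)
    {G : Sample D K n → ℝ≥0∞} (hG : Measurable G) (hB : Blind (box a b) G)
    (hGk : ∀ d, G d ≠ 0 → k ≤ (pointsIn d E a b).card) :
    ∫⁻ d, G d * leafSum k d (devCost P c d) t a b (pointsIn d E a b) ∂(Measure.pi fun _ => P) ≤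
      ∫⁻ d, G d * (P.map Prod.fst (box a b) *
        (ENNReal.ofReal ε + φ (pointsIn d E a b).card)) ∂(Measure.pi fun _ => P) := by
  set tail : ℕ → ℝ≥0∞ := fun N => ENNReal.ofReal (2 * Real.exp (-(ε ^ 2 / 4 * N))) with htail
  have hcount : ∀ (ψ : ℕ → ℝ≥0∞) (a b : Fin D → ℝ),
      Measurable fun d : Sample D K n => ψ (pointsIn d E a b).card := fun ψ a b =>
    (measurable_from_top (f := ψ)).comp (measurable_card_pointsIn E a b)
  have hdevm : ∀ a b : Fin D → ℝ, Measurable fun d : Sample D K n =>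
      (if ε < |classFreq d (pointsIn d E a b) c - cellProb P a b c| then (1 : ℝ≥0∞) else 0) :=
    fun a b => Measurable.ite (measurableSet_lt measurable_const
      ((measurable_classFreq_pointsIn E a b c).sub_const _).abs) measurable_const measurable_const
  have hGdev : ∀ (G : Sample D K n → ℝ≥0∞) (a b : Fin D → ℝ), Measurable G → Measurable fun d =>
      G d * (if ε < |classFreq d (pointsIn d E a b) c - cellProb P a b c| then 1 else 0) :=
    fun G a b hG => hG.mul (hdevm a b)
  have hGtail : ∀ (G : Sample D K n → ℝ≥0∞) (a b : Fin D → ℝ), Measurable G → Measurable fun d =>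
      G d * tail (pointsIn d E a b).card := fun G a b hG => hG.mul (hcount tail a b)
  induction t generalizing a b G with
  | leaf =>
    calc ∫⁻ d, G d * devCost P c d a b (pointsIn d E a b) ∂(Measure.pi fun _ => P)
        ≤ ∫⁻ d, P.map Prod.fst (box a b) * (ENNReal.ofReal ε * G d) +
            P.map Prod.fst (box a b) * (G d *
              (if ε < |classFreq d (pointsIn d E a b) c - cellProb P a b c| then 1 else 0))
            ∂(Measure.pi fun _ => P) := by
          refine lintegral_mono fun d => ?_
          refine (mul_le_mul_right (devCost_le P c d a b _ ε) _).trans (le_of_eq ?_)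
          ring
      _ ≤ ∫⁻ d, P.map Prod.fst (box a b) * (ENNReal.ofReal ε * G d) ∂(Measure.pi fun _ => P) +
            P.map Prod.fst (box a b) * ∫⁻ d, G d * tail (pointsIn d E a b).card
              ∂(Measure.pi fun _ => P) := by
          rw [lintegral_add_left ((hG.const_mul _).const_mul _),
            lintegral_const_mul _ (hGdev G a b hG)]
          exact add_le_add_right (mul_le_mul_right
            (lintegral_mul_deviation_le P hε0 hε1 a b c E hG hB) _) _
      _ = ∫⁻ d, G d * (P.map Prod.fst (box a b) *
            (ENNReal.ofReal ε + tail (pointsIn d E a b).card)) ∂(Measure.pi fun _ => P) := by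
          rw [← lintegral_const_mul _ (hGtail G a b hG),
            ← lintegral_add_left ((hG.const_mul _).const_mul _)]
          refine lintegral_congr fun d => ?_
          ring
      _ ≤ _ := by
          refine lintegral_mono fun d => ?_
          by_cases h : G d = 0
          · simp [h]
          · exact mul_le_mul_right (mul_le_mul_right
              (add_le_add_right (hφ1 _ (hGk d h)) _) _) _
  | node j v l r ihl ihr =>
    set μ := P.map Prod.fst with hμ
    set bl := upper b j v with hbl
    set ar := lower a j v with har
    -- The node is split (`o`) or becomes a leaf (`o'`). Both indicators depend on the two child
    -- counts, so neither is blind to the box itself. However, `o` is blind to each child box, which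
    -- is what the recursion requires.
    set o : Sample D K n → ℝ≥0∞ := fun d =>
      if k ≤ (pointsIn d E a bl).card ∧ k ≤ (pointsIn d E ar b).card then 1 else 0 with ho
    set o' : Sample D K n → ℝ≥0∞ := fun d =>
      if k ≤ (pointsIn d E a bl).card ∧ k ≤ (pointsIn d E ar b).card then 0 else 1 with ho'
    have hoS : MeasurableSet {d : Sample D K n | k ≤ (pointsIn d E a bl).card ∧
        k ≤ (pointsIn d E ar b).card} :=
      (measurableSet_le measurable_const (measurable_card_pointsIn _ _ _)).inter
        (measurableSet_le measurable_const (measurable_card_pointsIn _ _ _))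
    have hom : Measurable o := Measurable.ite hoS measurable_const measurable_const
    have hom' : Measurable o' := Measurable.ite hoS measurable_const measurable_const
    have hdisj : Disjoint (box a bl) (box ar b) := disjoint_box_upper_lower a b j v
    have hl := ihl a bl (G := fun d => G d * o d) (hG.mul hom) (by
      intro d d' hd
      simp only [ho]
      rw [hB.mono (box_upper_subset a b j v) d d' hd,
        pointsIn_congr_of_blind (a := a) (b := bl) (Or.inl subset_rfl) hd,
        pointsIn_congr_of_blind (a := ar) (b := b) (Or.inr hdisj) hd]) (by
      intro d hd
      by_contra hcon
      simp [ho, hcon] at hd)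
    have hr := ihr ar b (G := fun d => G d * o d) (hG.mul hom) (by
      intro d d' hd
      simp only [ho]
      rw [hB.mono (box_lower_subset a b j v) d d' hd,
        pointsIn_congr_of_blind (a := a) (b := bl) (Or.inr hdisj.symm) hd,
        pointsIn_congr_of_blind (a := ar) (b := b) (Or.inl subset_rfl) hd]) (by
      intro d hd
      by_contra hcon
      simp [ho, hcon] at hd)
    set Wl : Sample D K n → ℝ≥0∞ := fun d =>
      leafSum k d (devCost P c d) l a bl (pointsIn d E a bl) with hWl
    set Wr : Sample D K n → ℝ≥0∞ := fun d =>
      leafSum k d (devCost P c d) r ar b (pointsIn d E ar b) with hWr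
    have hWlm : Measurable Wl := measurable_leafSum_devCost P k c E l a bl
    have hWrm : Measurable Wr := measurable_leafSum_devCost P k c E r ar b
    set dev : Sample D K n → ℝ≥0∞ := fun d =>
      if ε < |classFreq d (pointsIn d E a b) c - cellProb P a b c| then 1 else 0 with hdev
    -- In the last term the factor `o'` is dropped: `G * dev` has a blind weight while `G * o' *
    -- dev` does not. The price is that a deviation at a node that is split is paid for as well.
    have hsplit : ∀ d, G d * leafSum k d (devCost P c d) (Tree.node j v l r) a b
        (pointsIn d E a b) ≤ G d * o d * Wl d + (G d * o d * Wr d +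
          (μ (box a b) * ENNReal.ofReal ε * (G d * o' d) + μ (box a b) * (G d * dev d))) := by
      intro d
      simp only [leafSum, left_pointsIn, right_pointsIn]
      by_cases h : k ≤ (pointsIn d E a bl).card ∧ k ≤ (pointsIn d E ar b).card
      · rw [if_pos h]
        have : o d = 1 := by simp [ho, h]
        rw [this, mul_one, ← add_assoc, mul_add]
        exact le_self_add
      · rw [if_neg h]
        have h1 : o d = 0 := by simp [ho, h]
        have h2 : o' d = 1 := by simp only [ho', if_neg h]
        rw [h1, h2]
        refine (mul_le_mul_right (devCost_le P c d a b _ ε) _).trans (le_of_eq ?_)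
        simp only [hdev]
        ring
    have hmeas1 : Measurable fun d => G d * o d * Wl d := (hG.mul hom).mul hWlm
    have hmeas2 : Measurable fun d => G d * o d * Wr d := (hG.mul hom).mul hWrm
    have hmeas3 : Measurable fun d => μ (box a b) * ENNReal.ofReal ε * (G d * o' d) :=
      (hG.mul hom').const_mul _
    have hmeasl : Measurable fun d => G d * o d * (μ (box a bl) *
        (ENNReal.ofReal ε + φ (pointsIn d E a bl).card)) :=
      (hG.mul hom).mul (((hcount φ a bl).const_add _).const_mul _)
    have hmeasr : Measurable fun d => G d * o d * (μ (box ar b) *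
        (ENNReal.ofReal ε + φ (pointsIn d E ar b).card)) :=
      (hG.mul hom).mul (((hcount φ ar b).const_add _).const_mul _)
    calc ∫⁻ d, G d * leafSum k d (devCost P c d) (Tree.node j v l r) a b
          (pointsIn d E a b) ∂(Measure.pi fun _ => P)
        ≤ _ := lintegral_mono hsplit
      _ = ∫⁻ d, G d * o d * Wl d ∂(Measure.pi fun _ => P) +
          (∫⁻ d, G d * o d * Wr d ∂(Measure.pi fun _ => P) +
          (∫⁻ d, μ (box a b) * ENNReal.ofReal ε * (G d * o' d) ∂(Measure.pi fun _ => P) +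
            μ (box a b) * ∫⁻ d, G d * dev d ∂(Measure.pi fun _ => P))) := by
          rw [lintegral_add_left hmeas1, lintegral_add_left hmeas2, lintegral_add_left hmeas3,
            lintegral_const_mul _ (hGdev G a b hG)]
      _ ≤ ∫⁻ d, G d * o d * (μ (box a bl) * (ENNReal.ofReal ε + φ (pointsIn d E a bl).card))
            ∂(Measure.pi fun _ => P) +
          (∫⁻ d, G d * o d * (μ (box ar b) * (ENNReal.ofReal ε + φ (pointsIn d E ar b).card))
            ∂(Measure.pi fun _ => P) +
          (∫⁻ d, μ (box a b) * ENNReal.ofReal ε * (G d * o' d) ∂(Measure.pi fun _ => P) +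
            μ (box a b) * ∫⁻ d, G d * tail (pointsIn d E a b).card
              ∂(Measure.pi fun _ => P))) :=
          add_le_add hl (add_le_add hr (add_le_add_right (mul_le_mul_right
            (lintegral_mul_deviation_le P hε0 hε1 a b c E hG hB) _) _))
      _ = ∫⁻ d, G d * o d * (μ (box a bl) * (ENNReal.ofReal ε + φ (pointsIn d E a bl).card)) +
          (G d * o d * (μ (box ar b) * (ENNReal.ofReal ε + φ (pointsIn d E ar b).card)) +
          (μ (box a b) * ENNReal.ofReal ε * (G d * o' d) +
            μ (box a b) * (G d * tail (pointsIn d E a b).card))) ∂(Measure.pi fun _ => P) := by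
          rw [lintegral_add_left hmeasl, lintegral_add_left hmeasr, lintegral_add_left hmeas3,
            lintegral_const_mul _ (hGtail G a b hG)]
      _ ≤ _ := by
          refine lintegral_mono fun d => ?_
          simp only
          by_cases hG0 : G d = 0
          · simp [hG0]
          by_cases h : k ≤ (pointsIn d E a bl).card ∧ k ≤ (pointsIn d E ar b).card
          · have h1 : o d = 1 := by simp [ho, h]
            have h2 : o' d = 0 := by simp only [ho', if_pos h]
            -- When the node is split each child has at least `k` points, so its sibling has at
            -- least `k` fewer points than the parent, as `hφ2` demands.
            have hcard : (pointsIn d E a bl).card + (pointsIn d E ar b).card =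
                (pointsIn d E a b).card := by
              rw [hbl, har, ← left_pointsIn, ← right_pointsIn, card_left_add_card_right]
            have hl' := hφ2 (pointsIn d E a b).card (pointsIn d E a bl).card (by omega)
            have hr' := hφ2 (pointsIn d E a b).card (pointsIn d E ar b).card (by omega)
            rw [h1, h2]
            calc _ = G d * (μ (box a bl) * (ENNReal.ofReal ε +
                    (tail (pointsIn d E a b).card + φ (pointsIn d E a bl).card)) +
                  μ (box ar b) * (ENNReal.ofReal ε +
                    (tail (pointsIn d E a b).card + φ (pointsIn d E ar b).card))) := by
                  rw [← measure_box_split μ a b j v]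
                  ring
              _ ≤ G d * (μ (box a bl) * (ENNReal.ofReal ε + φ (pointsIn d E a b).card) +
                  μ (box ar b) * (ENNReal.ofReal ε + φ (pointsIn d E a b).card)) :=
                  mul_le_mul_right (add_le_add
                    (mul_le_mul_right (add_le_add_right hl' _) _)
                    (mul_le_mul_right (add_le_add_right hr' _) _)) _
              _ = _ := by
                  rw [← add_mul, measure_box_split μ a b j v]
          · have h1 : o d = 0 := by simp [ho, h]
            have h2 : o' d = 1 := by simp only [ho', if_neg h]
            rw [h1, h2]
            calc _ = G d * (μ (box a b) * (ENNReal.ofReal ε + tail (pointsIn d E a b).card)) := by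
                  ring
              _ ≤ _ := mul_le_mul_right (mul_le_mul_right
                (add_le_add_right (hφ1 _ (hGk d hG0)) _) _) _

/-- The bound on the expected number of deviating nodes along a path. -/
noncomputable def pathTail (ε : ℝ) (k : ℕ) : ℝ :=
  2 * Real.exp (-(ε ^ 2 / 4 * k)) / (1 - Real.exp (-(ε ^ 2 / 4 * k)))

theorem tendsto_pathTail {ε : ℝ} (hε : 0 < ε) : Tendsto (pathTail ε) atTop (𝓝 0) := by
  have h1 : Tendsto (fun k : ℕ => Real.exp (-(ε ^ 2 / 4 * k))) atTop (𝓝 0) :=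
    Real.tendsto_exp_neg_atTop_nhds_zero.comp
      (tendsto_natCast_atTop_atTop.const_mul_atTop (by positivity))
  have := (h1.const_mul 2).div (h1.const_sub 1) (by norm_num)
  rw [mul_zero, zero_div] at this
  exact this

/-- The potential is `φ(N) = γ (1 - exp(-ε²N/4))`, bounded by `γ` uniformly in the number of points.
-/
theorem lintegral_leafSum_devCost_le {ε : ℝ} (hε0 : 0 < ε) (hε1 : ε ≤ 1) {k : ℕ} (hk : 0 < k)
    (c : Fin K) (E : Finset (Fin n)) (hkE : k ≤ E.card) (t : Tree D) {a b : Fin D → ℝ}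
    (hP : ∀ᵐ d ∂(Measure.pi fun _ : Fin n => P), ∀ i, (d i).1 ∈ box a b) :
    ∫⁻ d, leafSum k d (devCost P c d) t a b E ∂(Measure.pi fun _ : Fin n => P) ≤
      ENNReal.ofReal (ε + pathTail ε k) := by
  classical
  set r := Real.exp (-(ε ^ 2 / 4 * k)) with hr
  have hr0 : 0 < r := Real.exp_pos _
  have hr1 : r < 1 := by
    rw [hr, Real.exp_lt_one_iff]
    have : (0 : ℝ) < k := by exact_mod_cast hk
    have : 0 < ε ^ 2 / 4 * k := by positivity
    linarith
  set γ := pathTail ε k with hγ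
  have hγ1 : γ * (1 - r) = 2 * r := div_mul_cancel₀ _ (by linarith)
  have hγ0 : 0 ≤ γ := div_nonneg (by positivity) (by linarith)
  set u : ℕ → ℝ := fun N => Real.exp (-(ε ^ 2 / 4 * N)) with hu
  have hu0 : ∀ N, 0 < u N := fun N => Real.exp_pos _
  have hanti : ∀ N N', N' ≤ N → u N ≤ u N' := fun N N' h => by
    refine Real.exp_le_exp.2 (neg_le_neg ?_)
    have : (N' : ℝ) ≤ N := by exact_mod_cast h
    gcongr
  have hu1 : ∀ N, u N ≤ 1 := fun N => Real.exp_le_one_iff.2 (by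
    have : 0 ≤ ε ^ 2 / 4 * N := by positivity
    linarith)
  have huadd : ∀ N, u (N + k) = u N * r := fun N => by
    simp only [hu, hr]
    rw [← Real.exp_add]; push_cast; congr 1; ring
  have huk : u k = r := rfl
  have hφ0 : ∀ N, 0 ≤ γ * (1 - u N) := fun N => mul_nonneg hγ0 (by linarith [hu1 N])
  -- The choice `γ (1 - r) = 2r` is forced by the case `N = k` of the first condition. The second
  -- follows from it, because `u N ≤ r * u N'` when `N' + k ≤ N`.
  have hmain := lintegral_mul_leafSum_devCost_le P hε0 hε1 (k := k)
    (φ := fun N => ENNReal.ofReal (γ * (1 - u N)))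
    (fun N hN => by
      refine ENNReal.ofReal_le_ofReal ?_
      have := hanti _ _ hN
      change 2 * u N ≤ γ * (1 - u N)
      nlinarith)
    (fun N N' hN => by
      rw [← ENNReal.ofReal_add (by positivity) (hφ0 N')]
      refine ENNReal.ofReal_le_ofReal ?_
      change 2 * u N + γ * (1 - u N') ≤ γ * (1 - u N)
      have h1 : u N ≤ u N' * r := by rw [← huadd]; exact hanti _ _ hN
      have h2 : 2 * u N ≤ u N' * (2 * r) := by linarith
      rw [← hγ1] at h2
      nlinarith)
    -- This initial weight equals 1 almost surely, since all points lie in the root box and `k ≤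
    -- E.card`. It is written as an indicator so that the root satisfies the requirement that a
    -- nonzero weight implies at least `k` points.
    c E t a b (G := fun d => if k ≤ (pointsIn d E a b).card then 1 else 0)
    (Measurable.ite (measurableSet_le measurable_const (measurable_card_pointsIn _ _ _))
      measurable_const measurable_const)
    (fun d d' hd => by
      simp only [pointsIn_congr_of_blind (E := E) (Or.inl subset_rfl) hd])
    (fun d hd => by by_contra hcon; simp [hcon] at hd)
  have heq : ∀ᵐ d ∂(Measure.pi fun _ : Fin n => P), pointsIn d E a b = E := by
    filter_upwards [hP] with d hd using pointsIn_eq_self fun i _ => hd i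
  calc ∫⁻ d, leafSum k d (devCost P c d) t a b E ∂(Measure.pi fun _ : Fin n => P)
      = _ := by
        refine lintegral_congr_ae ?_
        filter_upwards [heq] with d hd
        rw [hd, if_pos hkE, one_mul]
    _ ≤ _ := hmain
    _ ≤ ∫⁻ _d, ENNReal.ofReal (ε + γ) ∂(Measure.pi fun _ : Fin n => P) := by
        refine lintegral_mono fun d => ?_
        have h1 : (if k ≤ (pointsIn d E a b).card then (1 : ℝ≥0∞) else 0) ≤ 1 := by
          split_ifs <;> simp
        have : IsProbabilityMeasure (P.map Prod.fst) :=
          Measure.isProbabilityMeasure_map measurable_fst.aemeasurable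
        have h2 : P.map Prod.fst (box a b) ≤ 1 := prob_le_one
        calc _ ≤ 1 * (1 * (ENNReal.ofReal ε +
              ENNReal.ofReal (γ * (1 - u (pointsIn d E a b).card)))) :=
              mul_le_mul' h1 (mul_le_mul' h2 le_rfl)
          _ = ENNReal.ofReal (ε + γ * (1 - u (pointsIn d E a b).card)) := by
              rw [one_mul, one_mul, ENNReal.ofReal_add hε0.le (hφ0 _)]
          _ ≤ _ := by
              refine ENNReal.ofReal_le_ofReal ?_
              have := hu0 (pointsIn d E a b).card
              nlinarith
    _ = _ := by simp

end Tail

/-! ### Approximation of the regression function on the leaves -/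

theorem le_lower (a : Fin D → ℝ) (j : Fin D) (v : ℝ) : a ≤ lower a j v := by
  intro i
  by_cases hi : i = j
  · subst hi; simp [lower]
  · simp [lower, hi]

theorem upper_le (b : Fin D → ℝ) (j : Fin D) (v : ℝ) : upper b j v ≤ b := by
  intro i
  by_cases hi : i = j
  · subst hi; simp [upper]
  · simp [upper, hi]

theorem leafSum_mono_of_le {k : ℕ} {d : Sample D K n}
    {Q Q' : (Fin D → ℝ) → (Fin D → ℝ) → Finset (Fin n) → ℝ≥0∞} {a₀ b₀ : Fin D → ℝ}
    (h : ∀ a b E, a₀ ≤ a → b ≤ b₀ → Q a b E ≤ Q' a b E) (t : Tree D) {a b : Fin D → ℝ}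
    (ha : a₀ ≤ a) (hb : b ≤ b₀) (E : Finset (Fin n)) :
    leafSum k d Q t a b E ≤ leafSum k d Q' t a b E := by
  induction t generalizing a b E with
  | leaf => exact h a b E ha hb
  | node j v l r ihl ihr =>
    simp only [leafSum]
    split_ifs
    · exact add_le_add (ihl ha ((upper_le b j v).trans hb) _)
        (ihr (ha.trans (le_lower a j v)) hb _)
    · exact h a b E ha hb

/-- The uniform distribution on the unit cube. -/
noncomputable def unitVolume (D : ℕ) : Measure (Fin D → ℝ) := volume.restrict (box 0 1)

open Classical in
/-- The volume of the box if its `j`-th side contains `[q, q + w]`, and `0` otherwise. -/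
noncomputable def spanCost (j : Fin D) (q w : ℝ) (a b : Fin D → ℝ) : ℝ≥0∞ :=
  if a j ≤ q ∧ q + w < b j then unitVolume D (box a b) else 0

/-- The first grid point to the right of `u` is less than `1/N` away, so one full grid step still
fits before `v`. -/
theorem exists_spans {N : ℕ} (hN : 0 < N) {u v : ℝ} (hu : 0 ≤ u) (hv : v ≤ 1)
    (h : 2 / (N : ℝ) < v - u) :
    ∃ i ∈ Finset.range N, u ≤ (i : ℝ) / N ∧ (i : ℝ) / N + 1 / N < v := by
  have hN' : (0 : ℝ) < N := by exact_mod_cast hN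
  have h1 : u * N ≤ ⌈u * N⌉₊ := Nat.le_ceil _
  have h2 : (⌈u * N⌉₊ : ℝ) < u * N + 1 := Nat.ceil_lt_add_one (by positivity)
  have h3 : (⌈u * N⌉₊ : ℝ) / N + 1 / N < v := by
    rw [← add_div, div_lt_iff₀ hN']
    rw [div_lt_iff₀ hN'] at h
    nlinarith
  refine ⟨⌈u * N⌉₊, ?_, (le_div_iff₀ hN').2 h1, h3⟩
  rw [Finset.mem_range]
  have h4 : ((⌈u * N⌉₊ : ℝ) + 1) / N < 1 := by rw [add_div]; linarith
  rw [div_lt_one hN'] at h4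
  have : (⌈u * N⌉₊ : ℝ) < N := by linarith
  exact_mod_cast this

section Bias

variable [NeZero K] (P : Measure ((Fin D → ℝ) × Fin K)) [IsProbabilityMeasure P]

theorem integrable_eta (μ : Measure (Fin D → ℝ)) [IsFiniteMeasure μ] (c : Fin K) :
    Integrable (fun x => eta P x c) μ :=
  Integrable.of_bound (measurable_eta P c).aestronglyMeasurable 1 (Eventually.of_forall fun x => by
    rw [Real.norm_of_nonneg (eta_nonneg P x c)]; exact eta_le_one P x c)

theorem measure_cell_eq (a b : Fin D → ℝ) (c : Fin K) :
    P.real (Prod.fst ⁻¹' box a b ∩ Prod.snd ⁻¹' {c}) =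
      ∫ x in box a b, eta P x c ∂(P.map Prod.fst) := by
  have : IsProbabilityMeasure (P.map Prod.fst) :=
    Measure.isProbabilityMeasure_map measurable_fst.aemeasurable
  have hms : MeasurableSet (Prod.fst ⁻¹' box a b ∩ Prod.snd ⁻¹' {c} : Set ((Fin D → ℝ) × Fin K)) :=
    (measurable_fst (measurableSet_box a b)).inter (measurable_snd (measurableSet_singleton c))
  rw [measureReal_def, ← lintegral_indicator_one hms,
    lintegral_eq_lintegral_eta P (measurable_one.indicator hms),
    integral_eq_lintegral_of_nonneg_ae (Eventually.of_forall fun x => eta_nonneg P x c)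
      (measurable_eta P c).aestronglyMeasurable, ← lintegral_indicator (measurableSet_box a b)]
  congr 1
  refine lintegral_congr fun x => ?_
  rw [Finset.sum_eq_single c]
  · by_cases hx : x ∈ box a b <;> simp [hx]
  · intro y _ hy
    simp [hy]
  · simp

/-- The contribution of a leaf to the approximation error of the regression function. -/
noncomputable def biasCost (c : Fin K) (a b : Fin D → ℝ) : ℝ≥0∞ :=
  ∫⁻ x in box a b, ENNReal.ofReal |cellProb P a b c - eta P x c| ∂(P.map Prod.fst)

theorem biasCost_le_measure (c : Fin K) (a b : Fin D → ℝ) :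
    biasCost P c a b ≤ P.map Prod.fst (box a b) := by
  calc biasCost P c a b ≤ ∫⁻ _x in box a b, 1 ∂(P.map Prod.fst) := by
        refine lintegral_mono fun x => ?_
        rw [← ENNReal.ofReal_one]
        refine ENNReal.ofReal_le_ofReal (abs_le.2 ?_)
        have := eta_nonneg P x c
        have := eta_le_one P x c
        have := cellProb_nonneg P a b c
        have := cellProb_le_one P a b c
        constructor <;> linarith
    _ = _ := by simp

/-- Replace `eta` by `h` twice, once in the cell average and once at the point. Averaging over the
cell does not increase the `L¹` distance, so each replacement costs the same integral, and the
oscillation of `h` is paid for once. -/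
theorem biasCost_le_of_oscillation (c : Fin K) (a b : Fin D → ℝ) {h : (Fin D → ℝ) → ℝ}
    (hh : Measurable h) {ε : ℝ} (hε : ∀ x ∈ box a b, ∀ y ∈ box a b, |h x - h y| ≤ ε) :
    biasCost P c a b ≤
      2 * ∫⁻ x in box a b, ENNReal.ofReal |eta P x c - h x| ∂(P.map Prod.fst) +
        ENNReal.ofReal ε * P.map Prod.fst (box a b) := by
  set μ := P.map Prod.fst with hμ
  have : IsProbabilityMeasure μ := Measure.isProbabilityMeasure_map measurable_fst.aemeasurable
  set I := ∫⁻ x in box a b, ENNReal.ofReal |eta P x c - h x| ∂μ with hI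
  set m := μ (box a b) with hm
  have hmeas : Measurable fun x => ENNReal.ofReal |eta P x c - h x| :=
    ((measurable_eta P c).sub hh).abs.ennreal_ofReal
  rcases eq_or_ne m 0 with hm0 | hm0
  · exact (biasCost_le_measure P c a b).trans (by rw [← hμ, ← hm, hm0]; exact zero_le)
  have hmt : m ≠ ⊤ := measure_ne_top _ _
  have hmr : (0 : ℝ) < μ.real (box a b) := ENNReal.toReal_pos hm0 hmt
  have hPm : P.real (Prod.fst ⁻¹' box a b) = μ.real (box a b) := by
    rw [hμ, measureReal_def, measureReal_def,
      Measure.map_apply measurable_fst (measurableSet_box a b)]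
  have hpoint : ∀ x ∈ box a b,
      ENNReal.ofReal |cellProb P a b c - h x| ≤ (I + ENNReal.ofReal ε * m) / m := by
    intro x hx
    rw [ENNReal.le_div_iff_mul_le (Or.inl hm0) (Or.inl hmt)]
    have h1 : (cellProb P a b c - h x) * μ.real (box a b) =
        ∫ y in box a b, (eta P y c - h x) ∂μ := by
      rw [integral_sub (integrable_eta P _ c) (integrable_const _), ← measure_cell_eq,
        setIntegral_const, cellProb, hPm, sub_mul, div_mul_cancel₀ _ hmr.ne', smul_eq_mul]
      ring
    calc ENNReal.ofReal |cellProb P a b c - h x| * m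
        = ENNReal.ofReal |∫ y in box a b, (eta P y c - h x) ∂μ| := by
          rw [← h1, abs_mul, abs_of_pos hmr, ENNReal.ofReal_mul (abs_nonneg _), ofReal_measureReal]
      _ ≤ ∫⁻ y in box a b, ENNReal.ofReal |eta P y c - h x| ∂μ := by
          rw [← Real.norm_eq_abs, ofReal_norm]
          refine (enorm_integral_le_lintegral_enorm _).trans (le_of_eq ?_)
          refine lintegral_congr fun y => ?_
          rw [← ofReal_norm, Real.norm_eq_abs]
      _ ≤ ∫⁻ y in box a b, (ENNReal.ofReal |eta P y c - h y| + ENNReal.ofReal ε) ∂μ := by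
          refine setLIntegral_mono' (measurableSet_box a b) fun y hy => ?_
          refine (ENNReal.ofReal_le_ofReal ?_).trans ENNReal.ofReal_add_le
          have := abs_sub_le (eta P y c) (h y) (h x)
          have := hε y hy x hx
          linarith
      _ = I + ENNReal.ofReal ε * m := by
          rw [lintegral_add_left hmeas, setLIntegral_const]
  calc biasCost P c a b
      ≤ ∫⁻ x in box a b, ((I + ENNReal.ofReal ε * m) / m +
          ENNReal.ofReal |eta P x c - h x|) ∂μ := by
        refine setLIntegral_mono' (measurableSet_box a b) fun x hx => ?_
        refine le_trans ?_ (add_le_add_left (hpoint x hx) _)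
        refine (ENNReal.ofReal_le_ofReal ?_).trans ENNReal.ofReal_add_le
        have := abs_sub_le (cellProb P a b c) (h x) (eta P x c)
        rw [abs_sub_comm (h x)] at this
        exact this
    _ = (I + ENNReal.ofReal ε * m) / m * m + I := by
        rw [lintegral_add_left measurable_const, setLIntegral_const]
    _ = 2 * I + ENNReal.ofReal ε * m := by
        rw [ENNReal.div_mul_cancel hm0 hmt]; ring

/-- The part of the density below `R` is controlled by volume; the remainder is a set whose mass
will be small for large `R`. -/
theorem measure_box_le {f : (Fin D → ℝ) → ℝ≥0∞} (hf : Measurable f)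
    (hPf : P.map Prod.fst = (unitVolume D).withDensity f) (R : ℝ≥0∞) (A : Set (Fin D → ℝ))
    (hA : MeasurableSet A) :
    P.map Prod.fst A ≤ R * unitVolume D A + P.map Prod.fst (A ∩ {x | R < f x}) := by
  have hR : MeasurableSet {x | R < f x} := measurableSet_lt measurable_const hf
  rw [← measure_inter_add_sdiff A hR, add_comm]
  refine add_le_add_left ?_ _
  rw [hPf, withDensity_apply _ (hA.diff hR)]
  calc ∫⁻ x in A \ {x | R < f x}, f x ∂(unitVolume D)
      ≤ ∫⁻ _x in A \ {x | R < f x}, R ∂(unitVolume D) :=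
        setLIntegral_mono' (hA.diff hR) fun x hx => not_lt.1 hx.2
    _ = R * unitVolume D (A \ {x | R < f x}) := by rw [setLIntegral_const]
    _ ≤ _ := mul_le_mul_right (measure_mono Set.sdiff_subset) _

/-- The cost of narrow cells and the mass where the density exceeds `R` are additive, hence sum to
their value on the cube. Only the volume of the wide cells depends on the tree, and `spanCost`
records it. -/
theorem leafSum_biasCost_le {f : (Fin D → ℝ) → ℝ≥0∞} (hf : Measurable f)
    (hPf : P.map Prod.fst = (unitVolume D).withDensity f) (R : ℝ≥0∞)
    (c : Fin K) {h : (Fin D → ℝ) → ℝ} (hh : Measurable h) {ε : ℝ} {N : ℕ} (hN : 0 < N)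
    (hε : ∀ x y, dist x y ≤ 2 / (N : ℝ) → |h x - h y| ≤ ε)
    (k : ℕ) (d : Sample D K n) (t : Tree D) (E : Finset (Fin n)) :
    leafSum k d (fun a b _ => biasCost P c a b) t 0 1 E ≤
      2 * ∫⁻ x, ENNReal.ofReal |eta P x c - h x| ∂(P.map Prod.fst) + ENNReal.ofReal ε +
        P.map Prod.fst {x | R < f x} +
        R * ∑ j : Fin D, ∑ i ∈ Finset.range N,
          leafSum k d (fun a b _ => spanCost j ((i : ℝ) / N) (1 / N) a b) t 0 1 E := by
  set μ := P.map Prod.fst with hμ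
  have : IsProbabilityMeasure μ := Measure.isProbabilityMeasure_map measurable_fst.aemeasurable
  set q : (Fin D → ℝ) → (Fin D → ℝ) → ℝ≥0∞ := fun a b =>
    2 * ∫⁻ x in box a b, ENNReal.ofReal |eta P x c - h x| ∂μ + ENNReal.ofReal ε * μ (box a b) +
      μ (box a b ∩ {x | R < f x}) with hq
  have hqadd : ∀ a b j v, q a (upper b j v) + q (lower a j v) b = q a b := by
    intro a b j v
    simp only [hq]
    rw [← setLIntegral_box_split μ _ a b j v, ← measure_box_split μ a b j v,
      ← measure_box_inter_split μ _ a b j v]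
    ring
  have hle : ∀ a b (A : Finset (Fin n)), 0 ≤ a → b ≤ 1 → biasCost P c a b ≤ q a b +
      R * ∑ j : Fin D, ∑ i ∈ Finset.range N, spanCost j ((i : ℝ) / N) (1 / N) a b := by
    intro a b _ ha hb
    -- A cell with all sides at most `2/N` has diameter at most `2/N` in the sup distance. Any
    -- longer side contains a full interval of the grid of mesh `1/N`.
    by_cases hw : ∀ j, b j - a j ≤ 2 / (N : ℝ)
    · refine (biasCost_le_of_oscillation P c a b hh fun x hx y hy => hε x y ?_).trans
        (le_add_right le_self_add)
      rw [dist_pi_le_iff (by positivity)]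
      intro j
      rw [Real.dist_eq, abs_le]
      have := hx j
      have := hy j
      have := hw j
      constructor <;> linarith
    · push Not at hw
      obtain ⟨j, hj⟩ := hw
      obtain ⟨i, hi, h1, h2⟩ := exists_spans hN (ha j) (hb j) hj
      have hs : unitVolume D (box a b) ≤
          ∑ j : Fin D, ∑ i ∈ Finset.range N, spanCost j ((i : ℝ) / N) (1 / N) a b := by
        calc unitVolume D (box a b) = spanCost j ((i : ℝ) / N) (1 / N) a b := by
              rw [spanCost, if_pos ⟨h1, h2⟩]
          _ ≤ ∑ i ∈ Finset.range N, spanCost j ((i : ℝ) / N) (1 / N) a b :=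
              Finset.single_le_sum (f := fun i : ℕ => spanCost j ((i : ℝ) / N) (1 / N) a b)
                (fun _ _ => zero_le) hi
          _ ≤ _ := Finset.single_le_sum (f := fun j : Fin D => ∑ i ∈ Finset.range N,
                spanCost j ((i : ℝ) / N) (1 / N) a b) (fun _ _ => zero_le) (Finset.mem_univ j)
      calc biasCost P c a b ≤ μ (box a b) := biasCost_le_measure P c a b
        _ ≤ R * unitVolume D (box a b) + μ (box a b ∩ {x | R < f x}) :=
            measure_box_le P hf hPf R _ (measurableSet_box a b)
        _ ≤ _ := by
            rw [add_comm]
            exact add_le_add le_add_self (mul_le_mul_right hs _)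
  refine (leafSum_mono_of_le hle t le_rfl le_rfl E).trans ?_
  rw [leafSum_add, leafSum_additive q hqadd, leafSum_const_mul, leafSum_finset_sum]
  simp_rw [leafSum_finset_sum]
  refine add_le_add_left ?_ _
  simp only [hq]
  refine add_le_add (add_le_add (mul_le_mul_right (setLIntegral_le_lintegral _ _) _) ?_)
    (measure_mono Set.inter_subset_right)
  calc ENNReal.ofReal ε * μ (box 0 1) ≤ ENNReal.ofReal ε * 1 := mul_le_mul_right prob_le_one _
    _ = _ := mul_one _

theorem exists_uniformContinuous_approx (c : Fin K) {ε : ℝ≥0∞} (hε : ε ≠ 0) :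
    ∃ h : (Fin D → ℝ) → ℝ, UniformContinuous h ∧
      ∫⁻ x, ENNReal.ofReal |eta P x c - h x| ∂(P.map Prod.fst) ≤ ε := by
  have : IsProbabilityMeasure (P.map Prod.fst) :=
    Measure.isProbabilityMeasure_map measurable_fst.aemeasurable
  obtain ⟨h, hs, hle, hc, -⟩ :=
    (integrable_eta P (P.map Prod.fst) c).exists_hasCompactSupport_lintegral_sub_le hε
  refine ⟨h, hc.uniformContinuous_of_tendsto_cocompact hs.is_zero_at_infty, ?_⟩
  refine le_trans (le_of_eq (lintegral_congr fun x => ?_)) hle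
  rw [← ofReal_norm, Real.norm_eq_abs]

end Bias

/-! ### Uniform law of large numbers on boxes -/

theorem volume_box_update (a b : Fin D → ℝ) (j : Fin D) (u v : ℝ) :
    volume (box (Function.update a j u) (Function.update b j v)) =
      ENNReal.ofReal (v - u) * ∏ i ∈ Finset.univ.erase j, ENNReal.ofReal (b i - a i) := by
  rw [box_eq_pi, Real.volume_pi_Ioc, ← Finset.mul_prod_erase _ _ (Finset.mem_univ j)]
  simp only [Function.update_self]
  congr 1
  refine Finset.prod_congr rfl fun i hi => ?_
  simp [Finset.ne_of_mem_erase hi]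

theorem box_subset_box {a b a' b' : Fin D → ℝ} (ha : a' ≤ a) (hb : b ≤ b') :
    box a b ⊆ box a' b' := fun _ hx j => ⟨(ha j).trans_lt (hx j).1, (hx j).2.trans (hb j)⟩

theorem unitVolume_box {a b : Fin D → ℝ} (ha : 0 ≤ a) (hb : b ≤ 1) :
    unitVolume D (box a b) = volume (box a b) := by
  rw [unitVolume, Measure.restrict_apply (measurableSet_box a b),
    Set.inter_eq_left.2 (box_subset_box ha hb)]

theorem unitVolume_slab_le (j : Fin D) (u v : ℝ) :
    unitVolume D {x | u < x j ∧ x j ≤ v} ≤ ENNReal.ofReal (v - u) := by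
  have hms : MeasurableSet {x : Fin D → ℝ | u < x j ∧ x j ≤ v} :=
    (measurableSet_lt measurable_const (measurable_pi_apply j)).inter
      (measurableSet_le (measurable_pi_apply j) measurable_const)
  rw [unitVolume, Measure.restrict_apply hms]
  calc volume ({x : Fin D → ℝ | u < x j ∧ x j ≤ v} ∩ box 0 1)
      ≤ volume (box (Function.update (0 : Fin D → ℝ) j u) (Function.update 1 j v)) := by
        refine measure_mono fun x hx i => ?_
        by_cases hi : i = j
        · subst hi; simpa using hx.1
        · simpa [hi] using hx.2 i
    _ = ENNReal.ofReal (v - u) := by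
        rw [volume_box_update, Finset.prod_eq_one, mul_one]
        intro i _; simp

theorem unitVolume_univ : unitVolume D Set.univ = 1 := by
  rw [unitVolume, Measure.restrict_apply_univ, box_eq_pi, Real.volume_pi_Ioc]
  simp

theorem exists_measure_lt_le {f : (Fin D → ℝ) → ℝ≥0∞} (hf : Measurable f)
    {μ : Measure (Fin D → ℝ)} [IsFiniteMeasure μ] (hμ : μ = (unitVolume D).withDensity f)
    {ε : ℝ≥0∞} (hε : 0 < ε) : ∃ R : ℕ, 0 < R ∧ μ {x | (R : ℝ≥0∞) < f x} ≤ ε := by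
  have htop : μ {x | f x = ⊤} = 0 := by
    have h1 : ∫⁻ x, f x ∂(unitVolume D) ≠ ⊤ := by
      rw [← setLIntegral_univ, ← withDensity_apply _ MeasurableSet.univ, ← hμ]
      exact measure_ne_top _ _
    have h2 := ae_lt_top hf h1
    rw [hμ]
    refine withDensity_absolutelyContinuous _ _ ?_
    refine measure_mono_null (fun x hx => ?_) h2
    simpa using hx
  have hmeas : ∀ R : ℕ, MeasurableSet {x | (R : ℝ≥0∞) < f x} := fun R =>
    measurableSet_lt measurable_const hf
  have hlim := tendsto_measure_iInter_atTop (μ := μ) (s := fun R : ℕ => {x | (R : ℝ≥0∞) < f x})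
    (fun R => (hmeas R).nullMeasurableSet)
    (fun R R' h x hx => lt_of_le_of_lt (b := (R' : ℝ≥0∞)) (by exact_mod_cast h) hx) ⟨0, measure_ne_top _ _⟩
  have hinter : ⋂ R : ℕ, {x | (R : ℝ≥0∞) < f x} = {x | f x = ⊤} := by
    ext x
    simp only [Set.mem_iInter, Set.mem_ofPred_eq]
    refine ⟨fun h => ?_, fun h R => by rw [h]; exact ENNReal.natCast_lt_top R⟩
    by_contra hne
    obtain ⟨R, hR⟩ := ENNReal.exists_nat_gt hne
    exact absurd (h R) (not_lt.2 hR.le)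
  rw [hinter, htop] at hlim
  obtain ⟨R, hR1, hR2⟩ :=
    ((hlim.eventually (gt_mem_nhds hε)).and (eventually_gt_atTop 0)).exists
  exact ⟨R, hR2, hR1.le⟩

/-- This is the place where the density must be nonzero almost everywhere: the sets where it is
below `1/(m+1)` decrease to a null set. -/
theorem exists_unitVolume_lt_le {f : (Fin D → ℝ) → ℝ≥0∞} (hf : Measurable f)
    (hf0 : ∀ᵐ x ∂(unitVolume D), f x ≠ 0) {ε : ℝ≥0∞} (hε : 0 < ε) :
    ∃ τ : ℝ, 0 < τ ∧ τ ≤ 1 ∧ unitVolume D {x | f x < ENNReal.ofReal τ} ≤ ε := by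
  set s : ℕ → Set (Fin D → ℝ) := fun m => {x | f x < ENNReal.ofReal (1 / (m + 1))} with hs
  have hanti : Antitone s := fun m m' h x hx => lt_of_lt_of_le hx
    (ENNReal.ofReal_le_ofReal (by
      have : (m : ℝ) ≤ m' := by exact_mod_cast h
      gcongr))
  have hfin : IsFiniteMeasure (unitVolume D) := ⟨by rw [unitVolume_univ]; simp⟩
  have hlim := tendsto_measure_iInter_atTop (μ := unitVolume D) (s := s)
    (fun R => (measurableSet_lt hf measurable_const).nullMeasurableSet)
    hanti ⟨0, measure_ne_top _ _⟩
  have hinter : unitVolume D (⋂ m, s m) = 0 := by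
    refine measure_mono_null (fun x hx => ?_) hf0
    simp only [hs, Set.mem_iInter, Set.mem_ofPred_eq] at hx
    simp only [Set.mem_compl_iff, Set.mem_ofPred_eq, not_not]
    by_contra hne
    have hlim : Tendsto (fun m : ℕ => ENNReal.ofReal (1 / ((m : ℝ) + 1))) atTop (𝓝 0) := by
      have := ENNReal.tendsto_ofReal (tendsto_one_div_add_atTop_nhds_zero_nat (𝕜 := ℝ))
      simpa using this
    obtain ⟨m, hm⟩ := (hlim.eventually (gt_mem_nhds (pos_iff_ne_zero.2 hne))).exists
    exact absurd (hx m) (not_lt.2 hm.le)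
  rw [hinter] at hlim
  obtain ⟨m, hm⟩ := (hlim.eventually (gt_mem_nhds hε)).exists
  refine ⟨1 / ((m : ℝ) + 1), by positivity, ?_, hm.le⟩
  rw [div_le_one (by positivity)]
  have : (0 : ℝ) ≤ m := by positivity
  linarith

/-! ### Bracketing of half-spaces and boxes. -/

/-- A class of sets is bracketed if it can be covered by finitely many brackets of arbitrarily
small measure. -/
def Bracketed (μ : Measure (Fin D → ℝ)) (𝒞 : Set (Set (Fin D → ℝ))) : Prop :=
  ∀ ε : ℝ≥0∞, 0 < ε → ∃ F : Finset (Set (Fin D → ℝ) × Set (Fin D → ℝ)),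
    (∀ p ∈ F, MeasurableSet p.1 ∧ MeasurableSet p.2 ∧ μ (p.2 \ p.1) ≤ ε) ∧
      ∀ C ∈ 𝒞, ∃ p ∈ F, p.1 ⊆ C ∧ C ⊆ p.2

theorem Bracketed.compl {μ : Measure (Fin D → ℝ)} {𝒞 : Set (Set (Fin D → ℝ))}
    (h : Bracketed μ 𝒞) : Bracketed μ {A | Aᶜ ∈ 𝒞} := by
  classical
  intro ε hε
  obtain ⟨F, hF, hC⟩ := h ε hε
  refine ⟨F.image fun p => (p.2ᶜ, p.1ᶜ), fun p hp => ?_, fun A hA => ?_⟩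
  · obtain ⟨p', hp', rfl⟩ := Finset.mem_image.1 hp
    obtain ⟨h1, h2, h3⟩ := hF p' hp'
    refine ⟨h2.compl, h1.compl, (measure_mono fun x hx => ?_).trans h3⟩
    simp only [Set.mem_sdiff, Set.mem_compl_iff, not_not] at hx ⊢
    exact ⟨hx.2, hx.1⟩
  · obtain ⟨p, hp, h1, h2⟩ := hC _ hA
    exact ⟨_, Finset.mem_image_of_mem _ hp, Set.compl_subset_comm.1 h2, Set.subset_compl_comm.1 h1⟩

theorem Bracketed.inter {μ : Measure (Fin D → ℝ)} {𝒞 𝒞' : Set (Set (Fin D → ℝ))}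
    (h : Bracketed μ 𝒞) (h' : Bracketed μ 𝒞') :
    Bracketed μ {A | ∃ C ∈ 𝒞, ∃ C' ∈ 𝒞', A = C ∩ C'} := by
  classical
  intro ε hε
  obtain ⟨F, hF, hC⟩ := h (ε / 2) (ENNReal.half_pos hε.ne')
  obtain ⟨F', hF', hC'⟩ := h' (ε / 2) (ENNReal.half_pos hε.ne')
  refine ⟨(F ×ˢ F').image fun p => (p.1.1 ∩ p.2.1, p.1.2 ∩ p.2.2), fun p hp => ?_,
    fun A hA => ?_⟩
  · obtain ⟨⟨p, p'⟩, hpp, rfl⟩ := Finset.mem_image.1 hp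
    obtain ⟨hp, hp'⟩ := Finset.mem_product.1 hpp
    obtain ⟨h1, h2, h3⟩ := hF p hp
    obtain ⟨h1', h2', h3'⟩ := hF' p' hp'
    refine ⟨h1.inter h1', h2.inter h2', ?_⟩
    calc μ ((p.2 ∩ p'.2) \ (p.1 ∩ p'.1)) ≤ μ ((p.2 \ p.1) ∪ (p'.2 \ p'.1)) := by
          refine measure_mono fun x hx => ?_
          simp only [Set.mem_sdiff, Set.mem_inter_iff, Set.mem_union] at hx ⊢
          tauto
      _ ≤ ε / 2 + ε / 2 := (measure_union_le _ _).trans (add_le_add h3 h3')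
      _ = ε := ENNReal.add_halves ε
  · obtain ⟨C, hCC, C', hCC', rfl⟩ := hA
    obtain ⟨p, hp, h1, h2⟩ := hC C hCC
    obtain ⟨p', hp', h1', h2'⟩ := hC' C' hCC'
    exact ⟨_, Finset.mem_image_of_mem _ (Finset.mk_mem_product hp hp'),
      Set.inter_subset_inter h1 h1', Set.inter_subset_inter h2 h2'⟩

theorem Bracketed.mono {μ : Measure (Fin D → ℝ)} {𝒞 𝒞' : Set (Set (Fin D → ℝ))}
    (h : Bracketed μ 𝒞) (hs : 𝒞' ⊆ 𝒞) : Bracketed μ 𝒞' := fun ε hε =>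
  let ⟨F, hF, hC⟩ := h ε hε
  ⟨F, hF, fun C hCC => hC C (hs hCC)⟩

/-- Truncating the density at `R` leaves mass at most `ε/2` aside, and on the rest a slab of width
`1/N` has mass at most `R/N ≤ ε/2`. -/
theorem bracketed_halfSpaces {f : (Fin D → ℝ) → ℝ≥0∞} (hf : Measurable f)
    {μ : Measure (Fin D → ℝ)} [IsFiniteMeasure μ] (hμ : μ = (unitVolume D).withDensity f)
    (j : Fin D) : Bracketed μ {A | ∃ b : ℝ, A = {x | x j ≤ b}} := by
  classical
  intro ε hε
  have hε2 := ENNReal.half_pos hε.ne'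
  obtain ⟨R, hR0, hR⟩ := exists_measure_lt_le hf hμ hε2
  obtain ⟨N, hN0, hN⟩ : ∃ N : ℕ, 0 < N ∧ (R : ℝ≥0∞) * ENNReal.ofReal (1 / N) ≤ ε / 2 := by
    have h1 : Tendsto (fun N : ℕ => (R : ℝ≥0∞) * ENNReal.ofReal (1 / N)) atTop (𝓝 0) := by
      have h2 := ENNReal.tendsto_ofReal (tendsto_one_div_atTop_nhds_zero_nat (𝕜 := ℝ))
      rw [ENNReal.ofReal_zero] at h2
      simpa using ENNReal.Tendsto.const_mul h2 (Or.inr (ENNReal.natCast_ne_top R))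
    obtain ⟨N, h1, h2⟩ := ((h1.eventually (gt_mem_nhds hε2)).and (eventually_gt_atTop 0)).exists
    exact ⟨N, h2, h1.le⟩
  have hN0' : (0 : ℝ) < N := by exact_mod_cast hN0
  have hhalf : ∀ u : ℝ, MeasurableSet {x : Fin D → ℝ | x j ≤ u} := fun u =>
    measurableSet_le (measurable_pi_apply j) measurable_const
  have hnull : μ (box 0 1)ᶜ = 0 := by
    rw [hμ]
    refine withDensity_absolutelyContinuous _ _ ?_
    rw [unitVolume, Measure.restrict_apply (measurableSet_box _ _).compl]
    simp
  have hslab : ∀ u v : ℝ, v - u ≤ 1 / N → μ ({x | x j ≤ v} \ {x | x j ≤ u}) ≤ ε := by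
    intro u v huv
    have hset : {x : Fin D → ℝ | x j ≤ v} \ {x | x j ≤ u} = {x | u < x j ∧ x j ≤ v} := by
      ext x; simp [and_comm]
    have hm : MeasurableSet ({x : Fin D → ℝ | x j ≤ v} \ {x | x j ≤ u}) :=
      (hhalf v).diff (hhalf u)
    have hRm : MeasurableSet {x | (R : ℝ≥0∞) < f x} := measurableSet_lt measurable_const hf
    rw [← measure_inter_add_sdiff _ hRm, ← ENNReal.add_halves ε]
    refine add_le_add ((measure_mono Set.inter_subset_right).trans hR) (le_trans ?_ hN)
    calc μ (({x : Fin D → ℝ | x j ≤ v} \ {x | x j ≤ u}) \ {x | (R : ℝ≥0∞) < f x})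
        ≤ R * unitVolume D (({x : Fin D → ℝ | x j ≤ v} \ {x | x j ≤ u}) \
            {x | (R : ℝ≥0∞) < f x}) := by
          rw [hμ, withDensity_apply _ (hm.diff hRm), ← setLIntegral_const]
          exact setLIntegral_mono' (hm.diff hRm) fun x hx => not_lt.1 hx.2
      _ ≤ R * unitVolume D {x | u < x j ∧ x j ≤ v} := by
          rw [← hset]
          exact mul_le_mul_right (measure_mono Set.sdiff_subset) _
      _ ≤ R * ENNReal.ofReal (1 / N) := mul_le_mul_right
          ((unitVolume_slab_le j u v).trans (ENNReal.ofReal_le_ofReal huv)) _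
  -- Grid slabs bracket the thresholds in `[0, 1)`. The two extra brackets serve the thresholds
  -- below 0 and from 1 on; their differences lie outside the cube and are null.
  refine ⟨insert (∅, {x | x j ≤ 0}) (insert ({x | x j ≤ 1}, Set.univ)
    ((Finset.range N).image fun i : ℕ =>
      ({x : Fin D → ℝ | x j ≤ (i : ℝ) / N}, {x : Fin D → ℝ | x j ≤ ((i : ℝ) + 1) / N}))),
    fun p hp => ?_, fun A hA => ?_⟩
  · rw [Finset.mem_insert, Finset.mem_insert, Finset.mem_image] at hp
    rcases hp with rfl | rfl | ⟨i, -, rfl⟩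
    · refine ⟨MeasurableSet.empty, hhalf 0, (measure_mono fun x hx hbox => ?_).trans
        (hnull.trans_le zero_le)⟩
      exact absurd (hbox j).1 (not_lt.2 hx.1)
    · refine ⟨hhalf 1, MeasurableSet.univ, (measure_mono fun x hx hbox => ?_).trans
        (hnull.trans_le zero_le)⟩
      exact hx.2 (hbox j).2
    · refine ⟨hhalf _, hhalf _, hslab _ _ (le_of_eq ?_)⟩
      rw [← sub_div]; congr 1; ring
  · obtain ⟨b, rfl⟩ := hA
    rcases lt_or_ge b 0 with hb | hb
    · refine ⟨_, Finset.mem_insert_self _ _, Set.empty_subset _, fun x hx => ?_⟩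
      exact le_trans hx hb.le
    rcases lt_or_ge b 1 with hb1 | hb1
    · refine ⟨_, Finset.mem_insert_of_mem (Finset.mem_insert_of_mem
        (Finset.mem_image_of_mem _ ((Finset.mem_range (n := N) (m := ⌊b * N⌋₊)).2 ?_))), fun x hx => ?_,
          fun x hx => ?_⟩
      · rw [Nat.floor_lt (by positivity)]
        nlinarith
      · refine le_trans (b := (⌊b * N⌋₊ : ℝ) / N) hx ?_
        rw [div_le_iff₀ hN0']
        exact Nat.floor_le (by positivity)
      · refine le_trans (b := b) hx ?_
        rw [le_div_iff₀ hN0']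
        exact (Nat.lt_floor_add_one _).le
    · exact ⟨_, Finset.mem_insert_of_mem (Finset.mem_insert_self _ _), fun x hx => le_trans hx hb1,
        Set.subset_univ _⟩

theorem bracketed_boxes {f : (Fin D → ℝ) → ℝ≥0∞} (hf : Measurable f)
    {μ : Measure (Fin D → ℝ)} [IsFiniteMeasure μ] (hμ : μ = (unitVolume D).withDensity f) :
    Bracketed μ {A | ∃ a b : Fin D → ℝ, A = box a b} := by
  classical
  have key : ∀ s : Finset (Fin D),
      Bracketed μ {A | ∃ a b : Fin D → ℝ, A = {x | ∀ j ∈ s, a j < x j ∧ x j ≤ b j}} := by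
    intro s
    induction s using Finset.induction_on with
    | empty =>
      intro ε hε
      refine ⟨{(Set.univ, Set.univ)}, ?_, ?_⟩
      · simp
      · rintro A ⟨a, b, rfl⟩
        exact ⟨_, Finset.mem_singleton_self _, by simp, by simp⟩
    | insert j s hj ih =>
      refine (((bracketed_halfSpaces hf hμ j).compl.inter
        (bracketed_halfSpaces hf hμ j)).inter ih).mono ?_
      rintro A ⟨a, b, rfl⟩
      refine ⟨{x | a j < x j} ∩ {x | x j ≤ b j}, ⟨{x | a j < x j}, ⟨a j, ?_⟩,
        {x | x j ≤ b j}, ⟨b j, rfl⟩, rfl⟩, _, ⟨a, b, rfl⟩, ?_⟩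
      · ext x; simp
      · ext x
        simp
  refine (key Finset.univ).mono ?_
  rintro A ⟨a, b, rfl⟩
  exact ⟨a, b, by ext x; simp [box]⟩

open Classical in
-- Chebyshev: the count is a sum of `S.card` independent indicators, each of variance at most 1.
theorem measure_count_deviation_le (P : Measure ((Fin D → ℝ) × Fin K)) [IsProbabilityMeasure P]
    {A : Set (Fin D → ℝ)} (hA : MeasurableSet A) (S : Finset (Fin n)) (hS : 0 < S.card)
    {ε : ℝ} (hε : 0 < ε) :
    (Measure.pi fun _ : Fin n => P) {d | ε * S.card ≤
      |((S.filter fun i => (d i).1 ∈ A).card : ℝ) - S.card * (P.map Prod.fst).real A|} ≤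
      ENNReal.ofReal (1 / (ε ^ 2 * S.card)) := by
  have hS' : (0 : ℝ) < S.card := by exact_mod_cast hS
  have hms : MeasurableSet (Prod.fst ⁻¹' A : Set ((Fin D → ℝ) × Fin K)) := measurable_fst hA
  set X : Fin n → (Fin D → ℝ) × Fin K → ℝ := fun i =>
    if i ∈ S then (Prod.fst ⁻¹' A : Set ((Fin D → ℝ) × Fin K)).indicator 1 else 0 with hX
  have hXm : ∀ i, Measurable (X i) := by
    intro i
    simp only [hX]
    split_ifs
    · exact measurable_one.indicator hms
    · exact measurable_zero
  have hX01 : ∀ i z, X i z ∈ Set.Icc (0 : ℝ) 1 := by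
    intro i z
    simp only [hX]
    split_ifs
    · by_cases hz : z ∈ (Prod.fst ⁻¹' A : Set ((Fin D → ℝ) × Fin K))
      · rw [Set.indicator_of_mem hz]; simp
      · rw [Set.indicator_of_notMem hz]; simp
    · simp
  have hL2 : ∀ i, MemLp (X i) 2 P := fun i =>
    MemLp.of_bound (hXm i).aestronglyMeasurable 1 (Eventually.of_forall fun z => by
      rw [Real.norm_of_nonneg (hX01 i z).1]; exact (hX01 i z).2)
  have hsum : ∀ d : Sample D K n, ∑ i, X i (d i) =
      ((S.filter fun i => (d i).1 ∈ A).card : ℝ) := by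
    intro d
    rw [Finset.card_filter, Nat.cast_sum, ← Finset.sum_subset (Finset.subset_univ S)]
    · refine Finset.sum_congr rfl fun i hi => ?_
      by_cases h : (d i).1 ∈ A <;> simp [hX, hi, h]
    · intro i _ hi
      simp [hX, hi]
  have hint : ∀ i, ∫ z, X i z ∂P = if i ∈ S then (P.map Prod.fst).real A else 0 := by
    intro i
    simp only [hX]
    split_ifs
    · rw [integral_indicator_one hms, measureReal_def, measureReal_def,
        Measure.map_apply measurable_fst hA]
    · simp
  have hmean : ∫ d : Sample D K n, ∑ i, X i (d i) ∂(Measure.pi fun _ : Fin n => P) =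
      S.card * (P.map Prod.fst).real A := by
    rw [integral_finsetSum]
    · have : ∀ i, ∫ d : Sample D K n, X i (d i) ∂(Measure.pi fun _ : Fin n => P) =
          ∫ z, X i z ∂P := fun i => by
        have hmp := measurePreserving_eval (fun _ : Fin n => P) i
        conv_rhs => rw [← hmp.map_eq]
        rw [integral_map hmp.measurable.aemeasurable (hXm i).aestronglyMeasurable]
      simp_rw [this, hint]
      rw [Finset.sum_ite_mem, Finset.univ_inter, Finset.sum_const, nsmul_eq_mul]
    · intro i _
      have hmp := measurePreserving_eval (fun _ : Fin n => P) i
      exact hmp.integrable_comp_of_integrable ((hL2 i).integrable (by norm_num))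
  have hvar : ProbabilityTheory.variance (fun d : Sample D K n => ∑ i, X i (d i))
      (Measure.pi fun _ : Fin n => P) ≤ S.card := by
    have := ProbabilityTheory.variance_sum_pi (μ := fun _ : Fin n => P) hL2
    have hfun : (fun d : Sample D K n => ∑ i, X i (d i)) =
        (∑ i, fun d : Sample D K n => X i (d i)) := by
      ext d; simp
    rw [hfun, this]
    calc ∑ i, ProbabilityTheory.variance (X i) P ≤ ∑ i, if i ∈ S then (1 : ℝ) else 0 := by
          refine Finset.sum_le_sum fun i _ => ?_
          split_ifs with hi
          · refine (ProbabilityTheory.variance_le_sq_of_bounded (a := 0) (b := 1)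
              (Eventually.of_forall fun z => hX01 i z) (hXm i).aemeasurable).trans ?_
            norm_num
          · simp [hX, hi]
      _ = S.card := by simp
  have hmem : MemLp (fun d : Sample D K n => ∑ i, X i (d i)) 2 (Measure.pi fun _ : Fin n => P) :=
    memLp_finsetSum _ fun i _ =>
      (hL2 i).comp_measurePreserving (measurePreserving_eval (fun _ : Fin n => P) i)
  have hcheb := ProbabilityTheory.meas_ge_le_variance_div_sq hmem (c := ε * S.card)
    (by positivity)
  rw [hmean] at hcheb
  simp_rw [hsum] at hcheb
  refine hcheb.trans (ENNReal.ofReal_le_ofReal ?_)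
  simp_rw [hsum] at hvar
  calc _ ≤ (S.card : ℝ) / (ε * S.card) ^ 2 := by gcongr
    _ = _ := by field_simp

/-- The empirical measure of the points `S` is uniformly `ε`-close to `μ` on boxes. -/
def IsUniform (μ : Measure (Fin D → ℝ)) (ε : ℝ) (d : Sample D K n) (S : Finset (Fin n)) : Prop :=
  ∀ a b : Fin D → ℝ, |((pointsIn d S a b).card : ℝ) - S.card * μ.real (box a b)| ≤ ε * S.card

open Classical in
-- Finitely many brackets, whose number depends on `P` and `ε` but not on `n`, sandwich all boxes.
-- Chebyshev is applied to the bracket ends only, which also gives a measurable exceptional set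
-- although there are uncountably many boxes.
theorem exists_measure_not_isUniform_le (P : Measure ((Fin D → ℝ) × Fin K))
    [IsProbabilityMeasure P] {f : (Fin D → ℝ) → ℝ≥0∞} (hf : Measurable f)
    (hPf : P.map Prod.fst = (unitVolume D).withDensity f) {ε : ℝ} (hε : 0 < ε) :
    ∃ C : ℝ, ∀ (n : ℕ) (S : Finset (Fin n)), 0 < S.card → ∃ Bad : Set (Sample D K n),
      MeasurableSet Bad ∧
      (Measure.pi fun _ : Fin n => P) Bad ≤ ENNReal.ofReal (C / S.card) ∧
      ∀ d, d ∉ Bad → IsUniform (P.map Prod.fst) ε d S := by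
  set μ := P.map Prod.fst with hμ
  have : IsProbabilityMeasure μ := Measure.isProbabilityMeasure_map measurable_fst.aemeasurable
  obtain ⟨F, hF, hcover⟩ := bracketed_boxes hf hPf (ENNReal.ofReal (ε / 2))
    (ENNReal.ofReal_pos.2 (by positivity))
  set F' := F.image Prod.fst ∪ F.image Prod.snd with hF'
  have hF'm : ∀ A ∈ F', MeasurableSet A := by
    intro A hA
    rw [hF', Finset.mem_union, Finset.mem_image, Finset.mem_image] at hA
    rcases hA with ⟨p, hp, rfl⟩ | ⟨p, hp, rfl⟩
    · exact (hF p hp).1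
    · exact (hF p hp).2.1
  refine ⟨∑ _A ∈ F', 1 / (ε / 2) ^ 2, fun n S hS => ?_⟩
  have hS' : (0 : ℝ) < S.card := by exact_mod_cast hS
  set B : Set (Fin D → ℝ) → Set (Sample D K n) := fun A => {d | ε / 2 * S.card ≤
    |((S.filter fun i => (d i).1 ∈ A).card : ℝ) - S.card * μ.real A|} with hB
  have hBm : ∀ A ∈ F', MeasurableSet (B A) := by
    intro A hA
    have h1 : Measurable fun d : Sample D K n => (S.filter fun i => (d i).1 ∈ A).card := by
      simp_rw [Finset.card_filter]
      refine Finset.measurable_sum _ fun i _ => Measurable.ite ?_ measurable_const measurable_const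
      exact (measurable_fst.comp (measurable_pi_apply i)) (hF'm A hA)
    exact measurableSet_le measurable_const
      (((measurable_from_top (f := fun m : ℕ => (m : ℝ))).comp h1).sub_const _).abs
  refine ⟨⋃ A ∈ F', B A, Finset.measurableSet_biUnion F' hBm, ?_, fun d hd a b => ?_⟩
  · calc _ ≤ ∑ A ∈ F', (Measure.pi fun _ : Fin n => P) (B A) := measure_biUnion_finset_le _ _
      _ ≤ ∑ A ∈ F', ENNReal.ofReal (1 / ((ε / 2) ^ 2 * S.card)) :=
          Finset.sum_le_sum fun A hA => measure_count_deviation_le P (hF'm A hA) S hS (by positivity)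
      _ = _ := by
          rw [← ENNReal.ofReal_sum_of_nonneg fun _ _ => by positivity, Finset.sum_div]
          congr 1
          refine Finset.sum_congr rfl fun _ _ => ?_
          rw [div_div]
  · obtain ⟨p, hp, h1, h2⟩ := hcover _ ⟨a, b, rfl⟩
    obtain ⟨hm1, hm2, hp3⟩ := hF p hp
    have hgood : ∀ A ∈ F',
        |((S.filter fun i => (d i).1 ∈ A).card : ℝ) - S.card * μ.real A| < ε / 2 * S.card := by
      intro A hA
      by_contra hcon
      exact hd (Set.mem_biUnion hA (not_lt.1 hcon))
    have g1 := abs_lt.1 (hgood p.1 (Finset.mem_union_left _ (Finset.mem_image_of_mem _ hp)))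
    have g2 := abs_lt.1 (hgood p.2 (Finset.mem_union_right _ (Finset.mem_image_of_mem _ hp)))
    have hpoints : pointsIn d S a b = S.filter fun i => (d i).1 ∈ box a b := by
      ext i; simp [pointsIn]
    have c1 : ((S.filter fun i => (d i).1 ∈ p.1).card : ℝ) ≤ (pointsIn d S a b).card := by
      rw [hpoints]
      exact_mod_cast Finset.card_le_card (Finset.monotone_filter_right _ fun i _ h => h1 h)
    have c2 : ((pointsIn d S a b).card : ℝ) ≤ (S.filter fun i => (d i).1 ∈ p.2).card := by
      rw [hpoints]
      exact_mod_cast Finset.card_le_card (Finset.monotone_filter_right _ fun i _ h => h2 h)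
    have m1 : μ.real p.1 ≤ μ.real (box a b) := measureReal_mono h1
    have m2 : μ.real (box a b) ≤ μ.real p.2 := measureReal_mono h2
    have m3 : μ.real p.2 ≤ μ.real p.1 + ε / 2 := by
      have h3 := measureReal_sdiff (μ := μ) (h1.trans h2) hm1
      have h4 : μ.real (p.2 \ p.1) ≤ ε / 2 := by
        rw [measureReal_def]
        exact ENNReal.toReal_le_of_le_ofReal (by positivity) hp3
      linarith
    have n1 := mul_le_mul_of_nonneg_left (m2.trans m3) hS'.le
    have n2 := mul_le_mul_of_nonneg_left (m3.trans (add_le_add_left m1 _)) hS'.le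
    rw [abs_le]
    constructor <;> nlinarith

/-! ### The random choice of a split -/

section ExpMech

variable {α : Type} {s : Finset α} (hs : s.Nonempty)

theorem minMax_nonneg (u : α → ℝ) {a : α} (ha : a ∈ s) : 0 ≤ minMax s hs u a :=
  div_nonneg (sub_nonneg.2 (Finset.inf'_le _ ha))
    (sub_nonneg.2 ((Finset.inf'_le _ ha).trans (Finset.le_sup' u ha)))

theorem minMax_le_one (u : α → ℝ) {a : α} (ha : a ∈ s) : minMax s hs u a ≤ 1 :=
  div_le_one_of_le₀ (sub_le_sub_right (Finset.le_sup' u ha) _)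
    (sub_nonneg.2 ((Finset.inf'_le _ ha).trans (Finset.le_sup' u ha)))

theorem expect_expMech (B : ℝ) (u : α → ℝ) (F : α → ℝ≥0∞) :
    expect (expMech s hs B u) F = ∑ a ∈ s, expMech s hs B u a * F a :=
  tsum_eq_sum fun a ha => by rw [expMech_apply_of_notMem hs B u ha, zero_mul]

variable {B : ℝ} (hB : 0 ≤ B) (u : α → ℝ)
include hB

/-- Normalized scores lie in `[0, 1]`, so each weight lies between 1 and `exp(B/2)`. Together with
`le_expMech_minMax`, this is all that the analysis of split probabilities needs to know about the
impurity decreases. -/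
theorem expMech_minMax_le {a : α} (ha : a ∈ s) :
    expMech s hs B (minMax s hs u) a ≤ ENNReal.ofReal (Real.exp (B / 2) / s.card) := by
  have hc : (0 : ℝ) < s.card := by exact_mod_cast hs.card_pos
  rw [expMech_apply hs B _ ha]
  refine ENNReal.ofReal_le_ofReal ?_
  have h1 : (s.card : ℝ) ≤ ∑ b ∈ s, Real.exp (B / 2 * minMax s hs u b) := by
    rw [← nsmul_one, ← Finset.sum_const]
    refine Finset.sum_le_sum fun b hb => Real.one_le_exp ?_
    have := minMax_nonneg hs u hb
    positivity
  have h2 : B / 2 * minMax s hs u a ≤ B / 2 :=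
    mul_le_of_le_one_right (by positivity) (minMax_le_one hs u ha)
  gcongr

theorem le_expMech_minMax {a : α} (ha : a ∈ s) :
    ENNReal.ofReal (Real.exp (-(B / 2)) / s.card) ≤ expMech s hs B (minMax s hs u) a := by
  have hc : (0 : ℝ) < s.card := by exact_mod_cast hs.card_pos
  rw [expMech_apply hs B _ ha]
  refine ENNReal.ofReal_le_ofReal ?_
  have h1 : ∑ b ∈ s, Real.exp (B / 2 * minMax s hs u b) ≤ s.card * Real.exp (B / 2) := by
    rw [← nsmul_eq_mul, ← Finset.sum_const]
    refine Finset.sum_le_sum fun b hb => Real.exp_le_exp.2 ?_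
    exact mul_le_of_le_one_right (by positivity) (minMax_le_one hs u hb)
  have h2 : 1 ≤ Real.exp (B / 2 * minMax s hs u a) := by
    refine Real.one_le_exp ?_
    have := minMax_nonneg hs u ha
    positivity
  have h3 : 0 < ∑ b ∈ s, Real.exp (B / 2 * minMax s hs u b) :=
    Finset.sum_pos (fun b _ => Real.exp_pos _) hs
  calc Real.exp (-(B / 2)) / s.card = 1 / (s.card * Real.exp (B / 2)) := by
        rw [Real.exp_neg]; field_simp
    _ ≤ _ := div_le_div₀ (by positivity) h2 h3 h1

open Classical in
theorem expect_expMech_indicator_le (p : α → Prop) :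
    expect (expMech s hs B (minMax s hs u)) (fun a => if p a then 1 else 0) ≤
      ENNReal.ofReal (Real.exp (B / 2) * (s.filter p).card / s.card) := by
  rw [expect_expMech]
  simp only [mul_ite, mul_one, mul_zero]
  rw [← Finset.sum_filter]
  calc ∑ a ∈ s.filter p, expMech s hs B (minMax s hs u) a
      ≤ ∑ _a ∈ s.filter p, ENNReal.ofReal (Real.exp (B / 2) / s.card) :=
        Finset.sum_le_sum fun a ha => expMech_minMax_le hs hB u (Finset.mem_filter.1 ha).1
    _ = _ := by
        rw [← ENNReal.ofReal_sum_of_nonneg fun _ _ => by positivity, Finset.sum_const,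
          nsmul_eq_mul]
        congr 1; ring

open Classical in
theorem le_expect_expMech_indicator (p : α → Prop) :
    ENNReal.ofReal (Real.exp (-(B / 2)) * (s.filter p).card / s.card) ≤
      expect (expMech s hs B (minMax s hs u)) (fun a => if p a then 1 else 0) := by
  rw [expect_expMech]
  simp only [mul_ite, mul_one, mul_zero]
  rw [← Finset.sum_filter]
  calc _ = ∑ _a ∈ s.filter p, ENNReal.ofReal (Real.exp (-(B / 2)) / s.card) := by
        rw [← ENNReal.ofReal_sum_of_nonneg fun _ _ => by positivity, Finset.sum_const,
          nsmul_eq_mul]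
        congr 1; ring
    _ ≤ _ :=
        Finset.sum_le_sum fun a ha => le_expMech_minMax hs hB u (Finset.mem_filter.1 ha).1

end ExpMech

/-! ### Counting split values, and one random split of a node. -/

section Split

variable {d : Sample D K n} {S : Finset (Fin n)}

theorem mem_splitValues {j : Fin D} {v : ℝ} :
    v ∈ splitValues d S j ↔ (∃ i ∈ S, (d i).1 j = v) ∧ ∃ i ∈ S, v < (d i).1 j := by
  classical
  simp [splitValues, right, Finset.Nonempty]

theorem mem_splitFeatures {j : Fin D} :
    j ∈ splitFeatures d S ↔ (splitValues d S j).Nonempty := by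
  classical
  simp [splitFeatures]

theorem card_splitValues_le (j : Fin D) : (splitValues d S j).card ≤ S.card := by
  classical
  unfold splitValues
  exact (Finset.card_filter_le _ _).trans Finset.card_image_le

open Classical in
-- Distinct points give distinct values, and every observed value except the largest is a possible
-- split; this exception is the `+ 1`.
theorem card_filter_le_card_splitValues_filter (j : Fin D)
    (hinj : Set.InjOn (fun i => (d i).1 j) S) (I : Set ℝ) :
    (S.filter fun i => (d i).1 j ∈ I).card ≤
      ((splitValues d S j).filter fun v => v ∈ I).card + 1 := by
  rcases S.eq_empty_or_nonempty with rfl | hS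
  · simp
  obtain ⟨i₀, hi₀, hmax⟩ := S.exists_max_image (fun i => (d i).1 j) hS
  have h1 : (S.filter fun i => (d i).1 j ∈ I).card =
      ((S.filter fun i => (d i).1 j ∈ I).image fun i => (d i).1 j).card :=
    (Finset.card_image_of_injOn
      (hinj.mono (by intro i hi; exact (Finset.mem_filter.1 hi).1))).symm
  have h2 : (((S.filter fun i => (d i).1 j ∈ I).image fun i => (d i).1 j).erase
      ((d i₀).1 j)) ⊆ (splitValues d S j).filter fun v => v ∈ I := by
    intro v hv
    obtain ⟨hne, hv⟩ := Finset.mem_erase.1 hv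
    obtain ⟨i, hi, rfl⟩ := Finset.mem_image.1 hv
    obtain ⟨hiS, hiI⟩ := Finset.mem_filter.1 hi
    refine Finset.mem_filter.2 ⟨mem_splitValues.2 ⟨⟨i, hiS, rfl⟩, i₀, hi₀, ?_⟩, hiI⟩
    exact lt_of_le_of_ne (hmax i hiS) hne
  have h3 := Finset.card_le_card h2
  have h4 := Finset.pred_card_le_card_erase (s := (S.filter fun i => (d i).1 j ∈ I).image
    fun i => (d i).1 j) (a := (d i₀).1 j)
  omega

open Classical in
-- The left child of the largest such split contains a point for each such value, and it has fewer
-- than `r` points.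
theorem card_splitValues_left_lt_le (j : Fin D) {r : ℝ} (hr : 0 ≤ r) :
    (((splitValues d S j).filter fun v => ((left d S j v).card : ℝ) < r).card : ℝ) ≤ r := by
  set W := (splitValues d S j).filter fun v => ((left d S j v).card : ℝ) < r with hW
  rcases W.eq_empty_or_nonempty with h | h
  · simpa [h] using hr
  obtain ⟨v₀, hv₀, hmax⟩ := W.exists_max_image id h
  have h1 : W ⊆ (left d S j v₀).image fun i => (d i).1 j := by
    intro v hv
    obtain ⟨⟨i, hi, rfl⟩, -⟩ := mem_splitValues.1 (Finset.mem_filter.1 hv).1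
    exact Finset.mem_image.2 ⟨i, Finset.mem_filter.2 ⟨hi, hmax _ hv⟩, rfl⟩
  have h2 : W.card ≤ (left d S j v₀).card := (Finset.card_le_card h1).trans Finset.card_image_le
  have h3 : (W.card : ℝ) ≤ (left d S j v₀).card := by exact_mod_cast h2
  exact h3.trans (Finset.mem_filter.1 hv₀).2.le

open Classical in
-- The right child of the smallest such split contains a point for each of the other values; the
-- smallest value itself accounts for the `+ 1`.
theorem card_splitValues_right_lt_le (j : Fin D) {r : ℝ} (hr : 0 ≤ r) :
    (((splitValues d S j).filter fun v => ((right d S j v).card : ℝ) < r).card : ℝ) ≤ r + 1 := by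
  set W := (splitValues d S j).filter fun v => ((right d S j v).card : ℝ) < r with hW
  rcases W.eq_empty_or_nonempty with h | h
  · simp only [h, Finset.card_empty, Nat.cast_zero]; linarith
  obtain ⟨v₀, hv₀, hmin⟩ := W.exists_min_image id h
  have h1 : W.erase v₀ ⊆ (right d S j v₀).image fun i => (d i).1 j := by
    intro v hv
    obtain ⟨hne, hv⟩ := Finset.mem_erase.1 hv
    obtain ⟨⟨i, hi, rfl⟩, -⟩ := mem_splitValues.1 (Finset.mem_filter.1 hv).1
    exact Finset.mem_image.2
      ⟨i, Finset.mem_filter.2 ⟨hi, lt_of_le_of_ne (hmin _ hv) hne.symm⟩, rfl⟩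
  have h2 := (Finset.card_le_card h1).trans Finset.card_image_le
  rw [Finset.card_erase_of_mem hv₀] at h2
  have h3 : W.card ≤ (right d S j v₀).card + 1 := by omega
  have h4 : (W.card : ℝ) ≤ (right d S j v₀).card + 1 := by exact_mod_cast h3
  have := (Finset.mem_filter.1 hv₀).2
  linarith

theorem card_sub_one_le_card_splitValues (j : Fin D)
    (hinj : Set.InjOn (fun i => (d i).1 j) S) : S.card ≤ (splitValues d S j).card + 1 := by
  classical
  simpa using card_filter_le_card_splitValues_filter (d := d) (S := S) j hinj Set.univ

open Classical in
-- A split is unbalanced (cost `L`), or it is balanced and either cuts feature `j₀` inside `I` (no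
-- cost) or does not (cost `A`); `b` is paid in every case. The first coefficient bounds the
-- probability of imbalance through the number of extreme split values. The second bounds the
-- probability of missing `I`, as feature `j₀` has probability at least `exp(-B₁/2)/D` and a value
-- in `I` then has probability at least `exp(-B₂/2) ρ`.
theorem expect_fullTree_succ_le (T : (Fin K → ℝ) → ℝ) {B₁ B₂ : ℝ} (hB₁ : 0 ≤ B₁) (hB₂ : 0 ≤ B₂)
    {m : ℕ} (hS : 2 ≤ S.card) (hinj : ∀ j, Set.InjOn (fun i => (d i).1 j) S) (j₀ : Fin D)
    {I : Set ℝ} {ρ κ : ℝ} (hκ : 0 ≤ κ) (hρ0 : 0 ≤ ρ)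
    (hρ : ρ * S.card + 1 ≤ (S.filter fun i => (d i).1 j₀ ∈ I).card)
    {F : Tree D → ℝ≥0∞} {L A b : ℝ≥0∞}
    (hsmall : ∀ t, F t ≤ L + b)
    (hcut : ∀ j v, κ * S.card ≤ (left d S j v).card → κ * S.card ≤ (right d S j v).card →
      expect (fullTree T B₁ B₂ d m (left d S j v)) (fun l =>
        expect (fullTree T B₁ B₂ d m (right d S j v)) fun r => F (Tree.node j v l r)) ≤
          (if j = j₀ ∧ v ∈ I then 0 else A) + b) :
    expect (fullTree T B₁ B₂ d (m + 1) S) F ≤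
      ENNReal.ofReal (Real.exp (B₂ / 2) * (2 * κ * S.card + 1) / (S.card - 1)) * L +
        ENNReal.ofReal (1 - Real.exp (-(B₁ / 2)) / D * Real.exp (-(B₂ / 2)) * ρ) * A + b := by
  have hScard : (2 : ℝ) ≤ S.card := by exact_mod_cast hS
  have hcardV : ∀ j, (S.card : ℝ) - 1 ≤ (splitValues d S j).card := by
    intro j
    have : (S.card : ℝ) ≤ (splitValues d S j).card + 1 := by
      exact_mod_cast card_sub_one_le_card_splitValues j (hinj j)
    linarith
  -- Two points with distinct coordinates give every feature a possible split, so the node is never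
  -- a forced leaf of the unpruned tree.
  have hV : ∀ j, (splitValues d S j).Nonempty := by
    intro j
    have := card_sub_one_le_card_splitValues j (hinj j)
    exact Finset.card_pos.1 (by omega)
  have hF : (splitFeatures d S).Nonempty := ⟨j₀, mem_splitFeatures.2 (hV j₀)⟩
  set pj := expMech (splitFeatures d S) hF B₁
    (minMax (splitFeatures d S) hF (bestDecrease T d S)) with hpj
  set pv : Fin D → PMF ℝ := fun j => expMech (splitValues d S j) (hV j) B₂
    (minMax (splitValues d S j) (hV j) (impurityDecrease T d S j)) with hpv
  have hexp : expect (fullTree T B₁ B₂ d (m + 1) S) F = expect pj fun j => expect (pv j) fun v =>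
      expect (fullTree T B₁ B₂ d m (left d S j v)) fun l =>
        expect (fullTree T B₁ B₂ d m (right d S j v)) fun r => F (Tree.node j v l r) := by
    rw [fullTree, dif_pos hF, expect_bind]
    refine expect_congr fun j => ?_
    rw [dif_pos (hV j), expect_bind]
    refine expect_congr fun v => ?_
    simp only [expect_bind, expect_map, Function.comp_def]
  set sm : Fin D → ℝ → ℝ≥0∞ := fun j v => (if ((left d S j v).card : ℝ) < κ * S.card then 1 else 0) +
    if ((right d S j v).card : ℝ) < κ * S.card then 1 else 0 with hsm
  have hpoint : ∀ j v, (expect (fullTree T B₁ B₂ d m (left d S j v)) fun l =>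
        expect (fullTree T B₁ B₂ d m (right d S j v)) fun r => F (Tree.node j v l r)) ≤
      sm j v * L + (if j = j₀ ∧ v ∈ I then 0 else 1) * A + b := by
    intro j v
    by_cases h : κ * S.card ≤ (left d S j v).card ∧ κ * S.card ≤ (right d S j v).card
    · refine (hcut j v h.1 h.2).trans ?_
      refine add_le_add_left ?_ _
      refine le_add_left ?_
      split_ifs <;> simp
    · have h1 : 1 ≤ sm j v := by
        simp only [hsm]
        by_cases hl : ((left d S j v).card : ℝ) < κ * S.card
        · rw [if_pos hl]; exact le_self_add
        · have hr : ((right d S j v).card : ℝ) < κ * S.card := by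
            by_contra hcon
            exact h ⟨not_lt.1 hl, not_lt.1 hcon⟩
          rw [if_pos hr]; exact le_add_self
      calc _ ≤ L + b := expect_le_const fun l _ => expect_le_const fun r _ => hsmall _
        _ ≤ _ := by
          refine add_le_add_left (le_add_right ?_) _
          calc L = 1 * L := (one_mul L).symm
            _ ≤ _ := mul_le_mul_left h1 _
  have hsmE : ∀ j, expect (pv j) (sm j) ≤
      ENNReal.ofReal (Real.exp (B₂ / 2) * (2 * κ * S.card + 1) / (S.card - 1)) := by
    intro j
    simp only [hsm]
    rw [expect_add]
    refine (add_le_add (expect_expMech_indicator_le (hV j) hB₂ _ _)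
      (expect_expMech_indicator_le (hV j) hB₂ _ _)).trans ?_
    rw [← ENNReal.ofReal_add (by positivity) (by positivity)]
    refine ENNReal.ofReal_le_ofReal ?_
    rw [← add_div, ← mul_add]
    have h1 := card_splitValues_left_lt_le (d := d) (S := S) j (r := κ * S.card) (by positivity)
    have h2 := card_splitValues_right_lt_le (d := d) (S := S) j (r := κ * S.card) (by positivity)
    have h3 := hcardV j
    refine div_le_div₀ (by positivity) (mul_le_mul_of_nonneg_left (by linarith)
      (Real.exp_pos _).le) (by linarith) h3
  have hcutE : (expect pj fun j => expect (pv j) fun v =>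
      (if j = j₀ ∧ v ∈ I then (0 : ℝ≥0∞) else 1)) ≤
      ENNReal.ofReal (1 - Real.exp (-(B₁ / 2)) / D * Real.exp (-(B₂ / 2)) * ρ) := by
    -- The probability of missing `I` is bounded through its complement, the event for which a lower
    -- bound is available.
    have hsum : (expect pj fun j => expect (pv j) fun v =>
        (if j = j₀ ∧ v ∈ I then (1 : ℝ≥0∞) else 0)) + (expect pj fun j => expect (pv j) fun v =>
        (if j = j₀ ∧ v ∈ I then (0 : ℝ≥0∞) else 1)) = 1 := by
      rw [← expect_add]
      simp_rw [← expect_add]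
      have : ∀ j v, ((if j = j₀ ∧ v ∈ I then (1 : ℝ≥0∞) else 0) +
          if j = j₀ ∧ v ∈ I then (0 : ℝ≥0∞) else 1) = 1 := by
        intro j v; split_ifs <;> simp
      simp_rw [this, expect_const]
    have hlow : ENNReal.ofReal (Real.exp (-(B₁ / 2)) / D * Real.exp (-(B₂ / 2)) * ρ) ≤
        expect pj fun j => expect (pv j) fun v =>
          (if j = j₀ ∧ v ∈ I then (1 : ℝ≥0∞) else 0) := by
      have hDpos : (0 : ℝ) < D := by exact_mod_cast (Fin.pos j₀)
      have hFD : ((splitFeatures d S).card : ℝ) ≤ D := by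
        have := Finset.card_le_univ (splitFeatures d S)
        rw [Fintype.card_fin] at this
        exact_mod_cast this
      have hFpos : (0 : ℝ) < (splitFeatures d S).card := by exact_mod_cast hF.card_pos
      have hVS : ((splitValues d S j₀).card : ℝ) ≤ S.card := by
        exact_mod_cast card_splitValues_le j₀
      have hVpos : (0 : ℝ) < (splitValues d S j₀).card := by exact_mod_cast (hV j₀).card_pos
      have hfilter : ρ * S.card ≤ ((splitValues d S j₀).filter fun v => v ∈ I).card := by
        have : ((S.filter fun i => (d i).1 j₀ ∈ I).card : ℝ) ≤
            ((splitValues d S j₀).filter fun v => v ∈ I).card + 1 := by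
          exact_mod_cast card_filter_le_card_splitValues_filter j₀ (hinj j₀) I
        linarith
      have h1 : ENNReal.ofReal (Real.exp (-(B₂ / 2)) * ρ) ≤
          expect (pv j₀) fun v => (if v ∈ I then (1 : ℝ≥0∞) else 0) := by
        refine le_trans (ENNReal.ofReal_le_ofReal ?_)
          (le_expect_expMech_indicator (hV j₀) hB₂ _ fun v => v ∈ I)
        rw [mul_div_assoc]
        refine mul_le_mul_of_nonneg_left ?_ (Real.exp_pos _).le
        rw [le_div_iff₀ hVpos]
        exact (mul_le_mul_of_nonneg_left hVS hρ0).trans hfilter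
      calc _ = ENNReal.ofReal (Real.exp (-(B₁ / 2)) / D) *
            ENNReal.ofReal (Real.exp (-(B₂ / 2)) * ρ) := by
            rw [← ENNReal.ofReal_mul (by positivity), mul_assoc]
        _ ≤ pj j₀ * expect (pv j₀) fun v => (if v ∈ I then (1 : ℝ≥0∞) else 0) := by
            refine mul_le_mul' (le_trans (ENNReal.ofReal_le_ofReal ?_)
              (le_expMech_minMax hF hB₁ _ (mem_splitFeatures.2 (hV j₀)))) h1
            gcongr
        _ = pj j₀ * expect (pv j₀) fun v => (if j₀ = j₀ ∧ v ∈ I then (1 : ℝ≥0∞) else 0) := by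
            simp
        _ ≤ _ := ENNReal.le_tsum (f := fun j => pj j * expect (pv j) fun v =>
            (if j = j₀ ∧ v ∈ I then (1 : ℝ≥0∞) else 0)) j₀
    rw [ENNReal.ofReal_sub _ (by positivity), ENNReal.ofReal_one]
    refine ENNReal.le_sub_of_add_le_left ENNReal.ofReal_ne_top ?_
    exact (add_le_add_left hlow _).trans_eq hsum
  rw [hexp]
  calc _ ≤ expect pj fun j => expect (pv j) fun v =>
        (sm j v * L + (if j = j₀ ∧ v ∈ I then 0 else 1) * A + b) :=
        expect_mono fun j => expect_mono fun v => hpoint j v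
    _ = (expect pj fun j => expect (pv j) (sm j)) * L + (expect pj fun j => expect (pv j) fun v =>
          (if j = j₀ ∧ v ∈ I then (0 : ℝ≥0∞) else 1)) * A + b := by
        simp_rw [expect_add, expect_mul_const, expect_const]
    _ ≤ _ := by
        refine add_le_add_left (add_le_add (mul_le_mul_left ?_ _) (mul_le_mul_left hcutE _)) _
        exact expect_le_const fun j _ => hsmE j

end Split

/-! ### The leaves are small -/

/-- Boxes only shrink down the tree, so a leaf can span the interval only if the root does, and then
the leaf volumes add up to the root volume. -/
theorem leafSum_spanCost_le (k : ℕ) (d : Sample D K n) (j : Fin D) (q w : ℝ) (t : Tree D)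
    (a b : Fin D → ℝ) (E : Finset (Fin n)) :
    leafSum k d (fun a b _ => spanCost j q w a b) t a b E ≤ spanCost j q w a b := by
  classical
  set p : Prop := a j ≤ q ∧ q + w < b j with hp
  have h1 : leafSum k d (fun a b _ => spanCost j q w a b) t a b E ≤
      leafSum k d (fun a b _ => if p then unitVolume D (box a b) else 0) t a b E := by
    refine leafSum_mono_of_le (a₀ := a) (b₀ := b) (fun a' b' _ ha' hb' => ?_) t le_rfl le_rfl E
    unfold spanCost
    split_ifs with h h'
    · exact le_rfl
    · exact absurd ⟨(ha' j).trans h.1, h.2.trans_le (hb' j)⟩ h'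
    · exact zero_le
    · exact le_rfl
  refine h1.trans (le_of_eq ?_)
  rw [leafSum_additive (fun a b => if p then unitVolume D (box a b) else 0)]
  · unfold spanCost
    simp only [hp]
  · intro a b j v
    split_ifs
    · exact measure_box_split _ _ _ _ _
    · simp

theorem spanCost_le (j : Fin D) (q w : ℝ) (a b : Fin D → ℝ) :
    spanCost j q w a b ≤ unitVolume D (box a b) := by
  unfold spanCost
  split_ifs <;> simp

/-- The additive weight that dominates the volume of the boxes on which the density is not
well behaved. -/
noncomputable def badWeight (μ : Measure (Fin D → ℝ)) (f : (Fin D → ℝ) → ℝ≥0∞) (R τ w : ℝ)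
    (a b : Fin D → ℝ) : ℝ≥0∞ :=
  (ENNReal.ofReal R)⁻¹ * μ (box a b) +
    (ENNReal.ofReal (w / 2))⁻¹ * unitVolume D (box a b ∩ {x | f x < ENNReal.ofReal τ})

theorem badWeight_split (μ : Measure (Fin D → ℝ)) (f : (Fin D → ℝ) → ℝ≥0∞) (R τ w : ℝ)
    (a b : Fin D → ℝ) (j : Fin D) (v : ℝ) :
    badWeight μ f R τ w a (upper b j v) + badWeight μ f R τ w (lower a j v) b =
      badWeight μ f R τ w a b := by
  unfold badWeight
  rw [← measure_box_split μ a b j v, ← measure_box_inter_split _ _ a b j v]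
  ring

theorem isProbabilityMeasure_unitVolume : IsProbabilityMeasure (unitVolume D) := ⟨unitVolume_univ⟩

/-- In a good box the mass is at most `R` times the volume, and the density is below `τ` on at most
a fraction `w/2` of the volume. The slab has a fraction at least `w` of the volume because the side
is at most 1, so at least `w/2` remains where the density is at least `τ`. The ratio is `τ (w/2) /
R`. -/
theorem mul_measure_box_le_measure_slab {μ : Measure (Fin D → ℝ)} [IsProbabilityMeasure μ]
    {f : (Fin D → ℝ) → ℝ≥0∞} (hf : Measurable f) (hμ : μ = (unitVolume D).withDensity f)
    {R τ w q : ℝ} (hR : 0 < R) (hτ : 0 < τ) (hw : 0 < w) {a b : Fin D → ℝ} {j : Fin D}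
    (ha : 0 ≤ a) (hb : b ≤ 1) (haq : a j ≤ q) (hqb : q + w < b j)
    (hgood : badWeight μ f R τ w a b ≤ unitVolume D (box a b)) :
    τ * w / (2 * R) * μ.real (box a b) ≤
      μ.real (box (Function.update a j q) (Function.update b j (q + w))) := by
  have := isProbabilityMeasure_unitVolume (D := D)
  set lam := unitVolume D with hlam
  set G : Set (Fin D → ℝ) := {x | f x < ENNReal.ofReal τ} with hG
  have hGm : MeasurableSet G := measurableSet_lt hf measurable_const
  set box' := box (Function.update a j q) (Function.update b j (q + w)) with hbox'
  have hm' : MeasurableSet box' := measurableSet_box _ _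
  have ha' : a ≤ Function.update a j q := by
    rw [le_update_iff]; exact ⟨haq, fun _ _ => le_rfl⟩
  have hb' : Function.update b j (q + w) ≤ b := by
    rw [update_le_iff]; exact ⟨hqb.le, fun _ _ => le_rfl⟩
  have hsub : box' ⊆ box a b := box_subset_box ha' hb'
  have hinv : ∀ {c : ℝ} {x y : ℝ≥0∞}, 0 < c → (ENNReal.ofReal c)⁻¹ * x ≤ y →
      x ≤ ENNReal.ofReal c * y := by
    intro c x y hc h
    have hc0 : ENNReal.ofReal c ≠ 0 := (ENNReal.ofReal_pos.2 hc).ne'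
    calc x = ENNReal.ofReal c * ((ENNReal.ofReal c)⁻¹ * x) := by
          rw [← mul_assoc, ENNReal.mul_inv_cancel hc0 ENNReal.ofReal_ne_top, one_mul]
      _ ≤ _ := mul_le_mul_right h _
  have h1 : μ.real (box a b) ≤ R * lam.real (box a b) := by
    have := hinv hR (le_self_add.trans hgood)
    have := ENNReal.toReal_mono (ENNReal.mul_ne_top ENNReal.ofReal_ne_top (measure_ne_top _ _)) this
    rwa [ENNReal.toReal_mul, ENNReal.toReal_ofReal hR.le] at this
  have h2 : lam.real (box a b ∩ G) ≤ w / 2 * lam.real (box a b) := by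
    have := hinv (half_pos hw) (le_add_self.trans hgood)
    have := ENNReal.toReal_mono (ENNReal.mul_ne_top ENNReal.ofReal_ne_top (measure_ne_top _ _)) this
    rwa [ENNReal.toReal_mul, ENNReal.toReal_ofReal (by positivity)] at this
  have h3 : w * lam.real (box a b) ≤ lam.real box' := by
    have hv : ENNReal.ofReal w * lam (box a b) ≤ lam box' := by
      rw [hlam, hbox', unitVolume_box ha hb, unitVolume_box (ha.trans ha') (hb'.trans hb),
        volume_box_update]
      have := volume_box_update a b j (a j) (b j)
      rw [Function.update_eq_self, Function.update_eq_self] at this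
      rw [this, show q + w - q = w by ring]
      refine mul_le_mul_right ?_ _
      calc ENNReal.ofReal (b j - a j) * ∏ i ∈ Finset.univ.erase j, ENNReal.ofReal (b i - a i)
          ≤ 1 * ∏ i ∈ Finset.univ.erase j, ENNReal.ofReal (b i - a i) := by
            refine mul_le_mul_left ?_ _
            rw [← ENNReal.ofReal_one]
            refine ENNReal.ofReal_le_ofReal ?_
            have h0 : 0 ≤ a j := ha j
            have h1 : b j ≤ 1 := hb j
            linarith
        _ = _ := one_mul _
    have := ENNReal.toReal_mono (measure_ne_top _ _) hv
    rwa [ENNReal.toReal_mul, ENNReal.toReal_ofReal hw.le] at this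
  have h4 : τ * lam.real (box' \ G) ≤ μ.real box' := by
    have hv : ENNReal.ofReal τ * lam (box' \ G) ≤ μ box' := by
      calc ENNReal.ofReal τ * lam (box' \ G) = ∫⁻ _x in box' \ G, ENNReal.ofReal τ ∂lam := by
            rw [setLIntegral_const]
        _ ≤ ∫⁻ x in box' \ G, f x ∂lam :=
            setLIntegral_mono' (hm'.diff hGm) fun x hx => not_lt.1 hx.2
        _ = μ (box' \ G) := by rw [hμ, withDensity_apply _ (hm'.diff hGm)]
        _ ≤ μ box' := measure_mono Set.sdiff_subset
    have := ENNReal.toReal_mono (measure_ne_top _ _) hv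
    rwa [ENNReal.toReal_mul, ENNReal.toReal_ofReal hτ.le] at this
  have h5 : lam.real box' ≤ lam.real (box' \ G) + lam.real (box a b ∩ G) := by
    rw [← measureReal_inter_add_sdiff (μ := lam) (s := box') hGm, add_comm]
    exact add_le_add_right (measureReal_mono (Set.inter_subset_inter_left _ hsub)) _
  have h6 : w / 2 * lam.real (box a b) ≤ lam.real (box' \ G) := by linarith
  calc τ * w / (2 * R) * μ.real (box a b) ≤ τ * w / (2 * R) * (R * lam.real (box a b)) := by gcongr
    _ = τ * (w / 2 * lam.real (box a b)) := by field_simp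
    _ ≤ τ * lam.real (box' \ G) := by gcongr
    _ ≤ _ := h4

set_option maxHeartbeats 1000000 in
-- Induction on the number `h` of levels still under control. After `H - h` balanced splits the node
-- retains a fraction at least `κ ^ (H - h)` of the structure points; `hcard` says this without
-- subtraction. Each level multiplies the spanning volume by `1 - p` and adds `σ` for imbalance. Bad
-- boxes are absorbed in `badWeight`, which is passed additively to the children, so they are
-- charged only once.
theorem expect_leafSum_spanCost_le (T : (Fin K → ℝ) → ℝ) {B₁ B₂ : ℝ} (hB₁ : 0 ≤ B₁) (hB₂ : 0 ≤ B₂)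
    {μ : Measure (Fin D → ℝ)} [IsProbabilityMeasure μ]
    {f : (Fin D → ℝ) → ℝ≥0∞} (hf : Measurable f) (hμ : μ = (unitVolume D).withDensity f)
    {j : Fin D} {q w R τ κ ε r₀ : ℝ} (hw0 : 0 < w) (hR : 0 < R) (hτ : 0 < τ)
    (hr₀ : r₀ = τ * w / (2 * R)) (hr₁ : r₀ ≤ 1) (hκ0 : 0 < κ) (hκ1 : κ ≤ 1)
    {H : ℕ} (hεr : (r₀ + 2) * ε ≤ κ ^ H * (r₀ / 2)) (hεκ : 4 * ε ≤ κ ^ (H + 1))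
    {d d' : Sample D K n} {S₀ E₀ : Finset (Fin n)} (hd : IsUniform μ ε d S₀)
    (hd' : IsUniform μ ε d' E₀) (hinj : ∀ j, Function.Injective fun i => (d i).1 j)
    (hS₀ : 1 ≤ ε * S₀.card) {k : ℕ} (hk : (k : ℝ) ≤ E₀.card * (κ ^ H / 2))
    {h : ℕ} (hH : h ≤ H) {m : ℕ} (hm : h ≤ m) {a b : Fin D → ℝ} (ha : 0 ≤ a) (hb : b ≤ 1)
    (hcard : κ ^ H * S₀.card ≤ κ ^ h * (pointsIn d S₀ a b).card) :
    expect (fullTree T B₁ B₂ d m (pointsIn d S₀ a b)) (fun t =>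
      leafSum k d' (fun a b _ => spanCost j q w a b) t a b (pointsIn d' E₀ a b)) ≤
    ENNReal.ofReal ((1 - Real.exp (-(B₁ / 2)) / D * Real.exp (-(B₂ / 2)) * (r₀ / 2)) ^ h +
      h * (3 * κ * Real.exp (B₂ / 2))) * unitVolume D (box a b) + badWeight μ f R τ w a b := by
  classical
  set p := Real.exp (-(B₁ / 2)) / D * Real.exp (-(B₂ / 2)) * (r₀ / 2) with hp
  set σ := 3 * κ * Real.exp (B₂ / 2) with hσ
  set lam := unitVolume D with hlam
  have hr0 : 0 < r₀ := by rw [hr₀]; positivity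
  have hDpos : (1 : ℝ) ≤ D := by exact_mod_cast (Fin.pos j)
  have hp1 : p ≤ 1 := by
    have h1 : Real.exp (-(B₁ / 2)) / D ≤ 1 := by
      rw [div_le_one (by linarith)]
      exact (Real.exp_le_one_iff.2 (by linarith)).trans hDpos
    have h2 : Real.exp (-(B₂ / 2)) ≤ 1 := Real.exp_le_one_iff.2 (by linarith)
    have h3 : Real.exp (-(B₁ / 2)) / D * Real.exp (-(B₂ / 2)) ≤ 1 :=
      mul_le_one₀ h1 (Real.exp_pos _).le h2
    exact mul_le_one₀ h3 (by positivity) (by linarith)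
  have hσ0 : 0 ≤ σ := by positivity
  induction h generalizing m a b with
  | zero =>
    refine expect_le_const fun t _ => ?_
    refine (leafSum_spanCost_le k d' j q w t a b _).trans ((spanCost_le j q w a b).trans ?_)
    simp
    exact le_self_add
  | succ h ih =>
    obtain ⟨m, rfl⟩ : ∃ m', m = m' + 1 := ⟨m - 1, by omega⟩
    by_cases hspan : a j ≤ q ∧ q + w < b j
    swap
    · refine expect_le_const fun t _ => ?_
      refine (leafSum_spanCost_le k d' j q w t a b _).trans ?_
      rw [spanCost, if_neg hspan]
      exact zero_le
    -- On a bad box the additive weight already dominates the whole volume; the failure of this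
    -- inequality is what makes both density estimates for the slab available.
    by_cases hbad : lam (box a b) ≤ badWeight μ f R τ w a b
    · refine expect_le_const fun t _ => ?_
      exact (leafSum_spanCost_le k d' j q w t a b _).trans ((spanCost_le j q w a b).trans
        (hbad.trans le_add_self))
    have hslab := mul_measure_box_le_measure_slab hf hμ hR hτ hw0 ha hb hspan.1 hspan.2
      (not_le.1 hbad).le
    rw [← hr₀] at hslab
    set S := pointsIn d S₀ a b with hS
    set s := (S₀.card : ℝ) with hs
    set N := (S.card : ℝ) with hN
    have hs0 : 0 ≤ s := by positivity
    have hN0 : 0 ≤ N := by positivity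
    have hκH : 0 < κ ^ H := by positivity
    have hNs : κ ^ H * s ≤ N := hcard.trans (mul_le_of_le_one_left hN0 (pow_le_one₀ hκ0.le hκ1))
    have hκN : 4 ≤ κ * N := by
      have h1 : κ * (κ ^ H * s) ≤ κ * N := by gcongr
      have h2 : 4 * ε * s ≤ κ ^ (H + 1) * s := by gcongr
      rw [pow_succ] at h2
      nlinarith
    have hN4 : 4 ≤ N := hκN.trans (mul_le_of_le_one_left hN0 hκ1)
    have hS2 : 2 ≤ S.card := by
      have : (2 : ℝ) ≤ S.card := by linarith
      exact_mod_cast this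
    -- Uniformity, applied to the box and to the slab, loses `(r₀ + 1) ε s` points. The hypothesis
    -- `hS₀` lets one more `ε s` pay for the `+ 1`, and `hεr` makes the total at most half of `r₀
    -- N`.
    have hslabcard : r₀ / 2 * N + 1 ≤
        ((S.filter fun i => (d i).1 j ∈ Set.Ioc q (q + w)).card : ℝ) := by
      have hpts : pointsIn d S₀ (Function.update a j q) (Function.update b j (q + w)) ⊆
          S.filter fun i => (d i).1 j ∈ Set.Ioc q (q + w) := by
        intro i hi
        simp only [pointsIn, Finset.mem_filter, hS] at hi ⊢
        refine ⟨⟨hi.1, ?_⟩, ?_⟩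
        · refine box_subset_box ?_ ?_ hi.2
          · rw [le_update_iff]; exact ⟨hspan.1, fun _ _ => le_rfl⟩
          · rw [update_le_iff]; exact ⟨hspan.2.le, fun _ _ => le_rfl⟩
        · have := hi.2 j
          simpa using this
      have hM : ((pointsIn d S₀ (Function.update a j q) (Function.update b j (q + w))).card : ℝ) ≤
          ((S.filter fun i => (d i).1 j ∈ Set.Ioc q (q + w)).card : ℝ) := by
        exact_mod_cast Finset.card_le_card hpts
      have hu1 := abs_le.1 (hd (Function.update a j q) (Function.update b j (q + w)))
      have hu2 := abs_le.1 (hd a b)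
      have h1 : s * (r₀ * μ.real (box a b)) ≤
          s * μ.real (box (Function.update a j q) (Function.update b j (q + w))) := by gcongr
      have h2 : N ≤ s * μ.real (box a b) + ε * s := by linarith [hu2.2]
      have h3 : r₀ * N ≤ r₀ * (s * μ.real (box a b) + ε * s) := by gcongr
      have h4 : (r₀ + 2) * ε * s ≤ κ ^ H * (r₀ / 2) * s := by gcongr
      have h5 : r₀ / 2 * (κ ^ H * s) ≤ r₀ / 2 * N := by gcongr
      linarith [hu1.1]
    have hstep := expect_fullTree_succ_le (d := d) (S := S) (m := m) T hB₁ hB₂ hS2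
      (fun j => (hinj j).injOn) j (I := Set.Ioc q (q + w)) (ρ := r₀ / 2) (κ := κ) hκ0.le
      (by positivity) (by rw [← hN]; convert hslabcard)
      (F := fun t => leafSum k d' (fun a b _ => spanCost j q w a b) t a b (pointsIn d' E₀ a b))
      (L := lam (box a b))
      (A := ENNReal.ofReal ((1 - p) ^ h + h * σ) * lam (box a b))
      (b := badWeight μ f R τ w a b)
      (fun t => (leafSum_spanCost_le k d' j q w t a b _).trans
        ((spanCost_le j q w a b).trans le_self_add)) ?_
    · refine hstep.trans ?_
      refine add_le_add_left ?_ _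
      rw [← mul_assoc, ← add_mul, ← ENNReal.ofReal_mul (by linarith)]
      refine mul_le_mul_left ?_ _
      have h1p : 0 ≤ 1 - p := by linarith
      have hx : 0 ≤ (1 - p) ^ h + h * σ := by positivity
      rw [← ENNReal.ofReal_add (div_nonneg (by positivity) (by linarith)) (by positivity)]
      refine ENNReal.ofReal_le_ofReal ?_
      rw [← hN, ← hp]
      have h1 : Real.exp (B₂ / 2) * (2 * κ * N + 1) / (N - 1) ≤ σ := by
        rw [div_le_iff₀ (by linarith), hσ]
        -- This uses `κ N ≥ 4` and `κ ≤ 1`: the difference is `κ N - 3 κ - 1`.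
        have : 2 * κ * N + 1 ≤ 3 * κ * (N - 1) := by nlinarith
        have := mul_le_mul_of_nonneg_left this (Real.exp_pos (B₂ / 2)).le
        linarith
      have hhσ : 0 ≤ p * (h * σ) := by positivity
      have h2 : (1 - p) * ((1 - p) ^ h + h * σ) ≤ (1 - p) ^ (h + 1) + h * σ := by
        rw [pow_succ]; linarith
      have h3 : ((h + 1 : ℕ) : ℝ) * σ = h * σ + σ := by push_cast; ring
      rw [h3]
      linarith
    · intro j' v hl hr
      rw [hS, left_pointsIn, ← hS] at hl
      rw [hS, right_pointsIn, ← hS] at hr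
      -- A child with a share `κ` of the structure points has mass at least `κ ^ H - ε`, so by
      -- uniformity it has at least `(κ ^ H - 2ε) E₀.card` estimation points. This is at least `k`,
      -- so balanced splits are never pruned here.
      have hEcount : ∀ a' b' : Fin D → ℝ, κ * N ≤ (pointsIn d S₀ a' b').card →
          k ≤ (pointsIn d' E₀ a' b').card := by
        intro a' b' hc
        have hu1 := abs_le.1 (hd a' b')
        have hu2 := abs_le.1 (hd' a' b')
        have hspos : 0 < s := by
          by_contra hcon
          have : s = 0 := le_antisymm (not_lt.1 hcon) hs0
          rw [this] at hS₀
          linarith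
        have h1 : κ ^ H * s ≤ κ * N := by
          have h2 : κ ^ (h + 1) * N ≤ κ * N := by
            rw [pow_succ, mul_assoc]
            exact mul_le_of_le_one_left (by positivity) (pow_le_one₀ hκ0.le hκ1)
          exact hcard.trans h2
        have h3 : s * (κ ^ H - ε) ≤ s * μ.real (box a' b') := by linarith [hu1.2]
        have h4 : κ ^ H - ε ≤ μ.real (box a' b') := le_of_mul_le_mul_left h3 hspos
        have h5 : κ ^ (H + 1) ≤ κ ^ H := pow_le_pow_of_le_one hκ0.le hκ1 (Nat.le_succ H)
        have h6 : (E₀.card : ℝ) * (κ ^ H / 2) ≤ E₀.card * (μ.real (box a' b') - ε) := by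
          gcongr
          linarith
        have h7 : (k : ℝ) ≤ (pointsIn d' E₀ a' b').card := by linarith [hu2.1]
        exact_mod_cast h7
      have hkl := hEcount _ _ hl
      have hkr := hEcount _ _ hr
      have hcardl : κ ^ H * s ≤ κ ^ h * (pointsIn d S₀ a (upper b j' v)).card := by
        refine hcard.trans ?_
        rw [pow_succ, mul_assoc]
        gcongr
      have hcardr : κ ^ H * s ≤ κ ^ h * (pointsIn d S₀ (lower a j' v) b).card := by
        refine hcard.trans ?_
        rw [pow_succ, mul_assoc]
        gcongr
      have hnode : ∀ l r : Tree D, leafSum k d' (fun a b _ => spanCost j q w a b)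
          (Tree.node j' v l r) a b (pointsIn d' E₀ a b) =
          leafSum k d' (fun a b _ => spanCost j q w a b) l a (upper b j' v)
            (pointsIn d' E₀ a (upper b j' v)) +
          leafSum k d' (fun a b _ => spanCost j q w a b) r (lower a j' v) b
            (pointsIn d' E₀ (lower a j' v) b) := by
        intro l r
        rw [leafSum, left_pointsIn, right_pointsIn, if_pos ⟨hkl, hkr⟩]
      simp_rw [hnode, expect_add, expect_const]
      rw [hS, left_pointsIn, right_pointsIn]
      -- A cut inside the slab leaves neither child spanning it, so this branch costs nothing.
      by_cases hc : j' = j ∧ v ∈ Set.Ioc q (q + w)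
      · obtain ⟨rfl, hv⟩ := hc
        have hz : ∀ (a' b' : Fin D → ℝ), ¬ (a' j' ≤ q ∧ q + w < b' j') →
            ∀ (t : Tree D) (E : Finset (Fin n)),
              leafSum k d' (fun a b _ => spanCost j' q w a b) t a' b' E = 0 := by
          intro a' b' hns t E
          have := leafSum_spanCost_le k d' j' q w t a' b' E
          rw [spanCost, if_neg hns] at this
          exact le_antisymm this zero_le
        simp_rw [hz a (upper b j' v) (fun hcon => by
            have : upper b j' v j' ≤ v := by simp [upper]
            linarith [hcon.2, hv.2]),
          hz (lower a j' v) b (fun hcon => by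
            have : v ≤ lower a j' v j' := by simp [lower]
            linarith [hcon.1, hv.1]), expect_const]
        simp
      · rw [if_neg hc]
        refine (add_le_add (ih (by omega) (by omega) ha ((upper_le b j' v).trans hb) hcardl)
          (ih (by omega) (by omega) (ha.trans (le_lower a j' v)) hb hcardr)).trans (le_of_eq ?_)
        rw [← badWeight_split μ f R τ w a b j' v, ← measure_box_split lam a b j' v]
        ring

/-! ### Measurability of the expected deviation in the training set -/

theorem minMax_image {α β : Type} [DecidableEq β] {s : Finset α} (hs : s.Nonempty) {φ : α → β}
    {u' : β → ℝ} {u : α → ℝ} (hu : ∀ a ∈ s, u' (φ a) = u a) (hs' : (s.image φ).Nonempty)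
    {a : α} (ha : a ∈ s) : minMax (s.image φ) hs' u' (φ a) = minMax s hs u a := by
  have h1 : (s.image φ).inf' hs' u' = s.inf' hs u := by
    rw [Finset.inf'_image]
    exact Finset.inf'_congr _ rfl hu
  have h2 : (s.image φ).sup' hs' u' = s.sup' hs u := by
    rw [Finset.sup'_image]
    exact Finset.sup'_congr _ rfl hu
  rw [minMax, minMax, h1, h2, hu a ha]

theorem expect_expMech_image {α β : Type} [DecidableEq β] {s : Finset α} (hs : s.Nonempty)
    {φ : α → β} (hφ : Set.InjOn φ s) {B : ℝ} {u' : β → ℝ} {u : α → ℝ}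
    (hu : ∀ a ∈ s, u' (φ a) = u a) (hs' : (s.image φ).Nonempty) (F : β → ℝ≥0∞) :
    expect (expMech (s.image φ) hs' B u') F = expect (expMech s hs B u) (F ∘ φ) := by
  rw [expect_expMech, expect_expMech, Finset.sum_image hφ]
  refine Finset.sum_congr rfl fun a ha => ?_
  rw [expMech_apply hs' _ _ (Finset.mem_image_of_mem φ ha), expMech_apply hs _ _ ha,
    Finset.sum_image hφ, hu a ha,
    Finset.sum_congr rfl fun b hb => by rw [hu b hb]]
  rfl

theorem expect_expMech_minMax_eq {α β : Type} [DecidableEq β] {s : Finset α} (hs : s.Nonempty)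
    {φ : α → β} (hφ : Set.InjOn φ s) {B : ℝ} {u' : β → ℝ} {u : α → ℝ}
    (hu : ∀ a ∈ s, u' (φ a) = u a) {s' : Finset β} (hs' : s'.Nonempty) (h : s' = s.image φ)
    (F : β → ℝ≥0∞) :
    expect (expMech s' hs' B (minMax s' hs' u')) F =
      expect (expMech s hs B (minMax s hs u)) (F ∘ φ) := by
  subst h
  exact expect_expMech_image hs hφ (fun a ha => minMax_image hs hu hs' ha) hs' F

theorem expMech_minMax_congr {α : Type} {s s' : Finset α} (h : s = s') (hs : s.Nonempty)
    (hs' : s'.Nonempty) {u u' : α → ℝ} (hu : u = u') (B : ℝ) :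
    expMech s hs B (minMax s hs u) = expMech s' hs' B (minMax s' hs' u') := by
  subst h hu
  rfl

/-! ### The law of the tree depends on the order pattern of the sample. -/

/-- Two samples with the same labels and the same order of the points in every coordinate. -/
def SamePattern (d₀ d : Sample D K n) : Prop :=
  (∀ i i' j, (d i).1 j ≤ (d i').1 j ↔ (d₀ i).1 j ≤ (d₀ i').1 j) ∧ ∀ i, (d i).2 = (d₀ i).2

open Classical in
/-- The value of feature `j` in `d` at a point whose value in `d₀` is `v`. -/
noncomputable def transport (d₀ d : Sample D K n) (j : Fin D) (v : ℝ) : ℝ :=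
  if h : ∃ i, (d₀ i).1 j = v then (d h.choose).1 j else 0

/-- The tree whose split values are transported from `d₀` to `d`. -/
noncomputable def relabel (d₀ d : Sample D K n) : Tree D → Tree D
  | .leaf => .leaf
  | .node j v l r => .node j (transport d₀ d j v) (relabel d₀ d l) (relabel d₀ d r)

namespace SamePattern

variable {d₀ d : Sample D K n} (h : SamePattern d₀ d)
include h

theorem transport_apply (i : Fin n) (j : Fin D) :
    transport d₀ d j ((d₀ i).1 j) = (d i).1 j := by
  have hex : ∃ i', (d₀ i').1 j = (d₀ i).1 j := ⟨i, rfl⟩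
  rw [transport, dif_pos hex]
  have hc := hex.choose_spec
  exact le_antisymm ((h.1 _ _ _).2 hc.le) ((h.1 _ _ _).2 hc.ge)

theorem left_eq (A : Finset (Fin n)) (i : Fin n) (j : Fin D) :
    left d A j ((d i).1 j) = left d₀ A j ((d₀ i).1 j) :=
  Finset.filter_congr fun i' _ => h.1 i' i j

theorem right_eq (A : Finset (Fin n)) (i : Fin n) (j : Fin D) :
    right d A j ((d i).1 j) = right d₀ A j ((d₀ i).1 j) :=
  Finset.filter_congr fun i' _ => by rw [← not_le, ← not_le, h.1 i' i j]

theorem classFreq_eq (A : Finset (Fin n)) : classFreq d A = classFreq d₀ A := by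
  ext c
  unfold classFreq
  rw [Finset.filter_congr fun i _ => by rw [h.2 i]]

theorem impurityDecrease_eq (T : (Fin K → ℝ) → ℝ) (S : Finset (Fin n)) (i : Fin n) (j : Fin D) :
    impurityDecrease T d S j ((d i).1 j) = impurityDecrease T d₀ S j ((d₀ i).1 j) := by
  unfold impurityDecrease
  rw [h.left_eq, h.right_eq, h.classFreq_eq, h.classFreq_eq, h.classFreq_eq]

theorem splitValues_eq [DecidableEq ℝ] (S : Finset (Fin n)) (j : Fin D) :
    splitValues d S j = (splitValues d₀ S j).image (transport d₀ d j) := by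
  ext v
  rw [mem_splitValues, Finset.mem_image]
  constructor
  · rintro ⟨⟨i, hi, rfl⟩, i', hi', hlt⟩
    refine ⟨(d₀ i).1 j, mem_splitValues.2 ⟨⟨i, hi, rfl⟩, i', hi', ?_⟩, h.transport_apply i j⟩
    rw [← not_le] at hlt ⊢
    rwa [← h.1]
  · rintro ⟨v, hv, rfl⟩
    obtain ⟨⟨i, hi, rfl⟩, i', hi', hlt⟩ := mem_splitValues.1 hv
    rw [h.transport_apply]
    refine ⟨⟨i, hi, rfl⟩, i', hi', ?_⟩
    rw [← not_le] at hlt ⊢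
    rwa [h.1]

theorem injOn_transport (S : Finset (Fin n)) (j : Fin D) :
    Set.InjOn (transport d₀ d j) (splitValues d₀ S j) := by
  intro v hv v' hv' heq
  obtain ⟨⟨i, -, rfl⟩, -⟩ := mem_splitValues.1 hv
  obtain ⟨⟨i', -, rfl⟩, -⟩ := mem_splitValues.1 hv'
  rw [h.transport_apply, h.transport_apply] at heq
  exact le_antisymm ((h.1 _ _ _).1 heq.le) ((h.1 _ _ _).1 heq.ge)

theorem impurityDecrease_transport (T : (Fin K → ℝ) → ℝ) (S : Finset (Fin n)) (j : Fin D) {v : ℝ}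
    (hv : v ∈ splitValues d₀ S j) :
    impurityDecrease T d S j (transport d₀ d j v) = impurityDecrease T d₀ S j v := by
  obtain ⟨⟨i, -, rfl⟩, -⟩ := mem_splitValues.1 hv
  rw [h.transport_apply, h.impurityDecrease_eq]

theorem splitValues_nonempty (S : Finset (Fin n)) (j : Fin D) :
    (splitValues d S j).Nonempty ↔ (splitValues d₀ S j).Nonempty := by
  classical
  rw [h.splitValues_eq, Finset.image_nonempty]

theorem splitFeatures_eq (S : Finset (Fin n)) : splitFeatures d S = splitFeatures d₀ S := by
  ext j
  rw [mem_splitFeatures, mem_splitFeatures, h.splitValues_nonempty]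

theorem bestDecrease_eq (T : (Fin K → ℝ) → ℝ) (S : Finset (Fin n)) :
    bestDecrease T d S = bestDecrease T d₀ S := by
  classical
  ext j
  unfold bestDecrease
  by_cases hne : (splitValues d₀ S j).Nonempty
  · rw [dif_pos hne, dif_pos ((h.splitValues_nonempty S j).2 hne)]
    have : ∀ (s : Finset ℝ) (hs : s.Nonempty),
        s = (splitValues d₀ S j).image (transport d₀ d j) →
        s.sup' hs (impurityDecrease T d S j) =
          (splitValues d₀ S j).sup' hne (impurityDecrease T d₀ S j) := by
      rintro s hs rfl
      rw [Finset.sup'_image]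
      exact Finset.sup'_congr _ rfl fun v hv => h.impurityDecrease_transport T S j hv
    exact this _ _ (h.splitValues_eq S j)
  · rw [dif_neg hne, dif_neg (mt (h.splitValues_nonempty S j).1 hne)]

/-- Every split value is a coordinate of a sample point, and children and impurity decreases depend
only on labels and on the order within each coordinate. Samples with the same pattern thus give the
same random tree up to moving the thresholds. -/
theorem expect_fullTree (T : (Fin K → ℝ) → ℝ) (B₁ B₂ : ℝ) (m : ℕ) (S : Finset (Fin n))
    (F : Tree D → ℝ≥0∞) :
    expect (fullTree T B₁ B₂ d m S) F =
      expect (fullTree T B₁ B₂ d₀ m S) fun t => F (relabel d₀ d t) := by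
  classical
  induction m generalizing S F with
  | zero => simp [fullTree, expect_pure, relabel]
  | succ m ih =>
    by_cases hF : (splitFeatures d₀ S).Nonempty
    · have hF' : (splitFeatures d S).Nonempty := by rwa [h.splitFeatures_eq]
      rw [fullTree, fullTree, dif_pos hF, dif_pos hF', expect_bind, expect_bind,
        expMech_minMax_congr (h.splitFeatures_eq S) hF' hF (h.bestDecrease_eq T S)]
      refine expect_congr fun j => ?_
      by_cases hV : (splitValues d₀ S j).Nonempty
      · have hV' := (h.splitValues_nonempty S j).2 hV
        rw [dif_pos hV, dif_pos hV', expect_bind, expect_bind,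
          expect_expMech_minMax_eq hV (h.injOn_transport S j)
            (fun v hv => h.impurityDecrease_transport T S j hv) hV' (h.splitValues_eq S j),
          expect_expMech, expect_expMech]
        refine Finset.sum_congr rfl fun v hv => ?_
        obtain ⟨⟨i, -, rfl⟩, -⟩ := mem_splitValues.1 hv
        simp only [Function.comp_apply, h.transport_apply, expect_bind, expect_map,
          Function.comp_def, h.left_eq, h.right_eq, ih, relabel]
      · rw [dif_neg hV, dif_neg (mt (h.splitValues_nonempty S j).1 hV), expect_pure, expect_pure,
          relabel]
    · have hF' : ¬ (splitFeatures d S).Nonempty := by rwa [h.splitFeatures_eq]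
      rw [fullTree, fullTree, dif_neg hF, dif_neg hF', expect_pure, expect_pure, relabel]

end SamePattern

theorem measurable_transport (d₀ : Sample D K n) (j : Fin D) (v : ℝ) :
    Measurable fun d : Sample D K n => transport d₀ d j v := by
  unfold transport
  split_ifs with h
  · exact (measurable_pi_apply j).comp (measurable_fst.comp (measurable_pi_apply _))
  · exact measurable_const

/-- The order pattern and the labels of a sample. -/
def pattern (d : Sample D K n) : (Fin n → Fin n → Fin D → Prop) × (Fin n → Fin K) :=
  (fun i i' j => (d i).1 j ≤ (d i').1 j, fun i => (d i).2)

theorem samePattern_of_pattern_eq {d₀ d : Sample D K n} (h : pattern d₀ = pattern d) :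
    SamePattern d₀ d := by
  have h1 := congrArg Prod.fst h
  have h2 := congrArg Prod.snd h
  refine ⟨fun i i' j => ?_, fun i => (congrFun h2 i).symm⟩
  exact (iff_of_eq (congrFun (congrFun (congrFun h1 i) i') j)).symm

theorem measurable_pattern : Measurable (pattern : Sample D K n → _) := by
  refine Measurable.prodMk ?_ ?_
  · refine measurable_pi_iff.2 fun i => measurable_pi_iff.2 fun i' => measurable_pi_iff.2 fun j => ?_
    refine measurableSet_setOfPred.1 (measurableSet_le ?_ ?_)
    · exact (measurable_pi_apply j).comp (measurable_fst.comp (measurable_pi_apply i))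
    · exact (measurable_pi_apply j).comp (measurable_fst.comp (measurable_pi_apply i'))
  · exact measurable_pi_iff.2 fun i => measurable_snd.comp (measurable_pi_apply i)

/-- On the samples of a given pattern the law of the tree is that of one fixed representative, and
only the thresholds move, measurably. There are finitely many patterns, so no regularity of `T` is
required. -/
theorem measurable_expect_fullTree (T : (Fin K → ℝ) → ℝ) (B₁ B₂ : ℝ) (m : ℕ) (S : Finset (Fin n))
    {F : Sample D K n → Tree D → ℝ≥0∞}
    (hF : ∀ (d₀ : Sample D K n) (t : Tree D), Measurable fun d => F d (relabel d₀ d t)) :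
    Measurable fun d => expect (fullTree T B₁ B₂ d m S) (F d) := by
  classical
  set G : (Fin n → Fin n → Fin D → Prop) × (Fin n → Fin K) → Sample D K n → ℝ≥0∞ := fun π d =>
    if h : ∃ d₀ : Sample D K n, pattern d₀ = π then
      expect (fullTree T B₁ B₂ h.choose m S) fun t => F d (relabel h.choose d t) else 0 with hG
  have hGm : ∀ π, Measurable (G π) := by
    intro π
    simp only [hG]
    split_ifs with h
    · exact measurable_expect _ fun t => hF _ t
    · exact measurable_const
  have heq : ∀ d, expect (fullTree T B₁ B₂ d m S) (F d) = G (pattern d) d := by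
    intro d
    have hex : ∃ d₀ : Sample D K n, pattern d₀ = pattern d := ⟨d, rfl⟩
    simp only [hG]
    rw [dif_pos hex]
    exact (samePattern_of_pattern_eq hex.choose_spec).expect_fullTree T B₁ B₂ m S (F d)
  simp_rw [heq]
  exact (measurable_from_prod_countable_right (f := fun p => G p.1 p.2) hGm).comp
    (measurable_pattern.prodMk measurable_id)

/-! ### Measurability in the sample when the boxes move with the sample. -/

section Measurability

variable (P : Measure ((Fin D → ℝ) × Fin K)) [IsProbabilityMeasure P]
  {Ω : Type*} [MeasurableSpace Ω]

theorem measurableSet_mem_box {a b x : Ω → Fin D → ℝ} (ha : Measurable a) (hb : Measurable b)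
    (hx : Measurable x) : MeasurableSet {ω | x ω ∈ box (a ω) (b ω)} := by
  have : {ω | x ω ∈ box (a ω) (b ω)} = ⋂ j, {ω | a ω j < x ω j} ∩ {ω | x ω j ≤ b ω j} := by
    ext ω; simp [box]
  rw [this]
  have hj : ∀ (y : Ω → Fin D → ℝ) (j : Fin D), Measurable y → Measurable fun ω => y ω j :=
    fun y j hy => (measurable_pi_apply j).comp hy
  exact MeasurableSet.iInter fun j => (measurableSet_lt (hj a j ha) (hj x j hx)).inter
    (measurableSet_le (hj x j hx) (hj b j hb))

theorem measurable_measure_box {Z : Type*} [MeasurableSpace Z] (ν : Measure Z) [SFinite ν]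
    {π : Z → Fin D → ℝ} (hπ : Measurable π) {A : Set Z} (hA : MeasurableSet A)
    {a b : Ω → Fin D → ℝ} (ha : Measurable a) (hb : Measurable b) :
    Measurable fun ω => ν (π ⁻¹' box (a ω) (b ω) ∩ A) := by
  have hms : MeasurableSet {p : Ω × Z | π p.2 ∈ box (a p.1) (b p.1) ∧ p.2 ∈ A} :=
    (measurableSet_mem_box (ha.comp measurable_fst) (hb.comp measurable_fst)
      (hπ.comp measurable_snd)).inter (measurable_snd hA)
  exact measurable_measure_prodMk_left hms

theorem measurable_cellProb {a b : Ω → Fin D → ℝ} (ha : Measurable a) (hb : Measurable b)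
    (c : Fin K) : Measurable fun ω => cellProb P (a ω) (b ω) c := by
  unfold cellProb
  refine Measurable.div ?_ ?_
  · exact (measurable_measure_box P measurable_fst
      (measurable_snd (measurableSet_singleton c)) ha hb).ennreal_toReal
  · have := (measurable_measure_box P measurable_fst MeasurableSet.univ ha hb).ennreal_toReal
    simpa [measureReal_def] using this

theorem measurable_card_pointsIn_box (E : Finset (Fin n)) {a b : Sample D K n → Fin D → ℝ}
    (ha : Measurable a) (hb : Measurable b) :
    Measurable fun d : Sample D K n => (pointsIn d E (a d) (b d)).card := by
  unfold pointsIn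
  simp_rw [Finset.card_filter]
  refine Finset.measurable_sum _ fun i _ => Measurable.ite ?_ measurable_const measurable_const
  exact measurableSet_mem_box ha hb (measurable_fst.comp (measurable_pi_apply i))

theorem measurable_classFreq_pointsIn_box (E : Finset (Fin n)) {a b : Sample D K n → Fin D → ℝ}
    (ha : Measurable a) (hb : Measurable b) (c : Fin K) :
    Measurable fun d : Sample D K n => classFreq d (pointsIn d E (a d) (b d)) c := by
  have h1 : Measurable fun d : Sample D K n =>
      ((pointsIn d E (a d) (b d)).filter fun i => (d i).2 = c).card := by
    unfold pointsIn
    simp_rw [Finset.filter_filter, Finset.card_filter]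
    refine Finset.measurable_sum _ fun i _ => Measurable.ite ?_ measurable_const measurable_const
    exact (measurableSet_mem_box ha hb (measurable_fst.comp (measurable_pi_apply i))).inter
      ((measurable_snd.comp (measurable_pi_apply i)) (measurableSet_singleton c))
  unfold classFreq
  exact ((measurable_from_top (f := fun m : ℕ => (m : ℝ))).comp h1).div
    ((measurable_from_top (f := fun m : ℕ => (m : ℝ))).comp (measurable_card_pointsIn_box E ha hb))

theorem measurable_leafSum_devCost_relabel (k : ℕ) (c : Fin K) (E : Finset (Fin n))
    (d₀ : Sample D K n) (t : Tree D) {a b : Sample D K n → Fin D → ℝ} (ha : Measurable a)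
    (hb : Measurable b) :
    Measurable fun d : Sample D K n =>
      leafSum k d (devCost P c d) (relabel d₀ d t) (a d) (b d) (pointsIn d E (a d) (b d)) := by
  have hQ : ∀ {a b : Sample D K n → Fin D → ℝ}, Measurable a → Measurable b →
      Measurable fun d : Sample D K n =>
        devCost P c d (a d) (b d) (pointsIn d E (a d) (b d)) := by
    intro a b ha hb
    refine Measurable.mul ?_
      (((measurable_classFreq_pointsIn_box E ha hb c).sub (measurable_cellProb P ha hb c)).abs
        ).ennreal_ofReal
    have : IsProbabilityMeasure (P.map Prod.fst) :=
      Measure.isProbabilityMeasure_map measurable_fst.aemeasurable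
    simpa using measurable_measure_box (P.map Prod.fst) measurable_id MeasurableSet.univ ha hb
  induction t generalizing a b with
  | leaf => exact hQ ha hb
  | node j v l r ihl ihr =>
    simp only [relabel, leafSum, left_pointsIn, right_pointsIn]
    have hv := measurable_transport d₀ j v
    have hupd : ∀ (y : Sample D K n → Fin D → ℝ) (w : Sample D K n → ℝ), Measurable y →
        Measurable w → Measurable fun d => Function.update (y d) j (w d) := by
      intro y w hy hw
      refine measurable_pi_iff.2 fun i => ?_
      by_cases hi : i = j
      · subst hi; simpa using hw
      · simpa [hi, Function.comp_def] using (measurable_pi_apply i).comp hy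
    have hu : Measurable fun d => upper (b d) j (transport d₀ d j v) :=
      hupd b _ hb (((measurable_pi_apply j).comp hb).min hv)
    have hl : Measurable fun d => lower (a d) j (transport d₀ d j v) :=
      hupd a _ ha (((measurable_pi_apply j).comp ha).max hv)
    exact Measurable.ite ((measurableSet_le measurable_const (measurable_card_pointsIn_box E ha hu)
      ).inter (measurableSet_le measurable_const (measurable_card_pointsIn_box E hl hb)))
      ((ihl ha hu).add (ihr hl hb)) (hQ ha hb)

end Measurability

/-! ### Independence of the structure points and the estimation points -/

open Classical in
/-- The sample that agrees with `d` on `S` and with `d'` outside `S`. -/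
noncomputable def mix (S : Finset (Fin n)) (d d' : Sample D K n) : Sample D K n := fun i =>
  if i ∈ S then d i else d' i

theorem map_mix (P : Measure ((Fin D → ℝ) × Fin K)) [IsProbabilityMeasure P]
    (S : Finset (Fin n)) :
    ((Measure.pi fun _ : Fin n => P).prod (Measure.pi fun _ : Fin n => P)).map
      (fun p => mix S p.1 p.2) = Measure.pi fun _ : Fin n => P := by
  classical
  refine (Measure.pi_eq fun A hA => ?_).symm
  have hm : Measurable fun p : Sample D K n × Sample D K n => mix S p.1 p.2 := by
    refine measurable_pi_iff.2 fun i => ?_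
    unfold mix
    by_cases hi : i ∈ S
    · simpa [hi, Function.comp_def] using (measurable_pi_apply i).comp measurable_fst
    · simpa [hi, Function.comp_def] using (measurable_pi_apply i).comp measurable_snd
  rw [Measure.map_apply hm (MeasurableSet.univ_pi hA)]
  have : (fun p : Sample D K n × Sample D K n => mix S p.1 p.2) ⁻¹' Set.pi Set.univ A =
      (Set.pi Set.univ fun i => if i ∈ S then A i else Set.univ) ×ˢ
        (Set.pi Set.univ fun i => if i ∈ S then Set.univ else A i) := by
    ext p
    simp only [Set.mem_preimage, Set.mem_pi, Set.mem_univ, true_implies, Set.mem_prod, mix,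
      ← forall_and]
    refine forall_congr' fun i => ?_
    by_cases hi : i ∈ S <;> simp [hi]
  rw [this, Measure.prod_prod, Measure.pi_pi, Measure.pi_pi, ← Finset.prod_mul_distrib]
  refine Finset.prod_congr rfl fun i _ => ?_
  by_cases hi : i ∈ S <;> simp [hi]

/-- The mixture of two independent samples has the law of a sample. An inequality holds without
measurability of `F`, and only an upper bound is needed. -/
theorem lintegral_le_lintegral_mix (P : Measure ((Fin D → ℝ) × Fin K)) [IsProbabilityMeasure P]
    (S : Finset (Fin n)) (F : Sample D K n → ℝ≥0∞) :
    ∫⁻ d, F d ∂(Measure.pi fun _ : Fin n => P) ≤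
      ∫⁻ d, ∫⁻ d', F (mix S d d') ∂(Measure.pi fun _ : Fin n => P)
        ∂(Measure.pi fun _ : Fin n => P) := by
  conv_lhs => rw [← map_mix P S]
  exact (lintegral_map_le _ _).trans (lintegral_prod_le _)

theorem fullTree_congr (T : (Fin K → ℝ) → ℝ) (B₁ B₂ : ℝ) {d d' : Sample D K n} (m : ℕ)
    {S : Finset (Fin n)} (h : ∀ i ∈ S, d i = d' i) :
    fullTree T B₁ B₂ d m S = fullTree T B₁ B₂ d' m S := by
  classical
  induction m generalizing S with
  | zero => rfl
  | succ m ih =>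
    have hl : ∀ j v, left d S j v = left d' S j v := fun j v =>
      Finset.filter_congr fun i hi => by rw [h i hi]
    have hr : ∀ j v, right d S j v = right d' S j v := fun j v =>
      Finset.filter_congr fun i hi => by rw [h i hi]
    have hsl : ∀ j v, left d' S j v ⊆ S := fun j v => Finset.filter_subset _ _
    have hsr : ∀ j v, right d' S j v ⊆ S := fun j v => Finset.filter_subset _ _
    have hc : ∀ A ⊆ S, classFreq d A = classFreq d' A := by
      intro A hA
      ext c
      unfold classFreq
      rw [Finset.filter_congr fun i hi => by rw [h i (hA hi)]]
    have hI : impurityDecrease T d S = impurityDecrease T d' S := by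
      ext j v
      unfold impurityDecrease
      rw [hl, hr, hc S subset_rfl, hc _ (hsl j v), hc _ (hsr j v)]
    have hV : splitValues d S = splitValues d' S := by
      ext j v
      rw [mem_splitValues, mem_splitValues]
      refine and_congr (exists_congr fun i => and_congr_right fun hi => ?_)
        (exists_congr fun i => and_congr_right fun hi => ?_) <;> rw [h i hi]
    have hF : splitFeatures d S = splitFeatures d' S := by
      ext j
      rw [mem_splitFeatures, mem_splitFeatures, hV]
    have hB : bestDecrease T d S = bestDecrease T d' S := by
      ext j
      simp only [bestDecrease, hV, hI]
    have ihl : ∀ j v, fullTree T B₁ B₂ d m (left d' S j v) = fullTree T B₁ B₂ d' m (left d' S j v) :=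
      fun j v => ih fun i hi => h i (hsl j v hi)
    have ihr : ∀ j v, fullTree T B₁ B₂ d m (right d' S j v) =
        fullTree T B₁ B₂ d' m (right d' S j v) :=
      fun j v => ih fun i hi => h i (hsr j v hi)
    by_cases hne : (splitFeatures d' S).Nonempty
    · have hne' : (splitFeatures d S).Nonempty := by rwa [hF]
      rw [fullTree, fullTree, dif_pos hne, dif_pos hne', expMech_minMax_congr hF hne' hne hB]
      congr 1
      ext1 j
      by_cases hv : (splitValues d' S j).Nonempty
      · have hv' : (splitValues d S j).Nonempty := by rwa [hV]
        rw [dif_pos hv, dif_pos hv',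
          expMech_minMax_congr (congrFun hV j) hv' hv (congrFun hI j)]
        simp only [hl, hr, ihl, ihr]
      · rw [dif_neg hv, dif_neg (by rwa [hV])]
    · rw [fullTree, fullTree, dif_neg hne, dif_neg (by rwa [hF])]

/-- Redraw the points outside `S`: the law of the unpruned tree is unchanged, so the bound for a
fixed tree applies under that law, with fresh estimation points. -/
theorem lintegral_expect_leafSum_devCost_le (P : Measure ((Fin D → ℝ) × Fin K))
    [IsProbabilityMeasure P] (T : (Fin K → ℝ) → ℝ) (B₁ B₂ : ℝ) {ε : ℝ} (hε0 : 0 < ε)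
    (hε1 : ε ≤ 1) {k : ℕ} (hk : 0 < k) (c : Fin K) (m : ℕ) (S E : Finset (Fin n))
    (hSE : Disjoint S E) (hkE : k ≤ E.card)
    (hP : ∀ᵐ d ∂(Measure.pi fun _ : Fin n => P), ∀ i, (d i).1 ∈ box 0 1) :
    ∫⁻ d, expect (fullTree T B₁ B₂ d m S)
        (fun t => leafSum k d (devCost P c d) t 0 1 (pointsIn d E 0 1))
        ∂(Measure.pi fun _ : Fin n => P) ≤
      ENNReal.ofReal (ε + pathTail ε k) := by
  refine (lintegral_le_lintegral_mix P S _).trans ?_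
  calc _ ≤ ∫⁻ _d, ENNReal.ofReal (ε + pathTail ε k) ∂(Measure.pi fun _ : Fin n => P) := by
        refine lintegral_mono fun d => ?_
        have h1 : ∀ d' : Sample D K n, expect (fullTree T B₁ B₂ (mix S d d') m S)
            (fun t => leafSum k (mix S d d') (devCost P c (mix S d d')) t 0 1
              (pointsIn (mix S d d') E 0 1)) =
            expect (fullTree T B₁ B₂ d m S)
              (fun t => leafSum k d' (devCost P c d') t 0 1 (pointsIn d' E 0 1)) := by
          intro d'
          have hS : ∀ i ∈ S, mix S d d' i = d i := fun i hi => by simp [mix, hi]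
          have hE : ∀ i ∈ E, mix S d d' i = d' i := fun i hi => by
            simp [mix, Finset.disjoint_right.1 hSE hi]
          have hpts : pointsIn (mix S d d') E 0 1 = pointsIn d' E 0 1 := by
            classical
            exact Finset.filter_congr fun i hi => by rw [hE i hi]
          have hsub : pointsIn d' E 0 1 ⊆ E := by
            classical exact Finset.filter_subset _ _
          rw [fullTree_congr T B₁ B₂ m hS, hpts]
          refine expect_congr fun t => leafSum_congr_sample t 0 1 _ (fun a b A hA => ?_)
            fun i hi => hE i (hsub hi)
          have : classFreq (mix S d d') A c = classFreq d' A c := by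
            unfold classFreq
            rw [Finset.filter_congr fun i hi => by rw [hE i (hsub (hA hi))]]
          rw [devCost, devCost, this]
        simp_rw [h1]
        rw [lintegral_expect _ _ fun t => measurable_leafSum_devCost P k c E t 0 1]
        refine expect_le_const fun t _ => ?_
        refine le_trans (le_of_eq (lintegral_congr_ae ?_))
          (lintegral_leafSum_devCost_le P hε0 hε1 hk c E hkE t hP)
        filter_upwards [hP] with d' hd'
        rw [pointsIn_eq_self fun i _ => hd' i]
    _ = _ := by simp

/-! ### Almost sure properties of the sample -/

theorem unitVolume_eq_restrict_Icc :
    unitVolume D = volume.restrict (Set.Icc (0 : Fin D → ℝ) 1) := by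
  have hbox : box (0 : Fin D → ℝ) 1 = Set.pi Set.univ fun _ => Set.Ioc 0 1 := by
    ext x; simp [box]
  rw [unitVolume, hbox]
  exact Measure.restrict_congr_set Measure.univ_pi_Ioc_ae_eq_Icc

section AlmostSure

variable (P : Measure ((Fin D → ℝ) × Fin K)) [IsProbabilityMeasure P]
  {f : (Fin D → ℝ) → ℝ≥0∞} (hPf : P.map Prod.fst = (unitVolume D).withDensity f)
include hPf

theorem map_fst_absolutelyContinuous : P.map Prod.fst ≪ unitVolume D := by
  rw [hPf]; exact withDensity_absolutelyContinuous _ _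

theorem ae_fst_mem_box : ∀ᵐ z ∂P, z.1 ∈ box 0 1 := by
  have h1 : ∀ᵐ x ∂(P.map Prod.fst), x ∈ box (0 : Fin D → ℝ) 1 :=
    (map_fst_absolutelyContinuous P hPf).ae_le (ae_restrict_mem (measurableSet_box 0 1))
  exact ae_of_ae_map measurable_fst.aemeasurable h1

theorem ae_forall_mem_box (n : ℕ) :
    ∀ᵐ d ∂(Measure.pi fun _ : Fin n => P), ∀ i, (d i).1 ∈ box (0 : Fin D → ℝ) 1 := by
  refine ae_all_iff.2 fun i => ?_
  exact (measurePreserving_eval (fun _ : Fin n => P) i).quasiMeasurePreserving.ae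
    (ae_fst_mem_box P hPf)

theorem restrict_box_map_fst : (P.map Prod.fst).restrict (box 0 1) = P.map Prod.fst := by
  refine Measure.restrict_eq_self_of_ae_mem ?_
  exact (map_fst_absolutelyContinuous P hPf).ae_le (ae_restrict_mem (measurableSet_box 0 1))

theorem measure_coordinate_eq_zero (j : Fin D) (r : ℝ) : P {z | z.1 j = r} = 0 := by
  have hm : MeasurableSet {x : Fin D → ℝ | x j = r} :=
    measurableSet_eq_fun (measurable_pi_apply j) measurable_const
  have h1 : (P.map Prod.fst) {x : Fin D → ℝ | x j = r} = 0 := by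
    refine map_fst_absolutelyContinuous P hPf (le_antisymm ?_ zero_le)
    rw [unitVolume]
    refine (Measure.restrict_apply_le _ _).trans ?_
    exact (Measure.pi_hyperplane (fun _ : Fin D => (volume : Measure ℝ)) j r).le
  rwa [Measure.map_apply measurable_fst hm] at h1

/-- Redrawing all points except the `i`-th makes coordinate `j` of the `i'`-th point independent of
that of the `i`-th; as it has no atoms, they differ almost surely. -/
theorem ae_injective (n : ℕ) :
    ∀ᵐ d ∂(Measure.pi fun _ : Fin n => P), ∀ j, Function.Injective fun i => (d i).1 j := by
  have hne : ∀ i i' : Fin n, i ≠ i' → ∀ j : Fin D,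
      ∀ᵐ d ∂(Measure.pi fun _ : Fin n => P), (d i).1 j ≠ (d i').1 j := by
    intro i i' hi j
    have hm : MeasurableSet {d : Sample D K n | (d i).1 j = (d i').1 j} :=
      measurableSet_eq_fun
        ((measurable_pi_apply j).comp (measurable_fst.comp (measurable_pi_apply i)))
        ((measurable_pi_apply j).comp (measurable_fst.comp (measurable_pi_apply i')))
    have : (Measure.pi fun _ : Fin n => P) {d : Sample D K n | (d i).1 j = (d i').1 j} = 0 := by
      rw [← lintegral_indicator_one hm]
      refine le_antisymm ((lintegral_le_lintegral_mix P {i} _).trans ?_) zero_le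
      have : ∀ d : Sample D K n, ∫⁻ d', Set.indicator {d : Sample D K n | (d i).1 j = (d i').1 j}
          1 (mix {i} d d') ∂(Measure.pi fun _ : Fin n => P) = 0 := by
        intro d
        have hm' : MeasurableSet {z : (Fin D → ℝ) × Fin K | z.1 j = (d i).1 j} :=
          ((measurable_pi_apply j).comp measurable_fst) (measurableSet_singleton _)
        calc _ = ∫⁻ d', Set.indicator {z : (Fin D → ℝ) × Fin K | z.1 j = (d i).1 j} 1 (d' i')
              ∂(Measure.pi fun _ : Fin n => P) := by
              refine lintegral_congr fun d' => ?_
              simp [Set.indicator, mix, hi.symm, eq_comm]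
          _ = ∫⁻ z, Set.indicator {z : (Fin D → ℝ) × Fin K | z.1 j = (d i).1 j} 1 z ∂P :=
              (measurePreserving_eval (fun _ : Fin n => P) i').lintegral_comp
                (measurable_one.indicator hm')
          _ = 0 := by
              rw [lintegral_indicator_one hm', measure_coordinate_eq_zero P hPf]
      simp [this]
    exact measure_eq_zero_iff_ae_notMem.1 this
  have : ∀ᵐ d ∂(Measure.pi fun _ : Fin n => P), ∀ i i' : Fin n, ∀ j : Fin D, i ≠ i' →
      (d i).1 j ≠ (d i').1 j := by
    refine ae_all_iff.2 fun i => ae_all_iff.2 fun i' => ae_all_iff.2 fun j => ?_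
    by_cases hi : i = i'
    · exact Eventually.of_forall fun _ h => absurd hi h
    · filter_upwards [hne i i' hi j] with d hd _ using hd
  filter_upwards [this] with d hd j i i' hii'
  by_contra hi
  exact hd i i' j hi hii'

end AlmostSure

/-! ### The leaves are narrow on average -/

/-- The constants are chosen in the order `R`, `τ`, `r₀`, `p`, `H`, `κ`, `ε`, each depending on the
previous ones only. Four quarters of `ψ` pay for the large density ratio, the small density, the
failure to cut within `H` levels, and the unbalanced splits. -/
theorem exists_expect_leafSum_spanCost_le (hD : 0 < D) (T : (Fin K → ℝ) → ℝ) {B₁ B₂ : ℝ}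
    (hB₁ : 0 ≤ B₁) (hB₂ : 0 ≤ B₂) {μ : Measure (Fin D → ℝ)} [IsProbabilityMeasure μ]
    {f : (Fin D → ℝ) → ℝ≥0∞} (hf : Measurable f) (hμ : μ = (unitVolume D).withDensity f)
    (hf0 : ∀ᵐ x ∂(unitVolume D), f x ≠ 0) {ψ w : ℝ} (hψ : 0 < ψ) (hw0 : 0 < w) (hw1 : w ≤ 1) :
    ∃ ε θ : ℝ, 0 < ε ∧ 0 < θ ∧ ∃ H : ℕ, ∀ (n : ℕ) (S E : Finset (Fin n)) (k m : ℕ)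
      (d : Sample D K n), H ≤ m → IsUniform μ ε d S → IsUniform μ ε d E →
      (∀ j, Function.Injective fun i => (d i).1 j) → (∀ i, (d i).1 ∈ box 0 1) →
      1 ≤ ε * S.card → (k : ℝ) ≤ E.card * θ → ∀ (j : Fin D) (q : ℝ),
      expect (fullTree T B₁ B₂ d m S)
        (fun t => leafSum k d (fun a b _ => spanCost j q w a b) t 0 1 E) ≤ ENNReal.ofReal ψ := by
  have hprob : IsProbabilityMeasure (unitVolume D) := isProbabilityMeasure_unitVolume
  set R : ℝ := 4 / ψ + 1 with hR
  have hR1 : 1 ≤ R := by have : 0 < 4 / ψ := by positivity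
                         linarith
  have hR0 : 0 < R := by linarith
  have hRψ : R⁻¹ ≤ ψ / 4 := by
    rw [inv_le_comm₀ hR0 (by positivity), inv_div]
    linarith
  obtain ⟨τ, hτ0, hτ1, hτ⟩ := exists_unitVolume_lt_le hf hf0
    (ε := ENNReal.ofReal (w / 2 * (ψ / 4))) (ENNReal.ofReal_pos.2 (by positivity))
  set r₀ : ℝ := τ * w / (2 * R) with hr₀
  have hr₀0 : 0 < r₀ := by positivity
  have hr₀1 : r₀ ≤ 1 := by
    rw [hr₀, div_le_one (by positivity)]
    nlinarith
  set p : ℝ := Real.exp (-(B₁ / 2)) / D * Real.exp (-(B₂ / 2)) * (r₀ / 2) with hp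
  have hD' : (1 : ℝ) ≤ D := by exact_mod_cast hD
  have hp0 : 0 < p := by positivity
  have hp1 : p ≤ 1 := by
    have h1 : Real.exp (-(B₁ / 2)) / D ≤ 1 := by
      rw [div_le_one (by linarith)]
      exact (Real.exp_le_one_iff.2 (by linarith)).trans hD'
    have h2 : Real.exp (-(B₂ / 2)) ≤ 1 := Real.exp_le_one_iff.2 (by linarith)
    have h3 : r₀ / 2 ≤ 1 := by linarith
    exact mul_le_one₀ (mul_le_one₀ h1 (Real.exp_pos _).le h2) (by positivity) h3
  obtain ⟨H, hH⟩ := exists_pow_lt_of_lt_one (show 0 < ψ / 4 by positivity)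
    (show 1 - p < 1 by linarith)
  -- The factor `H + 1` bounds the total imbalance over `H` levels and avoids a division by zero
  -- when `H = 0`.
  set κ : ℝ := min 1 (ψ / 4 / ((H + 1) * (3 * Real.exp (B₂ / 2)))) with hκ
  have hκ0 : 0 < κ := lt_min one_pos (by positivity)
  have hκ1 : κ ≤ 1 := min_le_left _ _
  have hκψ : H * (3 * κ * Real.exp (B₂ / 2)) ≤ ψ / 4 := by
    have h1 : κ * ((H + 1) * (3 * Real.exp (B₂ / 2))) ≤ ψ / 4 :=
      (le_div_iff₀ (by positivity)).1 (min_le_right _ _)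
    have h2 : 0 ≤ κ * Real.exp (B₂ / 2) := by positivity
    nlinarith
  set ε : ℝ := min (κ ^ H * (r₀ / 2) / (r₀ + 2)) (κ ^ (H + 1) / 4) with hε
  have hε0 : 0 < ε := lt_min (by positivity) (by positivity)
  have hεr : (r₀ + 2) * ε ≤ κ ^ H * (r₀ / 2) := by
    have := (le_div_iff₀ (show 0 < r₀ + 2 by positivity)).1
      (min_le_left (κ ^ H * (r₀ / 2) / (r₀ + 2)) (κ ^ (H + 1) / 4))
    rw [mul_comm]; exact this
  have hεκ : 4 * ε ≤ κ ^ (H + 1) := by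
    have := min_le_right (κ ^ H * (r₀ / 2) / (r₀ + 2)) (κ ^ (H + 1) / 4)
    rw [← hε] at this
    linarith
  refine ⟨ε, κ ^ H / 2, hε0, by positivity, H, ?_⟩
  intro n S E k m d hm hS hE hinj hbox hSc hk j q
  have hSp : pointsIn d S 0 1 = S := pointsIn_eq_self fun i _ => hbox i
  have hEp : pointsIn d E 0 1 = E := pointsIn_eq_self fun i _ => hbox i
  have key := expect_leafSum_spanCost_le (j := j) (q := q) T hB₁ hB₂ hf hμ hw0 hR0 hτ0 hr₀ hr₀1
    hκ0 hκ1 hεr hεκ hS hE hinj hSc hk le_rfl hm (a := 0) (b := 1) le_rfl le_rfl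
    (by rw [hSp])
  rw [hSp, hEp] at key
  refine key.trans ?_
  have h1 : badWeight μ f R τ w 0 1 ≤ ENNReal.ofReal (ψ / 4) + ENNReal.ofReal (ψ / 4) := by
    refine add_le_add ?_ ?_
    · calc _ ≤ (ENNReal.ofReal R)⁻¹ * 1 := by gcongr; exact prob_le_one
        _ = ENNReal.ofReal R⁻¹ := by rw [mul_one, ENNReal.ofReal_inv_of_pos hR0]
        _ ≤ _ := ENNReal.ofReal_le_ofReal hRψ
    · calc _ ≤ (ENNReal.ofReal (w / 2))⁻¹ * ENNReal.ofReal (w / 2 * (ψ / 4)) := by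
            gcongr
            exact (measure_mono Set.inter_subset_right).trans hτ
        _ = ENNReal.ofReal ((w / 2)⁻¹ * (w / 2 * (ψ / 4))) := by
            rw [← ENNReal.ofReal_inv_of_pos (by positivity), ← ENNReal.ofReal_mul (by positivity)]
        _ = ENNReal.ofReal (ψ / 4) := by
            congr 1
            field_simp
  calc _ ≤ ENNReal.ofReal (ψ / 4 + ψ / 4) * 1 +
        (ENNReal.ofReal (ψ / 4) + ENNReal.ofReal (ψ / 4)) := by
        refine add_le_add (mul_le_mul' (ENNReal.ofReal_le_ofReal ?_) prob_le_one) h1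
        exact add_le_add hH.le hκψ
    _ = _ := by
        rw [mul_one, ← ENNReal.ofReal_add (by positivity) (by positivity),
          ← ENNReal.ofReal_add (by positivity) (by positivity)]
        congr 1
        ring

section Bias

variable [NeZero K] (P : Measure ((Fin D → ℝ) × Fin K)) [IsProbabilityMeasure P]
  {f : (Fin D → ℝ) → ℝ≥0∞}

/-- Quarters of `δ` go to the continuous approximation, its oscillation, the mass where the density
exceeds `R`, and the wide leaves. -/
theorem exists_expect_leafSum_biasCost_le (hD : 0 < D) (T : (Fin K → ℝ) → ℝ) {B₁ B₂ : ℝ}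
    (hB₁ : 0 ≤ B₁) (hB₂ : 0 ≤ B₂) (hf : Measurable f)
    (hPf : P.map Prod.fst = (unitVolume D).withDensity f)
    (hf0 : ∀ᵐ x ∂(unitVolume D), f x ≠ 0) (c : Fin K) {δ : ℝ} (hδ : 0 < δ) :
    ∃ ε θ : ℝ, 0 < ε ∧ 0 < θ ∧ ∃ H : ℕ, ∀ (n : ℕ) (S E : Finset (Fin n)) (k m : ℕ)
      (d : Sample D K n), H ≤ m → IsUniform (P.map Prod.fst) ε d S →
      IsUniform (P.map Prod.fst) ε d E →
      (∀ j, Function.Injective fun i => (d i).1 j) → (∀ i, (d i).1 ∈ box 0 1) →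
      1 ≤ ε * S.card → (k : ℝ) ≤ E.card * θ →
      expect (fullTree T B₁ B₂ d m S)
        (fun t => leafSum k d (fun a b _ => biasCost P c a b) t 0 1 E) ≤ ENNReal.ofReal δ := by
  have hprob : IsProbabilityMeasure (P.map Prod.fst) :=
    Measure.isProbabilityMeasure_map measurable_fst.aemeasurable
  obtain ⟨h, hh, hhη⟩ := exists_uniformContinuous_approx P c (ε := ENNReal.ofReal (δ / 8))
    (ENNReal.ofReal_pos.2 (by positivity)).ne'
  obtain ⟨R, hR0, hR⟩ := exists_measure_lt_le hf hPf (ε := ENNReal.ofReal (δ / 4))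
    (ENNReal.ofReal_pos.2 (by positivity))
  obtain ⟨ω, hω, hhω⟩ := Metric.uniformContinuous_iff.1 hh (δ / 4) (by positivity)
  obtain ⟨N, hN⟩ := exists_nat_gt (2 / ω)
  have hN0' : (0 : ℝ) < N := lt_trans (by positivity) hN
  have hN0 : 0 < N := by exact_mod_cast hN0'
  have hN2 : 2 / (N : ℝ) < ω := by
    rw [div_lt_iff₀ hω] at hN
    rw [div_lt_iff₀ hN0', mul_comm]
    exact hN
  have hosc : ∀ x y, dist x y ≤ 2 / (N : ℝ) → |h x - h y| ≤ δ / 4 := by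
    intro x y hxy
    rw [← Real.dist_eq]
    exact (hhω (hxy.trans_lt hN2)).le
  have hR0' : (0 : ℝ) < R := by exact_mod_cast hR0
  have hD0' : (0 : ℝ) < D := by exact_mod_cast hD
  -- There are `D * N` pairs of a coordinate and a grid interval, and each volume is weighted by
  -- `R`.
  set ψ : ℝ := δ / 4 / (R * (D * N)) with hψ
  obtain ⟨ε, θ, hε, hθ, H, hmain⟩ := exists_expect_leafSum_spanCost_le (K := K) hD T hB₁ hB₂ hf hPf
    hf0 (ψ := ψ) (w := 1 / N) (by positivity) (by positivity)
    (by rw [div_le_one hN0']; exact_mod_cast hN0)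
  refine ⟨ε, θ, hε, hθ, H, ?_⟩
  intro n S E k m d hm hS hE hinj hbox hSc hk
  have hle := expect_mono (p := fullTree T B₁ B₂ d m S) fun t =>
    leafSum_biasCost_le P hf hPf (R : ℝ≥0∞) c hh.continuous.measurable hN0 hosc k d t E
  refine hle.trans ?_
  rw [expect_add, expect_const, expect_const_mul, expect_finset_sum]
  simp_rw [expect_finset_sum]
  have h1 : 2 * ∫⁻ x, ENNReal.ofReal |eta P x c - h x| ∂(P.map Prod.fst) ≤
      ENNReal.ofReal (δ / 4) := by
    calc _ ≤ 2 * ENNReal.ofReal (δ / 8) := by gcongr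
      _ = ENNReal.ofReal (2 * (δ / 8)) := by rw [ENNReal.ofReal_mul (by norm_num)]; simp
      _ = _ := by congr 1; ring
  have h2 : (R : ℝ≥0∞) * ∑ j : Fin D, ∑ i ∈ Finset.range N,
      expect (fullTree T B₁ B₂ d m S) (fun t =>
        leafSum k d (fun a b _ => spanCost j ((i : ℝ) / N) (1 / N) a b) t 0 1 E) ≤
      ENNReal.ofReal (δ / 4) := by
    calc _ ≤ (R : ℝ≥0∞) * ∑ j : Fin D, ∑ i ∈ Finset.range N, ENNReal.ofReal ψ := by
          gcongr with j _ i _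
          exact hmain n S E k m d hm hS hE hinj hbox hSc hk j _
      _ = ENNReal.ofReal (R * (D * (N * ψ))) := by
          rw [ENNReal.ofReal_mul (by positivity), ENNReal.ofReal_mul (by positivity),
            ENNReal.ofReal_mul (by positivity)]
          simp
      _ = _ := by
          congr 1
          rw [hψ]
          field_simp
  calc _ ≤ ENNReal.ofReal (δ / 4) + ENNReal.ofReal (δ / 4) + ENNReal.ofReal (δ / 4) +
        ENNReal.ofReal (δ / 4) := add_le_add (add_le_add (add_le_add h1 le_rfl) hR) h2
    _ = _ := by
        rw [← ENNReal.ofReal_add (by positivity) (by positivity),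
          ← ENNReal.ofReal_add (by positivity) (by positivity),
          ← ENNReal.ofReal_add (by positivity) (by positivity)]
        congr 1
        ring

end Bias

/-! ### Consistency -/

theorem tendsto_sizes {s k : ℕ → ℕ} {ρ : ℝ} (hρ : 0 < ρ)
    (hsρ : Tendsto (fun n => (s n : ℝ) / ((n : ℝ) - (s n : ℝ))) atTop (𝓝 ρ))
    (hkn : Tendsto (fun n : ℕ => (k n : ℝ) / (n : ℝ)) atTop (𝓝 0)) :
    Tendsto (fun n => (s n : ℝ)) atTop atTop ∧
      Tendsto (fun n : ℕ => (n : ℝ) - (s n : ℝ)) atTop atTop ∧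
      Tendsto (fun n : ℕ => (k n : ℝ) / ((n : ℝ) - (s n : ℝ))) atTop (𝓝 0) := by
  -- If `n - s n` vanished the quotient would be 0 by convention, which is excluded near the
  -- positive limit `ρ`.
  have hne : ∀ᶠ n : ℕ in atTop, (n : ℝ) - (s n : ℝ) ≠ 0 := by
    filter_upwards [hsρ.eventually (lt_mem_nhds hρ)] with n hn h0
    rw [h0, div_zero] at hn
    exact lt_irrefl _ hn
  have hr : Tendsto (fun n : ℕ => (n : ℝ) / ((n : ℝ) - (s n : ℝ))) atTop (𝓝 (1 + ρ)) := by
    refine (hsρ.const_add 1).congr' ?_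
    filter_upwards [hne] with n hn
    field_simp
    ring
  have hr' : Tendsto (fun n : ℕ => ((n : ℝ) - (s n : ℝ)) / (n : ℝ)) atTop (𝓝 (1 + ρ)⁻¹) := by
    refine (hr.inv₀ (by positivity)).congr fun n => ?_
    rw [inv_div]
  have h2 : Tendsto (fun n : ℕ => (n : ℝ) - (s n : ℝ)) atTop atTop := by
    refine (hr'.pos_mul_atTop (by positivity) tendsto_natCast_atTop_atTop).congr' ?_
    filter_upwards [eventually_gt_atTop 0] with n hn
    have : (n : ℝ) ≠ 0 := by positivity
    field_simp
  refine ⟨?_, h2, ?_⟩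
  · refine (hsρ.pos_mul_atTop hρ h2).congr' ?_
    filter_upwards [hne] with n hn
    field_simp
  · have := hkn.mul hr
    rw [zero_mul] at this
    refine this.congr' ?_
    filter_upwards [hne, eventually_gt_atTop 0] with n hn hn0
    have : (n : ℝ) ≠ 0 := by positivity
    field_simp

section Consistency

variable [NeZero K] (P : Measure ((Fin D → ℝ) × Fin K)) [IsProbabilityMeasure P]
  {f : (Fin D → ℝ) → ℝ≥0∞}

/-- The mean over the tree, given the sample and its partition, of the `L¹` distance between the
probability of the label `c` that the tree estimates and the true one. -/
noncomputable def labelError (T : (Fin K → ℝ) → ℝ) (B₁ B₂ : ℝ) (k : ℕ) (c : Fin K)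
    (S : Finset (Fin n)) (d : Sample D K n) : ℝ≥0∞ :=
  expect (fullTree T B₁ B₂ d n S) fun t => leafSum k d
    (fun a b A => ∫⁻ x in box a b, ENNReal.ofReal |classFreq d A c - eta P x c| ∂(P.map Prod.fst))
    t 0 1 Sᶜ

theorem labelError_le (T : (Fin K → ℝ) → ℝ) (B₁ B₂ : ℝ) (k : ℕ) (c : Fin K) (S : Finset (Fin n))
    (d : Sample D K n) :
    labelError P T B₁ B₂ k c S d ≤
      expect (fullTree T B₁ B₂ d n S) (fun t => leafSum k d (devCost P c d) t 0 1 Sᶜ) +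
        expect (fullTree T B₁ B₂ d n S)
          (fun t => leafSum k d (fun a b _ => biasCost P c a b) t 0 1 Sᶜ) := by
  rw [← expect_add]
  refine expect_mono fun t => ?_
  rw [← leafSum_add]
  refine leafSum_mono (fun a b A => ?_) t 0 1 _
  calc _ ≤ ∫⁻ x in box a b, (ENNReal.ofReal |classFreq d A c - cellProb P a b c| +
        ENNReal.ofReal |cellProb P a b c - eta P x c|) ∂(P.map Prod.fst) := by
        refine lintegral_mono fun x => ?_
        rw [← ENNReal.ofReal_add (abs_nonneg _) (abs_nonneg _)]
        exact ENNReal.ofReal_le_ofReal (abs_sub_le _ _ _)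
    _ = _ := by
        rw [lintegral_add_left measurable_const, setLIntegral_const, mul_comm]
        rfl

theorem expect_leafSum_biasCost_le_one (T : (Fin K → ℝ) → ℝ) (B₁ B₂ : ℝ) (k m : ℕ) (c : Fin K)
    (S E : Finset (Fin n)) (d : Sample D K n) :
    expect (fullTree T B₁ B₂ d m S)
      (fun t => leafSum k d (fun a b _ => biasCost P c a b) t 0 1 E) ≤ 1 := by
  have hprob : IsProbabilityMeasure (P.map Prod.fst) :=
    Measure.isProbabilityMeasure_map measurable_fst.aemeasurable
  refine expect_le_const fun t _ => ?_
  calc _ ≤ leafSum k d (fun a b _ => P.map Prod.fst (box a b)) t 0 1 E :=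
        leafSum_mono (fun a b _ => biasCost_le_measure P c a b) t 0 1 E
    _ = P.map Prod.fst (box 0 1) :=
        leafSum_additive _ (measure_box_split (P.map Prod.fst)) t 0 1 E
    _ ≤ 1 := prob_le_one

/-- Measurability of `labelError` in the sample is not established, so a measurable majorant is
produced: the expected deviation, plus the bias bound, plus the indicators of the events where
structure or estimation points fail to be uniform. On these events the bias is at most 1. The
threshold for `n` does not depend on which points are the structure points. -/
theorem eventually_labelError_le (hD : 0 < D) (hf : Measurable f)
    (hPf : P.map Prod.fst = (unitVolume D).withDensity f)
    (hf0 : ∀ᵐ x ∂(unitVolume D), f x ≠ 0) (T : (Fin K → ℝ) → ℝ) {B₁ B₂ : ℝ}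
    (hB₁ : 0 ≤ B₁) (hB₂ : 0 ≤ B₂) {s k : ℕ → ℕ} (hs : ∀ n, s n ≤ n) {ρ : ℝ} (hρ : 0 < ρ)
    (hsρ : Tendsto (fun n => (s n : ℝ) / ((n : ℝ) - (s n : ℝ))) atTop (𝓝 ρ))
    (hk : Tendsto k atTop atTop)
    (hkn : Tendsto (fun n : ℕ => (k n : ℝ) / (n : ℝ)) atTop (𝓝 0)) (c : Fin K) {δ : ℝ} (hδ : 0 < δ) :
    ∀ᶠ n in atTop, ∀ S : Finset (Fin n), S.card = s n → ∃ U : Sample D K n → ℝ≥0∞,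
      Measurable U ∧
      (∀ᵐ d ∂(Measure.pi fun _ : Fin n => P), labelError P T B₁ B₂ (k n) c S d ≤ U d) ∧
      ∫⁻ d, U d ∂(Measure.pi fun _ : Fin n => P) ≤ ENNReal.ofReal δ := by
  obtain ⟨ε, θ, hε, hθ, H, hbias⟩ := exists_expect_leafSum_biasCost_le P hD T hB₁ hB₂ hf hPf hf0 c
    (δ := δ / 5) (by positivity)
  obtain ⟨C, hC⟩ := exists_measure_not_isUniform_le P hf hPf hε
  obtain ⟨hs1, hs2, hk2⟩ := tendsto_sizes hρ hsρ hkn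
  have hC1 : Tendsto (fun n => C / (s n : ℝ)) atTop (𝓝 0) := hs1.const_div_atTop C
  have hC2 : Tendsto (fun n : ℕ => C / ((n : ℝ) - (s n : ℝ))) atTop (𝓝 0) := hs2.const_div_atTop C
  -- The deviation tolerance is unrelated to the uniformity tolerance `ε`; it must be at most 1 for
  -- the exponential bound.
  set ε' : ℝ := min 1 (δ / 5) with hε'
  have hε'0 : 0 < ε' := lt_min one_pos (by positivity)
  have hpt := (tendsto_pathTail hε'0).comp hk
  filter_upwards [eventually_ge_atTop H, hk.eventually_gt_atTop 0,
    hs1.eventually_ge_atTop (1 / ε), hs2.eventually_gt_atTop 0,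
    hk2.eventually (gt_mem_nhds hθ), hk2.eventually (gt_mem_nhds one_pos),
    hC1.eventually (gt_mem_nhds (show 0 < δ / 5 by positivity)),
    hC2.eventually (gt_mem_nhds (show 0 < δ / 5 by positivity)),
    hpt.eventually (gt_mem_nhds (show 0 < δ / 5 by positivity))]
    with n hnH hk0 hsn hen hkθ hk1 hCs hCe hpath S hS
  have hE : ((Sᶜ.card : ℕ) : ℝ) = (n : ℝ) - (s n : ℝ) := by
    rw [Finset.card_compl, Fintype.card_fin, hS, Nat.cast_sub (hs n)]
  have hS0 : 0 < S.card := by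
    have : (0 : ℝ) < s n := lt_of_lt_of_le (by positivity) hsn
    rw [hS]; exact_mod_cast this
  have hE0 : 0 < Sᶜ.card := by
    have : (0 : ℝ) < (Sᶜ.card : ℕ) := by rw [hE]; exact hen
    exact_mod_cast this
  have hkE : k n ≤ Sᶜ.card := by
    rw [div_lt_one hen, ← hE] at hk1
    exact_mod_cast hk1.le
  obtain ⟨Bad₁, hm₁, hP₁, hU₁⟩ := hC n S hS0
  obtain ⟨Bad₂, hm₂, hP₂, hU₂⟩ := hC n Sᶜ hE0
  have hbox := ae_forall_mem_box P hPf n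
  set V : Sample D K n → ℝ≥0∞ := fun d => expect (fullTree T B₁ B₂ d n S)
    (fun t => leafSum (k n) d (devCost P c d) t 0 1 (pointsIn d Sᶜ 0 1)) with hV
  have hVm : Measurable V := measurable_expect_fullTree T B₁ B₂ n S fun d₀ t =>
    measurable_leafSum_devCost_relabel P (k n) c Sᶜ d₀ t measurable_const measurable_const
  refine ⟨fun d => V d + (ENNReal.ofReal (δ / 5) + (Bad₁.indicator 1 d + Bad₂.indicator 1 d)),
    hVm.add (Measurable.const_add (Measurable.add (measurable_one.indicator hm₁)
      (measurable_one.indicator hm₂)) _), ?_, ?_⟩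
  · filter_upwards [hbox, ae_injective P hPf n] with d hd hinj
    refine (labelError_le P T B₁ B₂ (k n) c S d).trans ?_
    refine add_le_add ?_ ?_
    · rw [hV]
      simp only
      rw [pointsIn_eq_self (E := Sᶜ) fun i _ => hd i]
    · have hone := expect_leafSum_biasCost_le_one P T B₁ B₂ (k n) n c S Sᶜ d
      by_cases h1 : d ∈ Bad₁
      · refine hone.trans ?_
        rw [Set.indicator_of_mem h1]
        exact le_add_left (le_add_right le_rfl)
      by_cases h2 : d ∈ Bad₂
      · refine hone.trans ?_
        rw [Set.indicator_of_mem h2]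
        exact le_add_left (le_add_left le_rfl)
      refine le_add_right (hbias n S Sᶜ (k n) n d hnH (hU₁ d h1) (hU₂ d h2) hinj hd ?_ ?_)
      · rw [hS, mul_comm]
        exact (div_le_iff₀ hε).1 hsn
      · rw [hE, mul_comm]
        exact ((div_lt_iff₀ hen).1 hkθ).le
  · rw [lintegral_add_left hVm, lintegral_add_left measurable_const,
      lintegral_add_left (measurable_one.indicator hm₁), lintegral_indicator_one hm₁,
      lintegral_indicator_one hm₂, lintegral_const, measure_univ, mul_one]
    have hVle : ∫⁻ d, V d ∂(Measure.pi fun _ : Fin n => P) ≤ ENNReal.ofReal (δ / 5 + δ / 5) := by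
      refine (lintegral_expect_leafSum_devCost_le P T B₁ B₂ hε'0 (min_le_left _ _) hk0 c n S Sᶜ
        disjoint_compl_right hkE hbox).trans (ENNReal.ofReal_le_ofReal ?_)
      exact add_le_add (min_le_right _ _) hpath.le
    have h1 : (Measure.pi fun _ : Fin n => P) Bad₁ ≤ ENNReal.ofReal (δ / 5) := by
      refine hP₁.trans (ENNReal.ofReal_le_ofReal ?_)
      rw [hS]; exact hCs.le
    have h2 : (Measure.pi fun _ : Fin n => P) Bad₂ ≤ ENNReal.ofReal (δ / 5) := by
      refine hP₂.trans (ENNReal.ofReal_le_ofReal ?_)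
      rw [hE]; exact hCe.le
    calc _ ≤ ENNReal.ofReal (δ / 5 + δ / 5) + (ENNReal.ofReal (δ / 5) +
          (ENNReal.ofReal (δ / 5) + ENNReal.ofReal (δ / 5))) :=
          add_le_add hVle (add_le_add le_rfl (add_le_add h1 h2))
      _ = _ := by
          rw [← ENNReal.ofReal_add (by positivity) (by positivity),
            ← ENNReal.ofReal_add (by positivity) (by positivity),
            ← ENNReal.ofReal_add (by positivity) (by positivity)]
          congr 1
          ring

theorem measurable_treePrediction (T : (Fin K → ℝ) → ℝ) (B₁ B₂ : ℝ) (k s : ℕ) (hs : s ≤ n)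
    (rule : (Fin K → ℝ) → PMF (Fin K)) (d : Sample D K n) (c : Fin K) :
    Measurable fun x => treePrediction T B₁ B₂ k s hs rule d x c := by
  have : (fun x => treePrediction T B₁ B₂ k s hs rule d x c) = fun x =>
      expect (structureSet n s hs) fun S => expect (grow T B₁ B₂ k d n S Sᶜ) fun t =>
        rule (classFreq d (t.leafPoints d x Sᶜ)) c := rfl
  rw [this]
  exact measurable_expect _ fun S => measurable_expect _ fun t =>
    measurable_leafPoints (Ψ := fun _ A => rule (classFreq d A) c) (fun A => measurable_const) t _

theorem lintegral_expect_gap_le (hPf : P.map Prod.fst = (unitVolume D).withDensity f)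
    (T : (Fin K → ℝ) → ℝ) (B₁ B₂ : ℝ) (k s : ℕ) (hs : s ≤ n)
    {rule : (Fin K → ℝ) → PMF (Fin K)} {δ : ℝ≥0∞} (hr : IsNearMaximal rule δ)
    (d : Sample D K n) :
    ∫⁻ x, expect (treePrediction T B₁ B₂ k s hs rule d x) (gap P x) ∂(P.map Prod.fst) ≤
      δ + 2 * expect (structureSet n s hs) fun S => ∑ c, labelError P T B₁ B₂ k c S d := by
  have hprob : IsProbabilityMeasure (P.map Prod.fst) :=
    Measure.isProbabilityMeasure_map measurable_fst.aemeasurable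
  set L : Fin K → (Fin D → ℝ) → Finset (Fin n) → ℝ≥0∞ := fun c x A =>
    ENNReal.ofReal |classFreq d A c - eta P x c| with hL
  have hLA : ∀ c A, Measurable fun x => L c x A := fun c A =>
    ((measurable_eta P c).const_sub _).abs.ennreal_ofReal
  have hLm : ∀ (c : Fin K) (t : Tree D) (E : Finset (Fin n)),
      Measurable fun x => L c x (t.leafPoints d x E) := fun c t E =>
    measurable_leafPoints (Ψ := L c) (hLA c) t E
  have hsum : ∀ (t : Tree D) (E : Finset (Fin n)), Measurable fun x => ∑ c, L c x (t.leafPoints d x E) := fun t E =>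
    Finset.measurable_sum _ fun c _ => hLm c t E
  set G : Finset (Fin n) → Tree D → (Fin D → ℝ) → ℝ≥0∞ := fun S t x =>
    δ + 2 * ∑ c, L c x (t.leafPoints d x Sᶜ) with hG
  have hGm : ∀ S t, Measurable (G S t) := fun S t =>
    measurable_const.add ((hsum t _).const_mul 2)
  have h1 : ∀ x, expect (treePrediction T B₁ B₂ k s hs rule d x) (gap P x) ≤
      expect (structureSet n s hs) fun S => expect (grow T B₁ B₂ k d n S Sᶜ) fun t => G S t x := by
    intro x
    rw [treePrediction, expect_bind]
    refine expect_mono fun S => ?_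
    rw [expect_bind]
    exact expect_mono fun t => expect_gap_le P hr _ x
  have h2 : ∀ S t, ∫⁻ x, G S t x ∂(P.map Prod.fst) =
      δ + 2 * ∑ c, ∫⁻ x, L c x (t.leafPoints d x Sᶜ) ∂(P.map Prod.fst) := by
    intro S t
    rw [hG]
    simp only
    rw [lintegral_add_left measurable_const, lintegral_const, measure_univ, mul_one,
      lintegral_const_mul _ (hsum t _), lintegral_finsetSum _ fun c _ => hLm c t _]
  have h3 : ∀ S c, expect (grow T B₁ B₂ k d n S Sᶜ)
      (fun t => ∫⁻ x, L c x (t.leafPoints d x Sᶜ) ∂(P.map Prod.fst)) =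
      labelError P T B₁ B₂ k c S d := by
    intro S c
    rw [expect_grow, labelError]
    refine expect_congr fun t => ?_
    rw [← setLIntegral_leafPoints (P.map Prod.fst) (L c), restrict_box_map_fst P hPf]
  have h4 : ∀ S, ∫⁻ x, expect (grow T B₁ B₂ k d n S Sᶜ) (fun t => G S t x) ∂(P.map Prod.fst) =
      δ + 2 * ∑ c, labelError P T B₁ B₂ k c S d := by
    intro S
    rw [lintegral_expect _ _ (hGm S), expect_congr (h2 S), expect_add, expect_const,
      expect_const_mul, expect_finset_sum, Finset.sum_congr rfl fun c _ => h3 S c]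
  refine (lintegral_mono h1).trans (le_of_eq ?_)
  rw [lintegral_expect _ _ fun S => measurable_expect _ (hGm S), expect_congr h4, expect_add,
    expect_const, expect_const_mul]

theorem expectedError_le {M : ℕ} (hM : 0 < M) {vote : (Fin M → Fin K) → Fin K}
    (hvote : IsMajorityVote vote) (hPf : P.map Prod.fst = (unitVolume D).withDensity f)
    (T : (Fin K → ℝ) → ℝ) (B₁ B₂ : ℝ) (k s : ℕ) (hs : s ≤ n)
    {rule : (Fin K → ℝ) → PMF (Fin K)} {δ ε : ℝ≥0∞} (hr : IsNearMaximal rule δ)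
    (hU : ∀ c : Fin K, ∀ S : Finset (Fin n), S.card = s → ∃ U : Sample D K n → ℝ≥0∞,
      Measurable U ∧ (∀ᵐ d ∂(Measure.pi fun _ : Fin n => P), labelError P T B₁ B₂ k c S d ≤ U d) ∧
      ∫⁻ d, U d ∂(Measure.pi fun _ : Fin n => P) ≤ ε) :
    expectedError P T B₁ B₂ vote rule n k s hs ≤ bayesRisk P + M * (δ + 2 * (K * ε)) := by
  -- The majorant is extended by 0 to sets of the wrong size, which the partition law never selects,
  -- so that a choice is available for all `S`.
  have hU' : ∀ (c : Fin K) (S : Finset (Fin n)), ∃ U : Sample D K n → ℝ≥0∞, Measurable U ∧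
      (S.card = s → (∀ᵐ d ∂(Measure.pi fun _ : Fin n => P),
        labelError P T B₁ B₂ k c S d ≤ U d) ∧
        ∫⁻ d, U d ∂(Measure.pi fun _ : Fin n => P) ≤ ε) := by
    intro c S
    by_cases hS : S.card = s
    · obtain ⟨U, hUm, h⟩ := hU c S hS
      exact ⟨U, hUm, fun _ => h⟩
    · exact ⟨0, measurable_zero, fun h => absurd h hS⟩
  choose U hUm hUS using hU'
  have hcard : ∀ S ∈ (structureSet n s hs).support, S.card = s := by
    intro S hS
    simpa [structureSet] using hS
  have hae : ∀ᵐ d ∂(Measure.pi fun _ : Fin n => P), ∀ (c : Fin K) (S : Finset (Fin n)),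
      S.card = s → labelError P T B₁ B₂ k c S d ≤ U c S d := by
    refine ae_all_iff.2 fun c => ae_all_iff.2 fun S => ?_
    by_cases hS : S.card = s
    · filter_upwards [(hUS c S hS).1] with d hd _ using hd
    · exact Eventually.of_forall fun _ h => absurd h hS
  have hsum : ∀ S, Measurable fun d => ∑ c, U c S d := fun S =>
    Finset.measurable_sum _ fun c _ => hUm c S
  have hW : Measurable fun d => expect (structureSet n s hs) fun S => ∑ c, U c S d :=
    measurable_expect _ hsum
  have hmain : ∫⁻ d, expect (structureSet n s hs) (fun S => ∑ c, U c S d)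
      ∂(Measure.pi fun _ : Fin n => P) ≤ K * ε := by
    rw [lintegral_expect _ _ hsum]
    refine expect_le_const fun S hS => ?_
    rw [lintegral_finsetSum _ fun c _ => hUm c S]
    calc _ ≤ ∑ _c : Fin K, ε := Finset.sum_le_sum fun c _ => (hUS c S (hcard S hS)).2
      _ = K * ε := by simp
  calc expectedError P T B₁ B₂ vote rule n k s hs
      ≤ ∫⁻ d, (bayesRisk P + M * (δ + 2 * expect (structureSet n s hs) fun S => ∑ c, U c S d))
          ∂(Measure.pi fun _ : Fin n => P) := by
        refine lintegral_mono_ae ?_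
        filter_upwards [hae] with d hd
        refine (lintegral_voteError_le P hM hvote
          (measurable_treePrediction T B₁ B₂ k s hs rule d)).trans ?_
        gcongr
        refine (lintegral_expect_gap_le P hPf T B₁ B₂ k s hs hr d).trans ?_
        gcongr
        exact expect_mono_support fun S hS =>
          Finset.sum_le_sum fun c _ => hd c S (hcard S hS)
    _ = bayesRisk P + M * (δ + 2 * ∫⁻ d, expect (structureSet n s hs) (fun S => ∑ c, U c S d)
          ∂(Measure.pi fun _ : Fin n => P)) := by
        have hW' : Measurable fun d => δ + 2 * expect (structureSet n s hs) fun S =>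
          ∑ c, U c S d := measurable_const.add (hW.const_mul 2)
        rw [lintegral_add_left measurable_const, lintegral_const_mul _ hW',
          lintegral_add_left measurable_const, lintegral_const_mul _ hW]
        simp
    _ ≤ _ := by gcongr

theorem bayesRisk_le_expectedError {M : ℕ} (vote : (Fin M → Fin K) → Fin K)
    (T : (Fin K → ℝ) → ℝ) (B₁ B₂ : ℝ) (k s : ℕ) (hs : s ≤ n)
    (rule : (Fin K → ℝ) → PMF (Fin K)) :
    bayesRisk P ≤ expectedError P T B₁ B₂ vote rule n k s hs := by
  calc bayesRisk P = ∫⁻ _d : Sample D K n, bayesRisk P ∂(Measure.pi fun _ : Fin n => P) := by simp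
    _ ≤ _ := lintegral_mono fun d => bayesRisk_le_lintegral_voteError P vote
      (measurable_treePrediction T B₁ B₂ k s hs rule d)

/-- The Bayes risk is a lower bound for every `n`, and the upper bound `bayesRisk P + M * (δ + 2Kε)`
is eventually below any larger number, since `ε` is arbitrary and `δ → 0`. -/
theorem tendsto_expectedError {M : ℕ} (hD : 0 < D) (hM : 0 < M) (hf : Measurable f)
    (hPf : P.map Prod.fst = (unitVolume D).withDensity f)
    (hf0 : ∀ᵐ x ∂(unitVolume D), f x ≠ 0) (T : (Fin K → ℝ) → ℝ) {B₁ B₂ : ℝ}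
    (hB₁ : 0 ≤ B₁) (hB₂ : 0 ≤ B₂) {vote : (Fin M → Fin K) → Fin K} (hvote : IsMajorityVote vote)
    {s k : ℕ → ℕ} (hs : ∀ n, s n ≤ n) {ρ : ℝ} (hρ : 0 < ρ)
    (hsρ : Tendsto (fun n => (s n : ℝ) / ((n : ℝ) - (s n : ℝ))) atTop (𝓝 ρ))
    (hk : Tendsto k atTop atTop)
    (hkn : Tendsto (fun n : ℕ => (k n : ℝ) / (n : ℝ)) atTop (𝓝 0))
    {rule : ℕ → (Fin K → ℝ) → PMF (Fin K)} {δ : ℕ → ℝ≥0∞}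
    (hr : ∀ᶠ n in atTop, IsNearMaximal (rule n) (δ n)) (hδ : Tendsto δ atTop (𝓝 0)) :
    Tendsto (fun n => expectedError P T B₁ B₂ vote (rule n) n (k n) (s n) (hs n)) atTop
      (𝓝 (bayesRisk P)) := by
  refine tendsto_order.2 ⟨fun a ha => Eventually.of_forall fun n =>
    ha.trans_le (bayesRisk_le_expectedError P vote T B₁ B₂ (k n) (s n) (hs n) (rule n)),
    fun b hb => ?_⟩
  have hlim : Tendsto (fun ε : ℝ≥0∞ => bayesRisk P + M * (ε + 2 * (K * ε))) (𝓝 0)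
      (𝓝 (bayesRisk P + M * (0 + 2 * (K * 0)))) := by
    have hK : Tendsto (fun ε : ℝ≥0∞ => (K : ℝ≥0∞) * ε) (𝓝 0) (𝓝 (K * 0)) :=
      ENNReal.Tendsto.const_mul tendsto_id (Or.inr (ENNReal.natCast_ne_top K))
    exact (ENNReal.Tendsto.const_mul (tendsto_id.add
      (ENNReal.Tendsto.const_mul hK (Or.inr ENNReal.ofNat_ne_top)))
      (Or.inr (ENNReal.natCast_ne_top M))).const_add _
  simp only [mul_zero, add_zero] at hlim
  obtain ⟨ε, hε0, hε⟩ : ∃ ε : ℝ, 0 < ε ∧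
      bayesRisk P + M * (ENNReal.ofReal ε + 2 * (K * ENNReal.ofReal ε)) < b := by
    have h1 : Tendsto ENNReal.ofReal (𝓝[>] 0) (𝓝 0) := by
      have := (ENNReal.continuous_ofReal.tendsto 0).mono_left
        (nhdsWithin_le_nhds (s := Set.Ioi (0 : ℝ)))
      rwa [ENNReal.ofReal_zero] at this
    obtain ⟨ε, hε, hε0⟩ := (((hlim.comp h1).eventually (gt_mem_nhds hb)).and
      self_mem_nhdsWithin).exists
    exact ⟨ε, hε0, hε⟩
  have hU : ∀ᶠ n in atTop, ∀ c : Fin K, ∀ S : Finset (Fin n), S.card = s n →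
      ∃ U : Sample D K n → ℝ≥0∞, Measurable U ∧
      (∀ᵐ d ∂(Measure.pi fun _ : Fin n => P), labelError P T B₁ B₂ (k n) c S d ≤ U d) ∧
      ∫⁻ d, U d ∂(Measure.pi fun _ : Fin n => P) ≤ ENNReal.ofReal ε :=
    eventually_all.2 fun c =>
      eventually_labelError_le P hD hf hPf hf0 T hB₁ hB₂ hs hρ hsρ hk hkn c hε0
  filter_upwards [hU, hr, hδ.eventually (gt_mem_nhds (ENNReal.ofReal_pos.2 hε0))]
    with n hUn hrn hδn
  refine lt_of_le_of_lt ?_ hε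
  refine (expectedError_le P hM hvote hPf T B₁ B₂ (k n) (s n) (hs n) hrn hUn).trans ?_
  gcongr

end Consistency

end MRF
theorem theorem1 {D K M : ℕ} [NeZero K] (hD : 0 < D) (hM : 0 < M)
    -- the law of `(X, Y)`; `X` has a density on `[0,1]^D` that is nonzero almost everywhere
    (P : Measure ((Fin D → ℝ) × Fin K)) [IsProbabilityMeasure P]
    (f : (Fin D → ℝ) → ℝ≥0∞) (hf : Measurable f)
    (hPf : P.map Prod.fst = (volume.restrict (Set.Icc (0 : Fin D → ℝ) 1)).withDensity f)
    (hf0 : ∀ᵐ x ∂(volume.restrict (Set.Icc (0 : Fin D → ℝ) 1)), f x ≠ 0)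
    -- impurity criterion, hyper-parameters, and majority vote over the `M` trees
    (T : (Fin K → ℝ) → ℝ) (B₁ B₂ : ℝ) (hB₁ : 0 ≤ B₁) (hB₂ : 0 ≤ B₂)
    (vote : (Fin M → Fin K) → Fin K) (hvote : MRF.IsMajorityVote vote)
    -- number of structure points: the partition rate is asymptotically `ρ`
    (s : ℕ → ℕ) (hs : ∀ n, s n ≤ n) (ρ : ℝ) (hρ : 0 < ρ)
    (hsρ : Tendsto (fun n => (s n : ℝ) / ((n : ℝ) - (s n : ℝ))) atTop (𝓝 ρ))
    -- minimum leaf size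
    (k : ℕ → ℕ) (hk : Tendsto k atTop atTop)
    (hkn : Tendsto (fun n => (k n : ℝ) / (n : ℝ)) atTop (𝓝 0)) :
    (∀ B₃ : ℕ → ℝ, Tendsto B₃ atTop atTop →
      Tendsto (fun n => MRF.expectedError P T B₁ B₂ vote (MRF.randomLabel (B₃ n))
        n (k n) (s n) (hs n)) atTop (𝓝 (MRF.bayesRisk P))) ∧
    Tendsto (fun n => MRF.expectedError P T B₁ B₂ vote MRF.majorityLabel
      n (k n) (s n) (hs n)) atTop (𝓝 (MRF.bayesRisk P)) := by
  -- The half-open cube has the same restricted volume and fits the half-open cells of the tree.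
  rw [← MRF.unitVolume_eq_restrict_Icc] at hPf hf0
  refine ⟨fun B₃ hB₃ => ?_, ?_⟩
  · refine MRF.tendsto_expectedError P hD hM hf hPf hf0 T hB₁ hB₂ hvote hs hρ hsρ hk hkn
      (δ := fun n => ENNReal.ofReal (K * (2 / B₃ n))) ?_ ?_
    · filter_upwards [hB₃.eventually_gt_atTop 0] with n hn
      exact MRF.isNearMaximal_randomLabel hn
    · have h := ((hB₃.const_div_atTop 2).const_mul (K : ℝ))
      rw [mul_zero] at h
      have := (ENNReal.continuous_ofReal.tendsto 0).comp h
      rwa [ENNReal.ofReal_zero] at this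
  · exact MRF.tendsto_expectedError P hD hM hf hPf hf0 T hB₁ hB₂ hvote hs hρ hsρ hk hkn
      (rule := fun _ => MRF.majorityLabel) (δ := fun _ => 0)
      (Eventually.of_forall fun _ => MRF.isNearMaximal_majorityLabel) tendsto_const_nhds
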